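/- **Setting.** Let $\bigwedge_*$ be the complex Grassmann algebra on generators $\zeta_1,\zeta_2,\dots$, with either $L\ge 2$ generators ($*=L$) or countably many ($*=\infty$, the direct limit of the finite ones); $\bigwedge_*^0$ and $\bigwedge_*^1$ are its even and odd parts, $x=x_B+x_S$ is the decomposition of a supernumber into body $x_B\in\mathbb C$ and soul, and $\bigwedge_{*-2}\subseteq\bigwedge_*$ is the subalgebra generated by $\zeta_1,\dots,\zeta_{L-2}$ (by all $\zeta_j$ if $*=\infty$). A set is DeWitt open in $\bigwedge_*^0\oplus(\bigwedge_*^1)^2$ if it is the preimage of an open subset of $\mathbb C$ under $(z,\theta^+,\theta^-)\mapsto z_B$. A superanalytic function of the even variable $z$ is $f(z)=\sum_{l\ge0}\frac{z_S^l}{l!}f^{(l)}(z_B)$ with $f(z_B)=\sum_k f_k(z_B)\,\zeta_{k_1}\cdots\zeta_{k_s}$, the $f_k$ analytic and the monomials in $\bigwedge_{*-2}$. A superanalytic function of $(z,\theta^+,\theta^-)$ is $f_0(z)+\theta^+f_1(z)+\theta^-f_2(z)+\theta^+\theta^-f_{12}(z)$ with such $f_0,f_1,f_2,f_{12}$. With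 $D^\pm=\partial/\partial\theta^\pm+\theta^\mp\,\partial/\partial z$, a map $H=(\tilde z,\tilde\theta^+,\tilde\theta^-)$ from a DeWitt open set to $\bigwedge_*^0\oplus(\bigwedge_*^1)^2$ is N=2 superconformal if $\tilde z,\tilde\theta^\pm$ are superanalytic, $D^\pm\tilde\theta^\mp=0$, $D^\pm\tilde z=\tilde\theta^\mp D^\pm\tilde\theta^\pm$, and neither $D^+\tilde\theta^+$ nor $D^-\tilde\theta^-$ is identically zero. For $n\in\mathbb Z$, the super-Riemann sphere $S^2\hat{\mathbb C}(n)$ is obtained from two copies (southern and northern chart) of $\bigwedge_*^0\oplus(\bigwedge_*^1)^2$ by identifying the northern point $(z,\theta^+,\theta^-)$, $z$ invertible, with the southern point $I_n(z,\theta^+,\theta^-)=(1/z,\ i\theta^+z^{n-1},\ i\theta^-z^{-n-1})$. An N=2 superconformal automorphism of $S^2\hat{\mathbb C}(n)$ is a bijection of it onto itself whose expressions in the two charts are N=2 superconformal wherever they have non-empty domain. $T_{\mathsf S}$ denotes the expression of $T$ in the southern chart. **Theorem.** Every N=2 superconformal automorphism $T$ of $S^2\hat{\mathbb C}(n)$ is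 uniquely determined by $T_{\mathsf S}$. Moreover there are superanalytic functions $f,g^\pm$ (even) and $\psi^\pm$ (odd) of $z$ with $f'=(\psi^+)'\psi^--\psi^+(\psi^-)'+g^+g^-$ such that $T_{\mathsf S}(z,\theta^+,\theta^-)=(\tilde z,\tilde\theta^+,\tilde\theta^-)$ is given by $$\tilde z=f+\theta^+g^+\psi^-+\theta^-g^-\psi^++\theta^+\theta^-(\psi^+\psi^-)',\qquad \tilde\theta^\pm=\psi^\pm+\theta^\pm g^\pm\pm\theta^+\theta^-(\psi^\pm)',$$ and there are $a,b,c,d\in\bigwedge^0_{*-2}$ with $ad-bc=1$ such that the domain of $T_{\mathsf S}$ is the set where $cz+d$ is invertible, and on it $$f(z)=\frac{az+b}{cz+d},$$ and the following holds, for the same $a,b,c,d$. If $n=0$: for some $\psi^\pm_0,\psi^\pm_1\in\bigwedge^1_{*-2}$, some $\epsilon^\pm\in(\bigwedge^0_{*-2})^\times$ and some $f^\pm,h^\pm\in\bigwedge^0_{*-2}$, $$\psi^\pm(z)=\frac{\psi^\pm_1z+\psi^\pm_0}{cz+d},\qquad g^\pm(z)=\frac{\epsilon^\pm}{cz+d}+\frac{f^\pm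 z+h^\pm}{(cz+d)^2},$$ where $\epsilon^+\epsilon^-=1-\psi_1^+\psi_0^--\psi_1^-\psi_0^+$, $f^\pm=\mp\epsilon^\pm\psi_1^+\psi_1^-d$ and $h^\pm=\pm\epsilon^\pm\bigl(\psi_0^+\psi_0^-c-(\psi_1^+\psi_0^--\psi_1^-\psi_0^+)d\mp\psi_1^+\psi_1^-\psi_0^+\psi_0^-d\bigr)$. If $n=1$: for some $\psi_0^+,\psi_0^-,\psi_1^-,\psi_2^-\in\bigwedge^1_{*-2}$ and $\epsilon\in(\bigwedge^0_{*-2})^\times$, $$\psi^+(z)=\psi^+_0,\quad \psi^-(z)=\frac{\psi^-_2z^2+\psi^-_1z+\psi^-_0}{(cz+d)^2},\quad g^+(z)=\epsilon,\quad g^-(z)=\frac1{\epsilon(cz+d)^2}+\frac{\psi_0^+(2\psi_2^-dz-\psi_1^-(cz-d)-2\psi_0^-c)}{\epsilon(cz+d)^3}.$$ If $n=-1$: for some $\psi_0^-,\psi_0^+,\psi_1^+,\psi_2^+\in\bigwedge^1_{*-2}$ and $\epsilon\in(\bigwedge^0_{*-2})^\times$, $$\psi^+(z)=\frac{\psi^+_2z^2+\psi^+_1z+\psi^+_0}{(cz+d)^2},\quad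 \psi^-(z)=\psi^-_0,\quad g^+(z)=\frac1{\epsilon(cz+d)^2}-\frac{(2\psi_2^+dz-\psi_1^+(cz-d)-2\psi_0^+c)\psi_0^-}{\epsilon(cz+d)^3},\quad g^-(z)=\epsilon.$$ If $n\ge2$: for some $\psi_0^-,\dots,\psi_{n+1}^-\in\bigwedge^1_{*-2}$ and $\epsilon\in(\bigwedge^0_{*-2})^\times$, $$\psi^+(z)=0,\quad \psi^-(z)=\frac{\psi^-_{n+1}z^{n+1}+\cdots+\psi^-_1z+\psi^-_0}{(cz+d)^{n+1}},\quad g^\pm(z)=\epsilon^{\pm1}(cz+d)^{\pm n-1}.$$ If $n\le-2$: for some $\psi_0^+,\dots,\psi_{-n+1}^+\in\bigwedge^1_{*-2}$ and $\epsilon\in(\bigwedge^0_{*-2})^\times$, $$\psi^+(z)=\frac{\psi^+_{-n+1}z^{-n+1}+\cdots+\psi^+_1z+\psi^+_0}{(cz+d)^{-n+1}},\quad \psi^-(z)=0,\quad g^\pm(z)=\epsilon^{\mp1}(cz+d)^{\pm n-1}.$$ -/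

import Mathlib

open scoped Topology

namespace N2

/-! ### Grassmann algebras -/

/-- The index set of the generators of the Grassmann algebra on `L` generators,
`L = 0, 1, 2, …` or `L = ∞`. The index `i` stands for the generator `ζ_{i+1}`. -/
abbrev Gen (L : ℕ∞) : Type := {i : ℕ // (i : ℕ∞) < L}

/-- The Grassmann algebra on `L` generators: the exterior algebra of the complex vector space with
basis `Gen L`. For `L = ∞` it is the union (direct limit) of the finite ones. -/
abbrev Gr (L : ℕ∞) : Type := ExteriorAlgebra ℂ (Gen L →₀ ℂ)

variable {L : ℕ∞}

/-- The generators `ζ`. -/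
noncomputable def zeta (i : Gen L) : Gr L := ExteriorAlgebra.ι ℂ (Finsupp.single i 1)

/-- The monomial `ζ_{k₁} ζ_{k₂} ⋯ ζ_{kₛ}` for `k = {k₁ < k₂ < ⋯ < kₛ}`. -/
noncomputable def zetaProd (k : Finset (Gen L)) : Gr L := ((k.sort (· ≤ ·)).map zeta).prod

/-- The even part of the Grassmann algebra. -/
noncomputable def even (L : ℕ∞) : Submodule ℂ (Gr L) :=
  CliffordAlgebra.evenOdd (0 : QuadraticForm ℂ (Gen L →₀ ℂ)) 0

/-- The odd part of the Grassmann algebra. -/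
noncomputable def odd (L : ℕ∞) : Submodule ℂ (Gr L) :=
  CliffordAlgebra.evenOdd (0 : QuadraticForm ℂ (Gen L →₀ ℂ)) 1

/-- The generators of the Grassmann subalgebra on `L - 2` generators (all generators if `L = ∞`). -/
def IsLow (i : Gen L) : Prop := ((i : ℕ) : ℕ∞) + 2 < L

/-- The Grassmann algebra on `L - 2` generators, as a subalgebra of the one on `L` generators. -/
noncomputable def lowAlg (L : ℕ∞) : Subalgebra ℂ (Gr L) := Algebra.adjoin ℂ {x | ∃ i : Gen L, IsLow i ∧ x = zeta i}

/-- The even part of the Grassmann algebra on `L - 2` generators. -/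
noncomputable def lowEven (L : ℕ∞) : Submodule ℂ (Gr L) := even L ⊓ Subalgebra.toSubmodule (lowAlg L)

/-- The odd part of the Grassmann algebra on `L - 2` generators. -/
noncomputable def lowOdd (L : ℕ∞) : Submodule ℂ (Gr L) := odd L ⊓ Subalgebra.toSubmodule (lowAlg L)

/-- The body of a supernumber: its coefficient at the empty monomial. -/
noncomputable def body : Gr L →ₐ[ℂ] ℂ := ExteriorAlgebra.algebraMapInv

/-- The soul of a supernumber. -/
noncomputable def soul (x : Gr L) : Gr L := x - algebraMap ℂ (Gr L) (body x)

/-- Quotient of supernumbers (only used when the denominator is even and invertible). -/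
noncomputable def quo (x y : Gr L) : Gr L := x * Ring.inverse y

infixl:70 " /ₛ " => quo

/-- Integer powers of an invertible supernumber. -/
noncomputable def ipow (x : Gr L) (k : ℤ) : Gr L := x ^ k.toNat * Ring.inverse x ^ (-k).toNat

/-! ### Superspace -/

/-- Points `(z, θ⁺, θ⁻)` of superspace in one even and two odd variables. -/
@[ext]
structure SPoint (L : ℕ∞) where
  z : Gr L
  θp : Gr L
  θm : Gr L
  z_even : z ∈ even L
  θp_odd : θp ∈ odd L
  θm_odd : θm ∈ odd L

/-- The projection of superspace onto its body. -/
noncomputable def SPoint.base (x : SPoint L) : ℂ := body x.z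

/-- The DeWitt topology: the open sets are the preimages of the open subsets of the body `ℂ`. -/
noncomputable instance : TopologicalSpace (SPoint L) :=
  TopologicalSpace.induced SPoint.base inferInstance

/-! ### Superanalytic functions -/

/-- A superfunction of one even variable, given by its complex coefficient functions:
`f(z) = ∑ₖ fₖ(z) ζ_{k₁} ⋯ ζ_{kₛ}`. -/
abbrev Coeff (L : ℕ∞) : Type := Finset (Gen L) → ℂ → ℂ

/-- Superanalyticity over `V ⊆ ℂ`: the coefficient functions are analytic on `V`; only monomials
in the first `L - 2` generators occur; and, as values are finite sums of monomials, near every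
point of `V` only finitely many coefficient functions are non-zero. -/
structure Coeff.IsAnalytic (f : Coeff L) (V : Set ℂ) : Prop where
  analytic : ∀ k, AnalyticOnNhd ℂ (f k) V
  low : ∀ k, (∃ i ∈ k, ¬ IsLow i) → ∀ w ∈ V, f k w = 0
  finite : ∀ w ∈ V, {k | ¬ f k =ᶠ[𝓝 w] 0}.Finite

/-- The value at an even supernumber, `f(z) = ∑ₗ z_S^l / l! · f^{(l)}(z_B)`. -/
noncomputable def Coeff.eval (f : Coeff L) (z : Gr L) : Gr L :=
  ∑ᶠ l : ℕ, ((l.factorial : ℂ)⁻¹) •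
    (soul z ^ l * ∑ᶠ k : Finset (Gen L), iteratedDeriv l (f k) (body z) • zetaProd k)

/-- The derivative `∂f/∂z`. -/
noncomputable def Coeff.der (f : Coeff L) : Coeff L := fun k => deriv (f k)

/-- A superfunction of one even and two odd variables,
`H = c₀(z) + θ⁺ c₁(z) + θ⁻ c₂(z) + θ⁺θ⁻ c₁₂(z)`. -/
structure SFun (L : ℕ∞) where
  c0 : Coeff L
  c1 : Coeff L
  c2 : Coeff L
  c12 : Coeff L

namespace SFun

/-- Superanalyticity over `V ⊆ ℂ`. -/
structure IsAnalytic (H : SFun L) (V : Set ℂ) : Prop where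
  h0 : H.c0.IsAnalytic V
  h1 : H.c1.IsAnalytic V
  h2 : H.c2.IsAnalytic V
  h12 : H.c12.IsAnalytic V

/-- The value at a point of superspace. -/
noncomputable def eval (H : SFun L) (x : SPoint L) : Gr L :=
  H.c0.eval x.z + x.θp * H.c1.eval x.z + x.θm * H.c2.eval x.z + x.θp * x.θm * H.c12.eval x.z

instance : Add (SFun L) :=
  ⟨fun G H => ⟨G.c0 + H.c0, G.c1 + H.c1, G.c2 + H.c2, G.c12 + H.c12⟩⟩

/-- `∂H/∂z`. -/
noncomputable def dz (H : SFun L) : SFun L := ⟨H.c0.der, H.c1.der, H.c2.der, H.c12.der⟩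

/-- `∂H/∂θ⁺`. -/
def dp (H : SFun L) : SFun L := ⟨H.c1, 0, H.c12, 0⟩

/-- `∂H/∂θ⁻` (an odd derivation, so `θ⁺θ⁻` goes to `-θ⁺`). -/
def dm (H : SFun L) : SFun L := ⟨H.c2, -H.c12, 0, 0⟩

/-- `θ⁺ H`. -/
def mulp (H : SFun L) : SFun L := ⟨0, H.c0, 0, H.c2⟩

/-- `θ⁻ H`. -/
def mulm (H : SFun L) : SFun L := ⟨0, 0, H.c0, -H.c1⟩

/-- The superderivation `D⁺ = ∂/∂θ⁺ + θ⁻ ∂/∂z`. -/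
noncomputable def Dp (H : SFun L) : SFun L := H.dp + mulm H.dz

/-- The superderivation `D⁻ = ∂/∂θ⁻ + θ⁺ ∂/∂z`. -/
noncomputable def Dm (H : SFun L) : SFun L := H.dm + mulp H.dz

end SFun

/-- `N = 2` superconformal functions on DeWitt open sets, as partial maps of superspace: the
components `(Z, P, M)` are superanalytic with `D⁺M = 0`, `D⁻P = 0`, `D⁺Z = M · D⁺P`,
`D⁻Z = P · D⁻M`, and neither `D⁺P` nor `D⁻M` is identically zero. -/
def IsSuperconformal (H : SPoint L →. SPoint L) : Prop :=
  IsOpen H.Dom ∧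
  ∃ Z P M : SFun L,
    Z.IsAnalytic (SPoint.base '' H.Dom) ∧
    P.IsAnalytic (SPoint.base '' H.Dom) ∧
    M.IsAnalytic (SPoint.base '' H.Dom) ∧
    (∀ x, ∀ y ∈ H x, y.z = Z.eval x ∧ y.θp = P.eval x ∧ y.θm = M.eval x) ∧
    (∀ x ∈ H.Dom, M.Dp.eval x = 0 ∧ P.Dm.eval x = 0 ∧
      Z.Dp.eval x - M.eval x * P.Dp.eval x = 0 ∧
      Z.Dm.eval x - P.eval x * M.Dm.eval x = 0) ∧
    (∃ x ∈ H.Dom, P.Dp.eval x ≠ 0) ∧ (∃ x ∈ H.Dom, M.Dm.eval x ≠ 0)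

/-- `f, g⁺, g⁻` (even) and `ψ⁺, ψ⁻` (odd) are the component functions of the partial map `H` of
superspace, i.e. `H` sends `(z, θ⁺, θ⁻)` to
`(f + θ⁺g⁺ψ⁻ + θ⁻g⁻ψ⁺ + θ⁺θ⁻(ψ⁺ψ⁻)', ψ⁺ + θ⁺g⁺ + θ⁺θ⁻(ψ⁺)', ψ⁻ + θ⁻g⁻ - θ⁺θ⁻(ψ⁻)')`,
where `f' = (ψ⁺)'ψ⁻ - ψ⁺(ψ⁻)' + g⁺g⁻`. -/
structure IsComponents (H : SPoint L →. SPoint L) (f gp gm ψp ψm : Coeff L) : Prop where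
  f_analytic : f.IsAnalytic (SPoint.base '' H.Dom)
  gp_analytic : gp.IsAnalytic (SPoint.base '' H.Dom)
  gm_analytic : gm.IsAnalytic (SPoint.base '' H.Dom)
  ψp_analytic : ψp.IsAnalytic (SPoint.base '' H.Dom)
  ψm_analytic : ψm.IsAnalytic (SPoint.base '' H.Dom)
  parity : ∀ x ∈ H.Dom, f.eval x.z ∈ even L ∧ gp.eval x.z ∈ even L ∧ gm.eval x.z ∈ even L ∧
    ψp.eval x.z ∈ odd L ∧ ψm.eval x.z ∈ odd L
  z_eq : ∀ x, ∀ y ∈ H x, y.z = f.eval x.z + x.θp * gp.eval x.z * ψm.eval x.z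
    + x.θm * gm.eval x.z * ψp.eval x.z
    + x.θp * x.θm * (ψp.der.eval x.z * ψm.eval x.z + ψp.eval x.z * ψm.der.eval x.z)
  θp_eq : ∀ x, ∀ y ∈ H x, y.θp = ψp.eval x.z + x.θp * gp.eval x.z + x.θp * x.θm * ψp.der.eval x.z
  θm_eq : ∀ x, ∀ y ∈ H x, y.θm = ψm.eval x.z + x.θm * gm.eval x.z - x.θp * x.θm * ψm.der.eval x.z
  cond : ∀ x ∈ H.Dom, f.der.eval x.z = ψp.der.eval x.z * ψm.eval x.z
    - ψp.eval x.z * ψm.der.eval x.z + gp.eval x.z * gm.eval x.z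

/-! ### The super-Riemann spheres -/

theorem ipow_unit (u : (Gr L)ˣ) (k : ℤ) : ipow (u : Gr L) k = ((u ^ k : (Gr L)ˣ) : Gr L) := by
  rw [ipow, Ring.inverse_unit]
  obtain ⟨m, rfl | rfl⟩ := k.eq_nat_or_neg
  · simp
  · simp

theorem inverse_mem_even {x : Gr L} (hx : x ∈ even L) : Ring.inverse x ∈ even L := by
  by_cases hu : IsUnit x
  · obtain ⟨u, rfl⟩ := hu
    rw [Ring.inverse_unit]
    have h1 : CliffordAlgebra.involute ((u⁻¹ : (Gr L)ˣ) : Gr L) = ((u⁻¹ : (Gr L)ˣ) : Gr L) := by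
      have h2 := CliffordAlgebra.involute_eq_of_mem_even hx
      have h3 : CliffordAlgebra.involute ((u⁻¹ : (Gr L)ˣ) : Gr L) * (u : Gr L) = 1 := by
        conv_lhs => rw [← h2]
        rw [← map_mul, Units.inv_mul, map_one]
      calc CliffordAlgebra.involute ((u⁻¹ : (Gr L)ˣ) : Gr L)
          = CliffordAlgebra.involute ((u⁻¹ : (Gr L)ˣ) : Gr L) *
            ((u : Gr L) * ((u⁻¹ : (Gr L)ˣ) : Gr L)) := by rw [Units.mul_inv, mul_one]
        _ = _ := by rw [← mul_assoc, h3, one_mul]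
    have htop := (CliffordAlgebra.evenOdd_isCompl
      (Q := (0 : QuadraticForm ℂ (Gen L →₀ ℂ)))).sup_eq_top
    obtain ⟨a, ha, b, hb, hab⟩ := Submodule.mem_sup.1
      (htop.symm ▸ Submodule.mem_top (x := ((u⁻¹ : (Gr L)ˣ) : Gr L)))
    rw [← hab, map_add, CliffordAlgebra.involute_eq_of_mem_even ha,
      CliffordAlgebra.involute_eq_of_mem_odd hb, add_right_inj, neg_eq_iff_add_eq_zero,
      ← two_smul ℂ b, smul_eq_zero_iff_right two_ne_zero] at h1
    rw [← hab, h1, add_zero]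
    exact ha
  · rw [Ring.inverse_non_unit _ hu]
    exact zero_mem _

theorem mul_mem_parity {i j : ZMod 2} {x y : Gr L}
    (hx : x ∈ CliffordAlgebra.evenOdd (0 : QuadraticForm ℂ (Gen L →₀ ℂ)) i)
    (hy : y ∈ CliffordAlgebra.evenOdd (0 : QuadraticForm ℂ (Gen L →₀ ℂ)) j) :
    x * y ∈ CliffordAlgebra.evenOdd (0 : QuadraticForm ℂ (Gen L →₀ ℂ)) (i + j) :=
  SetLike.mul_mem_graded hx hy

theorem even_mul_mem {x y : Gr L} (hx : x ∈ even L) (hy : y ∈ even L) : x * y ∈ even L := by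
  have h := mul_mem_parity hx hy
  rwa [add_zero] at h

theorem odd_mul_even_mem {x y : Gr L} (hx : x ∈ odd L) (hy : y ∈ even L) : x * y ∈ odd L := by
  have h := mul_mem_parity hx hy
  rwa [add_zero] at h

theorem even_pow_mem {x : Gr L} (hx : x ∈ even L) (k : ℕ) : x ^ k ∈ even L := by
  induction k with
  | zero =>
    rw [pow_zero]
    exact CliffordAlgebra.one_le_evenOdd_zero _ (Submodule.one_le.1 le_rfl)
  | succ k ih =>
    rw [pow_succ]
    exact even_mul_mem ih hx

theorem ipow_mem_even {x : Gr L} (hx : x ∈ even L) (k : ℤ) : ipow x k ∈ even L :=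
  even_mul_mem (even_pow_mem hx _) (even_pow_mem (inverse_mem_even hx) _)

/-- For `s = i` the transition function
`I_n (z, θ⁺, θ⁻) = (1/z, iθ⁺zⁿ/z, iθ⁻z⁻ⁿ/z)` on the points with `z` invertible, and for `s = -i`
its inverse. -/
noncomputable def transition (s : ℂ) (n : ℤ) (x : SPoint L) : SPoint L where
  z := Ring.inverse x.z
  θp := s • (x.θp * ipow x.z (n - 1))
  θm := s • (x.θm * ipow x.z (-n - 1))
  z_even := inverse_mem_even x.z_even
  θp_odd := Submodule.smul_mem _ _ (odd_mul_even_mem x.θp_odd (ipow_mem_even x.z_even _))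
  θm_odd := Submodule.smul_mem _ _ (odd_mul_even_mem x.θm_odd (ipow_mem_even x.z_even _))

theorem transition_transition {s t : ℂ} (h : t * s = 1) (n : ℤ) {x : SPoint L}
    (hx : IsUnit x.z) : transition t n (transition s n x) = x := by
  obtain ⟨z, θp, θm, hz, hp, hm⟩ := x
  obtain ⟨u, rfl⟩ := hx
  have key : ∀ (θ : Gr L) (k : ℤ),
      t • ((s • (θ * ipow (u : Gr L) k)) * ipow (Ring.inverse (u : Gr L)) k) = θ := by
    intro θ k
    rw [Ring.inverse_unit, ipow_unit, ipow_unit, smul_mul_assoc, smul_smul, h, one_smul,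
      mul_assoc, ← Units.val_mul, inv_zpow, mul_inv_cancel, Units.val_one, mul_one]
  ext1
  · simp [transition]
  · exact key _ _
  · exact key _ _

/-- The gluing relation on the disjoint union of a southern (left) and a northern (right) copy of
superspace: the northern point `q`, with invertible even coordinate, is the southern point
`I_n q`. -/
inductive Glue (L : ℕ∞) (n : ℤ) : SPoint L ⊕ SPoint L → SPoint L ⊕ SPoint L → Prop
  | glue (q : SPoint L) (hq : IsUnit q.z) :
      Glue L n (Sum.inr q) (Sum.inl (transition Complex.I n q))

/-- The super-Riemann sphere `S²Ĉ(n)`: two copies of superspace glued along `I_n`. -/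
def Sphere (L : ℕ∞) (n : ℤ) : Type := Quot (Glue L n)

/-- The two coordinate charts of `S²Ĉ(n)`. -/
inductive Pole
  | south
  | north

namespace Sphere

variable {n : ℤ}

/-- The inverses of the coordinate charts: the point of the sphere with given coordinates. -/
def point : Pole → SPoint L → Sphere L n
  | .south, x => Quot.mk _ (Sum.inl x)
  | .north, x => Quot.mk _ (Sum.inr x)

open Classical in
/-- The southern chart. -/
noncomputable def southChart : Sphere L n →. SPoint L :=
  Quot.lift
    (fun s => match s with
      | .inl x => Part.some x
      | .inr q => if IsUnit q.z then Part.some (transition Complex.I n q) else Part.none)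
    (by rintro _ _ ⟨q, hq⟩; simp [hq])

open Classical in
/-- The northern chart. -/
noncomputable def northChart : Sphere L n →. SPoint L :=
  Quot.lift
    (fun s => match s with
      | .inl x => if IsUnit x.z then Part.some (transition (-Complex.I) n x) else Part.none
      | .inr q => Part.some q)
    (by
      rintro _ _ ⟨q, hq⟩
      have h : IsUnit (transition Complex.I n q).z := hq.ringInverse
      simp only [h, if_true]
      rw [transition_transition (by simp) n hq])

/-- The coordinate charts, as partial maps to superspace. -/
noncomputable def chart : Pole → (Sphere L n →. SPoint L)
  | .south => southChart
  | .north => northChart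

theorem chart_point (α : Pole) (x : SPoint L) : chart α (point α x : Sphere L n) = Part.some x := by
  cases α <;> rfl

theorem point_of_mem_chart (α : Pole) (P : Sphere L n) (x : SPoint L) (h : x ∈ chart α P) :
    point α x = P := by
  classical
  induction P using Quot.ind with
  | mk s =>
    cases α with
    | south =>
      cases s with
      | inl y => rw [Part.mem_some_iff.1 h]; rfl
      | inr q =>
        change x ∈ (if IsUnit q.z then Part.some (transition Complex.I n q) else Part.none) at h
        split_ifs at h with hq
        · rw [Part.mem_some_iff.1 h]
          exact (Quot.sound (Glue.glue q hq)).symm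
        · exact absurd h (Part.notMem_none _)
    | north =>
      cases s with
      | inr y => rw [Part.mem_some_iff.1 h]; rfl
      | inl q =>
        change x ∈ (if IsUnit q.z then Part.some (transition (-Complex.I) n q) else Part.none) at h
        split_ifs at h with hq
        · rw [Part.mem_some_iff.1 h]
          have h2 := Glue.glue (L := L) (n := n) (transition (-Complex.I) n q) hq.ringInverse
          rw [transition_transition (by simp) n hq] at h2
          exact Quot.sound h2
        · exact absurd h (Part.notMem_none _)

/-- The expression `Ω_β ∘ T ∘ Ω_α⁻¹` of a map `T` of the sphere in the charts `α` and `β`. It is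
defined at the coordinates of the points of `U_α ∩ T⁻¹(U_β)`. -/
noncomputable def expr (T : Sphere L n → Sphere L n) (α β : Pole) : SPoint L →. SPoint L :=
  fun x => chart β (T (point α x))

/-- The expression of `T` in the southern chart. -/
noncomputable def southExpr (T : Sphere L n → Sphere L n) : SPoint L →. SPoint L :=
  expr T .south .south

/-- `T` is an `N = 2` superconformal map if its expressions in the charts are, whenever they are
defined somewhere. -/
def IsSuperconformalMap (T : Sphere L n → Sphere L n) : Prop :=
  ∀ α β, (expr T α β).Dom.Nonempty → IsSuperconformal (expr T α β)

/-- The `N = 2` superconformal automorphisms of `S²Ĉ(n)`: the bijective superconformal maps. -/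
def Aut (L : ℕ∞) (n : ℤ) : Set (Sphere L n → Sphere L n) :=
  {T | Function.Bijective T ∧ IsSuperconformalMap T}

end Sphere

end N2

open N2 N2.Sphere

namespace N2
variable {L : ℕ∞}

theorem algebraMap_mem_even (r : ℂ) : algebraMap ℂ (Gr L) r ∈ even L := by
  rw [Algebra.algebraMap_eq_smul_one]
  exact Submodule.smul_mem _ _ (CliffordAlgebra.one_le_evenOdd_zero _ (Submodule.one_le.1 le_rfl))

theorem one_mem_even : (1 : Gr L) ∈ even L := by
  simpa using algebraMap_mem_even (L := L) 1

theorem even_mul_odd_mem {x y : Gr L} (hx : x ∈ even L) (hy : y ∈ odd L) : x * y ∈ odd L := by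
  have h := mul_mem_parity hx hy
  rwa [zero_add] at h

theorem odd_mul_odd_mem {x y : Gr L} (hx : x ∈ odd L) (hy : y ∈ odd L) : x * y ∈ even L := by
  have h := mul_mem_parity hx hy
  have h2 : (1 : ZMod 2) + 1 = 0 := by decide
  rwa [h2] at h

theorem zeta_mem_odd (i : Gen L) : zeta i ∈ odd L := CliffordAlgebra.ι_mem_evenOdd_one _ _

theorem even_inf_odd : even L ⊓ odd L = ⊥ :=
  (CliffordAlgebra.evenOdd_isCompl (Q := (0 : QuadraticForm ℂ (Gen L →₀ ℂ)))).inf_eq_bot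

theorem eq_zero_of_even_of_odd {x : Gr L} (h : x ∈ even L) (h' : x ∈ odd L) : x = 0 := by
  have : x ∈ even L ⊓ odd L := ⟨h, h'⟩
  rwa [even_inf_odd, Submodule.mem_bot] at this

theorem exists_even_add_odd (x : Gr L) : ∃ a ∈ even L, ∃ b ∈ odd L, a + b = x :=
  Submodule.mem_sup.1 ((CliffordAlgebra.evenOdd_isCompl
    (Q := (0 : QuadraticForm ℂ (Gen L →₀ ℂ)))).sup_eq_top.symm ▸ Submodule.mem_top (x := x))

theorem iota_mul_swap (m₁ m₂ : Gen L →₀ ℂ) :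
    ExteriorAlgebra.ι ℂ m₁ * ExteriorAlgebra.ι ℂ m₂
      = -(ExteriorAlgebra.ι ℂ m₂ * ExteriorAlgebra.ι ℂ m₁) :=
  eq_neg_of_add_eq_zero_left (ExteriorAlgebra.ι_add_mul_swap _ _)

/-- Even supernumbers are central. -/
theorem even_comm {x : Gr L} (hx : x ∈ even L) (y : Gr L) : x * y = y * x := by
  have key : ∀ (m : Gen L →₀ ℂ), x * ExteriorAlgebra.ι ℂ m = ExteriorAlgebra.ι ℂ m * x := by
    intro m
    induction x, hx using CliffordAlgebra.even_induction with
    | algebraMap r => exact Algebra.commutes r _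
    | add x y hx hy h1 h2 => rw [add_mul, mul_add, h1, h2]
    | ι_mul_ι_mul m₁ m₂ x hx h =>
      change ExteriorAlgebra.ι ℂ m₁ * ExteriorAlgebra.ι ℂ m₂ * x * _ =
        _ * (ExteriorAlgebra.ι ℂ m₁ * ExteriorAlgebra.ι ℂ m₂ * x)
      rw [mul_assoc _ x, h, mul_assoc, ← mul_assoc _ _ x, iota_mul_swap m₂ m, neg_mul, mul_neg,
        ← mul_assoc, ← mul_assoc, iota_mul_swap m₁ m]
      noncomm_ring
  induction y using ExteriorAlgebra.induction with
  | algebraMap r => exact (Algebra.commutes r _).symm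
  | ι m => exact key m
  | mul a b ha hb => rw [← mul_assoc, ha, mul_assoc, hb, mul_assoc]
  | add a b ha hb => rw [mul_add, add_mul, ha, hb]

/-- Odd supernumbers anticommute. -/
theorem odd_anticomm {x y : Gr L} (hx : x ∈ odd L) (hy : y ∈ odd L) : x * y = -(y * x) := by
  have key : ∀ (m : Gen L →₀ ℂ) (y : Gr L), y ∈ odd L →
      ExteriorAlgebra.ι ℂ m * y = -(y * ExteriorAlgebra.ι ℂ m) := by
    intro m y hy
    induction y, hy using CliffordAlgebra.odd_induction with
    | ι m' => exact iota_mul_swap m m'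
    | add x y hx hy h1 h2 => rw [mul_add, add_mul, h1, h2, neg_add]
    | ι_mul_ι_mul m₁ m₂ x hx h =>
      have hc := even_comm (CliffordAlgebra.ι_mul_ι_mem_evenOdd_zero
        (0 : QuadraticForm ℂ (Gen L →₀ ℂ)) m₁ m₂)
      rw [← mul_assoc, ← hc, mul_assoc, h, mul_neg, mul_assoc _ x]
  induction x, hx using CliffordAlgebra.odd_induction with
  | ι m' => exact key m' y hy
  | add x y hx hy h1 h2 => rw [mul_add, add_mul, h1, h2, neg_add]
  | ι_mul_ι_mul m₁ m₂ x hx h =>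
    have hc := even_comm (CliffordAlgebra.ι_mul_ι_mem_evenOdd_zero
        (0 : QuadraticForm ℂ (Gen L →₀ ℂ)) m₁ m₂)
    rw [mul_assoc, h, mul_neg, hc, mul_assoc, ← hc]

theorem odd_sq {x : Gr L} (hx : x ∈ odd L) : x * x = 0 := by
  have h := eq_neg_iff_add_eq_zero.1 (odd_anticomm hx hx)
  rwa [← two_smul ℂ (x * x), smul_eq_zero_iff_right two_ne_zero] at h

theorem odd_mul_mul_self {x : Gr L} (hx : x ∈ odd L) (y : Gr L) : x * y * x = 0 := by
  obtain ⟨a, ha, b, hb, rfl⟩ := exists_even_add_odd y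
  rw [mul_add, add_mul, ← even_comm ha, mul_assoc, odd_sq hx, odd_anticomm hx hb, neg_mul,
    mul_assoc, odd_sq hx]
  simp

@[simp] theorem body_algebraMap (r : ℂ) : body (algebraMap ℂ (Gr L) r) = r :=
  ExteriorAlgebra.algebraMap_leftInverse _ r

@[simp] theorem body_iota (m : Gen L →₀ ℂ) : body (ExteriorAlgebra.ι ℂ m) = 0 := by
  simp [body, ExteriorAlgebra.algebraMapInv]

theorem body_odd {x : Gr L} (hx : x ∈ odd L) : body x = 0 := by
  have := congrArg body (odd_sq hx)
  rwa [map_mul, map_zero, mul_self_eq_zero] at this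

theorem even_commute {x : Gr L} (hx : x ∈ even L) (y : Gr L) : Commute x y := even_comm hx y

theorem soul_mem_even {x : Gr L} (hx : x ∈ even L) : soul x ∈ even L :=
  sub_mem hx (algebraMap_mem_even _)

theorem soul_nilpotent {x : Gr L} (hx : x ∈ even L) : IsNilpotent (soul x) := by
  induction x, hx using CliffordAlgebra.even_induction with
  | algebraMap r =>
    have : soul (algebraMap ℂ (Gr L) r) = 0 := by simp [soul]
    exact this ▸ IsNilpotent.zero
  | add x y hx hy h1 h2 =>
    have : soul (x + y) = soul x + soul y := by
      simp only [soul, map_add]; abel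
    rw [this]
    exact (even_commute (soul_mem_even hx) _).isNilpotent_add h1 h2
  | ι_mul_ι_mul m₁ m₂ x hx h =>
    have hb : body (ExteriorAlgebra.ι ℂ m₁ * ExteriorAlgebra.ι ℂ m₂ * x) = 0 := by simp
    refine ⟨2, ?_⟩
    change soul (ExteriorAlgebra.ι ℂ m₁ * ExteriorAlgebra.ι ℂ m₂ * x) ^ 2 = 0
    rw [soul, hb, map_zero, sub_zero, pow_two, mul_assoc (ExteriorAlgebra.ι ℂ m₁),
      ← mul_assoc _ (ExteriorAlgebra.ι ℂ m₁),
      odd_mul_mul_self (CliffordAlgebra.ι_mem_evenOdd_one _ _), zero_mul]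

theorem isNilpotent_of_body_eq_zero {x : Gr L} (hx : x ∈ even L) (h : body x = 0) :
    IsNilpotent x := by
  have := soul_nilpotent hx
  rwa [soul, h, map_zero, sub_zero] at this

theorem body_ne_zero_of_isUnit {x : Gr L} (h : IsUnit x) : body x ≠ 0 :=
  (h.map (body (L := L))).ne_zero

theorem isUnit_of_body_ne_zero {x : Gr L} (hx : x ∈ even L) (h : body x ≠ 0) : IsUnit x := by
  have h1 : x = algebraMap ℂ (Gr L) (body x) + soul x := by simp [soul]
  rw [h1]
  exact (soul_nilpotent hx).isUnit_add_left_of_commute ((IsUnit.mk0 _ h).map (algebraMap ℂ (Gr L)))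
    (even_commute (soul_mem_even hx) _)

theorem isUnit_iff_body {x : Gr L} (hx : x ∈ even L) : IsUnit x ↔ body x ≠ 0 :=
  ⟨body_ne_zero_of_isUnit, isUnit_of_body_ne_zero hx⟩

/-! ### Contractions and separation by unused generators -/

noncomputable def contr (i : Gen L) : Gr L →ₗ[ℂ] Gr L :=
  CliffordAlgebra.contractLeft (Q := (0 : QuadraticForm ℂ (Gen L →₀ ℂ))) (Finsupp.lapply i)

theorem contr_zeta_mul (i j : Gen L) (b : Gr L) :
    contr i (zeta j * b) = (if j = i then b else 0) - zeta j * contr i b := by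
  have := CliffordAlgebra.contractLeft_ι_mul (Q := (0 : QuadraticForm ℂ (Gen L →₀ ℂ)))
    (Finsupp.lapply i) (Finsupp.single j (1 : ℂ)) b
  refine this.trans ?_
  simp [Finsupp.single_apply, contr, zeta, ExteriorAlgebra.ι]

theorem contr_eq_zero {S : Set (Gen L)} {i : Gen L} (hi : i ∉ S) {a : Gr L}
    (ha : a ∈ Algebra.adjoin ℂ (zeta '' S)) : contr i a = 0 := by
  have key : ∀ b, contr i b = 0 → contr i (a * b) = 0 := by
    induction ha using Algebra.adjoin_induction with
    | mem x hx =>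
      obtain ⟨j, hj, rfl⟩ := hx
      intro b hb
      have : j ≠ i := fun h => hi (h ▸ hj)
      simp [contr_zeta_mul, hb, this]
    | algebraMap r => intro b hb; rw [← Algebra.smul_def, map_smul, hb, smul_zero]
    | add x y _ _ hx hy => intro b hb; rw [add_mul, map_add, hx b hb, hy b hb, add_zero]
    | mul x y _ _ hx hy => intro b hb; rw [mul_assoc]; exact hx _ (hy b hb)
  have h1 : contr i (1 : Gr L) = 0 := CliffordAlgebra.contractLeft_one (Q := (0 : QuadraticForm ℂ (Gen L →₀ ℂ))) _
  simpa using key 1 h1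

theorem exists_contr_eq_zero (hL : 1 < L) {a : Gr L} (ha : a ∈ lowAlg L) :
    ∃ i j : Gen L, i ≠ j ∧ contr i a = 0 ∧ contr j a = 0 := by
  have h1 : ∃ S : Set (Gen L), S.Finite ∧ (∀ i ∈ S, IsLow i) ∧ a ∈ Algebra.adjoin ℂ (zeta '' S) := by
    induction ha using Algebra.adjoin_induction with
    | mem x hx =>
      obtain ⟨j, hj, rfl⟩ := hx
      exact ⟨{j}, Set.finite_singleton _, by simpa using hj, Algebra.subset_adjoin (by simp)⟩
    | algebraMap r => exact ⟨∅, Set.finite_empty, by simp, Subalgebra.algebraMap_mem _ _⟩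
    | add x y _ _ hx hy =>
      obtain ⟨S, hS, hS', hx⟩ := hx
      obtain ⟨S2, hS2, hS2', hy⟩ := hy
      refine ⟨S ∪ S2, hS.union hS2, ?_, add_mem
        (Algebra.adjoin_mono (Set.image_mono Set.subset_union_left) hx)
        (Algebra.adjoin_mono (Set.image_mono Set.subset_union_right) hy)⟩
      rintro i (h | h); exacts [hS' i h, hS2' i h]
    | mul x y _ _ hx hy =>
      obtain ⟨S, hS, hS', hx⟩ := hx
      obtain ⟨S2, hS2, hS2', hy⟩ := hy
      refine ⟨S ∪ S2, hS.union hS2, ?_, mul_mem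
        (Algebra.adjoin_mono (Set.image_mono Set.subset_union_left) hx)
        (Algebra.adjoin_mono (Set.image_mono Set.subset_union_right) hy)⟩
      rintro i (h | h); exacts [hS' i h, hS2' i h]
  obtain ⟨S, hS, hS', haS⟩ := h1
  have h2 : ∃ i j : Gen L, i ≠ j ∧ i ∉ S ∧ j ∉ S := by
    induction L using ENat.recTopCoe with
    | top =>
      have : Infinite (Gen (⊤ : ℕ∞)) :=
        Infinite.of_injective (fun n : ℕ => (⟨n, ENat.natCast_lt_top n⟩ : Gen ⊤))
          (fun a b h => by simpa using h)
      obtain ⟨i, hi⟩ := hS.infinite_compl.nonempty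
      obtain ⟨j, hj⟩ := (hS.insert i).infinite_compl.nonempty
      refine ⟨i, j, ?_, hi, fun h => hj (Set.mem_insert_of_mem _ h)⟩
      rintro rfl
      exact hj (Set.mem_insert _ _)
    | coe N =>
      have hN : 1 < N := by exact_mod_cast hL
      refine ⟨⟨N - 1, by exact_mod_cast (by omega : N - 1 < N)⟩,
        ⟨N - 2, by exact_mod_cast (by omega : N - 2 < N)⟩, ?_, ?_, ?_⟩
      · simp only [ne_eq, Subtype.mk.injEq]; omega
      · intro h
        have := hS' _ h
        simp only [IsLow] at this
        have : N - 1 + 2 < N := by exact_mod_cast this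
        omega
      · intro h
        have := hS' _ h
        simp only [IsLow] at this
        have : N - 2 + 2 < N := by exact_mod_cast this
        omega
  obtain ⟨i, j, hij, hi, hj⟩ := h2
  exact ⟨i, j, hij, contr_eq_zero hi haS, contr_eq_zero hj haS⟩

theorem eq_zero_of_odd_mul (hL : 1 < L) {a : Gr L} (ha : a ∈ lowAlg L)
    (h : ∀ θ ∈ odd L, θ * a = 0) : a = 0 := by
  obtain ⟨i, j, hij, hi, hj⟩ := exists_contr_eq_zero hL ha
  have := congrArg (contr i) (h _ (zeta_mem_odd i))
  simpa [contr_zeta_mul, hi] using this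

theorem eq_of_odd_mul (hL : 1 < L) {a b : Gr L} (ha : a ∈ lowAlg L) (hb : b ∈ lowAlg L)
    (h : ∀ θ ∈ odd L, θ * a = θ * b) : a = b :=
  sub_eq_zero.1 (eq_zero_of_odd_mul hL (sub_mem ha hb) fun θ hθ => by
    rw [mul_sub, h θ hθ, sub_self])

theorem eq_zero_of_odd_mul_odd_mul (hL : 1 < L) {a : Gr L} (ha : a ∈ lowAlg L)
    (h : ∀ θ ∈ odd L, ∀ θ' ∈ odd L, θ * θ' * a = 0) : a = 0 := by
  obtain ⟨i, j, hij, hi, hj⟩ := exists_contr_eq_zero hL ha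
  have h1 := congrArg (contr j) (congrArg (contr i) (h _ (zeta_mem_odd i) _ (zeta_mem_odd j)))
  rw [mul_assoc, contr_zeta_mul, contr_zeta_mul] at h1
  simpa [hij.symm, hi, hj, contr_zeta_mul] using h1

/-! ### Parity within the low algebra -/

theorem involute_mem_lowAlg {a : Gr L} (ha : a ∈ lowAlg L) :
    CliffordAlgebra.involute (Q := (0 : QuadraticForm ℂ (Gen L →₀ ℂ))) a ∈ lowAlg L := by
  have : lowAlg L ≤ (lowAlg L).comap
      (CliffordAlgebra.involute (Q := (0 : QuadraticForm ℂ (Gen L →₀ ℂ)))) := by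
    refine Algebra.adjoin_le ?_
    rintro _ ⟨i, hi, rfl⟩
    have h : CliffordAlgebra.involute (Q := (0 : QuadraticForm ℂ (Gen L →₀ ℂ))) (zeta i) = - zeta i :=
      CliffordAlgebra.involute_ι _
    simp only [Subalgebra.coe_comap, Set.mem_preimage, h]
    exact neg_mem (Algebra.subset_adjoin ⟨i, hi, rfl⟩)
  exact this ha

theorem exists_lowEven_add_lowOdd {x : Gr L} (hx : x ∈ lowAlg L) :
    ∃ a ∈ lowEven L, ∃ b ∈ lowOdd L, a + b = x := by
  obtain ⟨a, ha, b, hb, rfl⟩ := exists_even_add_odd x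
  have h1 := involute_mem_lowAlg hx
  rw [map_add, CliffordAlgebra.involute_eq_of_mem_even ha,
    CliffordAlgebra.involute_eq_of_mem_odd hb] at h1
  have h2 : a = (2⁻¹ : ℂ) • ((a + b) + (a + -b)) := by module
  have h3 : b = (2⁻¹ : ℂ) • ((a + b) - (a + -b)) := by module
  refine ⟨a, ⟨ha, ?_⟩, b, ⟨hb, ?_⟩, rfl⟩
  · rw [h2]; exact Subalgebra.smul_mem _ (add_mem hx h1) _
  · rw [h3]; exact Subalgebra.smul_mem _ (sub_mem hx h1) _

theorem even_of_odd_mul (hL : 1 < L) {a : Gr L} (ha : a ∈ lowAlg L)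
    (h : ∀ θ ∈ odd L, θ * a ∈ odd L) : a ∈ even L := by
  obtain ⟨x, hx, y, hy, rfl⟩ := exists_lowEven_add_lowOdd ha
  have : y = 0 := eq_zero_of_odd_mul hL hy.2 fun θ hθ => by
    refine eq_zero_of_even_of_odd (odd_mul_odd_mem hθ hy.1) ?_
    have := sub_mem (h θ hθ) (odd_mul_even_mem hθ hx.1)
    rwa [mul_add, add_sub_cancel_left] at this
  rw [this, add_zero]; exact hx.1

theorem algebraMap_mem_lowEven (r : ℂ) : algebraMap ℂ (Gr L) r ∈ lowEven L :=
  ⟨algebraMap_mem_even r, Subalgebra.algebraMap_mem _ r⟩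

theorem lowEven_mul {x y : Gr L} (hx : x ∈ lowEven L) (hy : y ∈ lowEven L) : x * y ∈ lowEven L :=
  ⟨even_mul_mem hx.1 hy.1, Subalgebra.mul_mem (lowAlg L) hx.2 hy.2⟩

theorem lowOdd_mul {x y : Gr L} (hx : x ∈ lowOdd L) (hy : y ∈ lowOdd L) : x * y ∈ lowEven L :=
  ⟨odd_mul_odd_mem hx.1 hy.1, Subalgebra.mul_mem (lowAlg L) hx.2 hy.2⟩

/-- The even part of the low algebra, as a subalgebra. -/
noncomputable def lowEvenAlg (L : ℕ∞) : Subalgebra ℂ (Gr L) where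
  carrier := {x | x ∈ lowEven L}
  mul_mem' := fun ha hb => lowEven_mul ha hb
  add_mem' := fun ha hb => (lowEven L).add_mem ha hb
  algebraMap_mem' := fun r => algebraMap_mem_lowEven r

noncomputable instance : CommRing (lowEvenAlg L) :=
  { (inferInstance : Ring (lowEvenAlg L)) with
    mul_comm := fun x y => Subtype.ext (even_comm x.2.1 y) }

theorem exists_sqrt_of_isNilpotent {R : Type*} [CommRing R] [Algebra ℂ R] (x : R) (r : ℂ)
    (hr : r ≠ 0) (h : IsNilpotent (x - algebraMap ℂ R (r ^ 2))) : ∃ y, y * y = x := by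
  let P : Polynomial R := Polynomial.X ^ 2 - Polynomial.C x
  have h1 : IsNilpotent (Polynomial.aeval (algebraMap ℂ R r) P) := by
    have : Polynomial.aeval (algebraMap ℂ R r) P = - (x - algebraMap ℂ R (r ^ 2)) := by
      simp [P]
    rw [this]
    exact h.neg
  have h2 : IsUnit (Polynomial.aeval (algebraMap ℂ R r) (Polynomial.derivative P)) := by
    have : Polynomial.aeval (algebraMap ℂ R r) (Polynomial.derivative P)
        = algebraMap ℂ R (2 * r) := by
      simp [P, one_add_one_eq_two, map_mul, map_ofNat (algebraMap ℂ R) 2]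
    rw [this]
    exact (IsUnit.mk0 _ (by simpa using hr)).map _
  obtain ⟨y, hy, -⟩ := Polynomial.existsUnique_nilpotent_sub_and_aeval_eq_zero h1 h2
  refine ⟨y, ?_⟩
  have := hy.2
  simp only [P, map_sub, map_pow, Polynomial.aeval_X, Polynomial.aeval_C] at this
  rw [← pow_two]
  exact sub_eq_zero.1 this

theorem exists_inv_of_isNilpotent {R : Type*} [CommRing R] [Algebra ℂ R] (x : R) (r : ℂ)
    (hr : r ≠ 0) (h : IsNilpotent (x - algebraMap ℂ R r)) : ∃ y, x * y = 1 := by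
  have := h.isUnit_add_left_of_commute ((IsUnit.mk0 _ hr).map (algebraMap ℂ R)) (Commute.all _ _)
  rw [add_sub_cancel] at this
  exact this.exists_right_inv

theorem isNilpotent_lowEvenAlg {x : Gr L} (hx : x ∈ lowEven L) :
    IsNilpotent ((⟨x, hx⟩ : lowEvenAlg L) - algebraMap ℂ (lowEvenAlg L) (body x)) := by
  obtain ⟨m, hm⟩ := soul_nilpotent hx.1
  exact ⟨m, Subtype.ext hm⟩

theorem exists_lowEven_sqrt {x : Gr L} (hx : x ∈ lowEven L) (hu : IsUnit x) :
    ∃ y ∈ lowEven L, IsUnit y ∧ y * y = x := by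
  obtain ⟨r, hr⟩ := IsAlgClosed.exists_pow_nat_eq (body x) (n := 2) (by norm_num)
  have hr0 : r ≠ 0 := by
    rintro rfl
    exact body_ne_zero_of_isUnit hu (by rw [← hr]; simp)
  obtain ⟨y, hy⟩ := exists_sqrt_of_isNilpotent (⟨x, hx⟩ : lowEvenAlg L) r hr0
    (hr.symm ▸ isNilpotent_lowEvenAlg hx)
  have hy3 : (y : Gr L) * y = x := congrArg Subtype.val hy
  refine ⟨_, y.2, ?_, hy3⟩
  refine isUnit_of_body_ne_zero y.2.1 fun h => body_ne_zero_of_isUnit hu ?_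
  rw [← hy3, map_mul, h, mul_zero]

theorem inverse_mem_lowEven {x : Gr L} (hx : x ∈ lowEven L) : Ring.inverse x ∈ lowEven L := by
  refine ⟨inverse_mem_even hx.1, ?_⟩
  by_cases hu : IsUnit x
  · obtain ⟨y, hy⟩ := exists_inv_of_isNilpotent _ _ (body_ne_zero_of_isUnit hu)
      (isNilpotent_lowEvenAlg hx)
    have hy3 : x * (y : Gr L) = 1 := congrArg Subtype.val hy
    have : Ring.inverse x = (y : Gr L) := by
      rw [← mul_one (Ring.inverse x), ← hy3, ← mul_assoc, Ring.inverse_mul_cancel _ hu, one_mul]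
    rw [this]
    exact y.2.2
  · rw [Ring.inverse_non_unit _ hu]; exact zero_mem (lowAlg L)

/-! ### Germs of analytic functions with values in the low algebra -/

/-- `F` is, near `w`, a finite combination of elements of the low algebra with analytic
coefficients. -/
inductive SuperAnalyticAt (w : ℂ) : (ℂ → Gr L) → Prop
  | smul (c : ℂ → ℂ) (a : Gr L) (hc : AnalyticAt ℂ c w) (ha : a ∈ lowAlg L) :
      SuperAnalyticAt w (fun v => c v • a)
  | add (F G : ℂ → Gr L) (hF : SuperAnalyticAt w F) (hG : SuperAnalyticAt w G) :
      SuperAnalyticAt w (fun v => F v + G v)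
  | congr (F G : ℂ → Gr L) (hF : SuperAnalyticAt w F) (h : F =ᶠ[𝓝 w] G) : SuperAnalyticAt w G

/-- `F` has derivative `a` at `w`, tested on linear functionals. -/
def HasWeakDerivAt (F : ℂ → Gr L) (a : Gr L) (w : ℂ) : Prop :=
  ∀ ℓ : Module.Dual ℂ (Gr L), HasDerivAt (fun v => ℓ (F v)) (ℓ a) w

/-- The derivative of a function with values in the Grassmann algebra. -/
noncomputable def wderiv (F : ℂ → Gr L) (w : ℂ) : Gr L :=
  Classical.epsilon fun a => HasWeakDerivAt F a w

theorem eq_of_dual {x y : Gr L} (h : ∀ ℓ : Module.Dual ℂ (Gr L), ℓ x = ℓ y) : x = y := by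
  rw [← sub_eq_zero, ← Module.forall_dual_apply_eq_zero_iff ℂ]
  intro ℓ
  rw [map_sub, h ℓ, sub_self]

namespace HasWeakDerivAt

variable {F G : ℂ → Gr L} {a b : Gr L} {w : ℂ}

theorem unique (h : HasWeakDerivAt F a w) (h' : HasWeakDerivAt F b w) : a = b :=
  eq_of_dual fun ℓ => (h ℓ).unique (h' ℓ)

theorem wderiv_eq (h : HasWeakDerivAt F a w) : wderiv F w = a :=
  unique (Classical.epsilon_spec (p := fun a => HasWeakDerivAt F a w) ⟨a, h⟩) h

theorem add (h : HasWeakDerivAt F a w) (h' : HasWeakDerivAt G b w) :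
    HasWeakDerivAt (fun v => F v + G v) (a + b) w := fun ℓ => by
  simp only [map_add]
  exact (h ℓ).add (h' ℓ)

theorem congr (h : HasWeakDerivAt F a w) (h' : F =ᶠ[𝓝 w] G) : HasWeakDerivAt G a w := fun ℓ =>
  (h ℓ).congr_of_eventuallyEq (h'.symm.fun_comp ℓ)

theorem linear (h : HasWeakDerivAt F a w) (A : Gr L →ₗ[ℂ] Gr L) :
    HasWeakDerivAt (fun v => A (F v)) (A a) w := fun ℓ => h (ℓ.comp A)

theorem smul {c : ℂ → ℂ} {c' : ℂ} (hc : HasDerivAt c c' w) (h : HasWeakDerivAt F a w) :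
    HasWeakDerivAt (fun v => c v • F v) (c' • F w + c w • a) w := fun ℓ => by
  simp only [map_add, map_smul, smul_eq_mul]
  exact hc.mul (h ℓ)

theorem const (a : Gr L) (w : ℂ) : HasWeakDerivAt (fun _ => a) 0 w := fun ℓ => by
  simpa using hasDerivAt_const w (ℓ a)

theorem mem (h : HasWeakDerivAt F a w) (W : Submodule ℂ (Gr L)) (hF : ∀ᶠ v in 𝓝 w, F v ∈ W) :
    a ∈ W := by
  refine (Subspace.forall_mem_dualAnnihilator_apply_eq_zero_iff W a).1 fun φ hφ => ?_
  rw [Submodule.mem_dualAnnihilator] at hφ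
  have h1 : (fun v => φ (F v)) =ᶠ[𝓝 w] fun _ => 0 := hF.mono fun v hv => hφ _ hv
  exact (h φ).unique ((hasDerivAt_const w (0 : ℂ)).congr_of_eventuallyEq h1)

theorem comp {g : ℂ → ℂ} {g' : ℂ} (h : HasWeakDerivAt F a (g w)) (hg : HasDerivAt g g' w) :
    HasWeakDerivAt (fun v => F (g v)) (g' • a) w := fun ℓ => by
  rw [map_smul, smul_eq_mul, mul_comm]
  exact (h ℓ).comp w hg

end HasWeakDerivAt

theorem wderiv_congr {F G : ℂ → Gr L} {w : ℂ} (h : F =ᶠ[𝓝 w] G) : wderiv F w = wderiv G w := by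
  have : (fun a => HasWeakDerivAt F a w) = fun a => HasWeakDerivAt G a w := by
    ext a
    exact ⟨fun h' => h'.congr h, fun h' => h'.congr h.symm⟩
  rw [wderiv, wderiv, this]

theorem wderiv_eventuallyEq {F G : ℂ → Gr L} {w : ℂ} (h : F =ᶠ[𝓝 w] G) :
    wderiv F =ᶠ[𝓝 w] wderiv G :=
  (eventually_eventually_nhds.2 h).mono fun _ hv => wderiv_congr hv

theorem wderiv_iterate_eventuallyEq {F G : ℂ → Gr L} {w : ℂ} (h : F =ᶠ[𝓝 w] G) (l : ℕ) :
    wderiv^[l] F =ᶠ[𝓝 w] wderiv^[l] G := by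
  induction l with
  | zero => exact h
  | succ l ih =>
    rw [Function.iterate_succ_apply', Function.iterate_succ_apply']
    exact wderiv_eventuallyEq ih

namespace SuperAnalyticAt

variable {F G : ℂ → Gr L} {w : ℂ}

theorem const {a : Gr L} (ha : a ∈ lowAlg L) (w : ℂ) : SuperAnalyticAt w (fun _ => a) := by
  simpa using smul (w := w) (fun _ => 1) a analyticAt_const ha

theorem zero (w : ℂ) : SuperAnalyticAt w (fun _ => (0 : Gr L)) := const (zero_mem _) w

theorem sum {ι : Type*} (s : Finset ι) {F : ι → ℂ → Gr L}
    (h : ∀ i ∈ s, SuperAnalyticAt w (F i)) : SuperAnalyticAt w (fun v => ∑ i ∈ s, F i v) := by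
  classical
  induction s using Finset.induction_on with
  | empty => simpa using zero w
  | insert i s hi ih =>
    simp only [Finset.sum_insert hi]
    exact add _ _ (h i (Finset.mem_insert_self _ _))
      (ih fun j hj => h j (Finset.mem_insert_of_mem hj))

theorem csmul {c : ℂ → ℂ} (hc : AnalyticAt ℂ c w) (hF : SuperAnalyticAt w F) :
    SuperAnalyticAt w (fun v => c v • F v) := by
  induction hF with
  | smul e a he ha => simpa only [smul_smul] using smul (fun v => c v * e v) a (hc.mul he) ha
  | add F G _ _ h1 h2 => simpa only [smul_add] using add _ _ h1 h2
  | congr F G _ h ih => exact congr _ _ ih (h.mono fun v hv => by simp only [hv])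

theorem neg (hF : SuperAnalyticAt w F) : SuperAnalyticAt w (fun v => -F v) := by
  simpa using csmul (c := fun _ => -1) analyticAt_const hF

theorem sub (hF : SuperAnalyticAt w F) (hG : SuperAnalyticAt w G) :
    SuperAnalyticAt w (fun v => F v - G v) := by
  simpa only [sub_eq_add_neg] using add _ _ hF hG.neg

theorem mul (hF : SuperAnalyticAt w F) (hG : SuperAnalyticAt w G) :
    SuperAnalyticAt w (fun v => F v * G v) := by
  induction hF with
  | smul c a hc ha =>
    simp only [smul_mul_assoc]
    refine csmul hc ?_
    induction hG with
    | smul e b he hb =>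
      simp only [mul_smul_comm]
      exact smul _ _ he (mul_mem ha hb)
    | add F G _ _ h1 h2 => simpa only [mul_add] using add _ _ h1 h2
    | congr F G _ h ih => exact congr _ _ ih (h.mono fun v hv => by simp only [hv])
  | add F F' _ _ h1 h2 => simpa only [add_mul] using add _ _ h1 h2
  | congr F F' _ h ih => exact congr _ _ ih (h.mono fun v hv => by simp only [hv])

theorem pow (hF : SuperAnalyticAt w F) (k : ℕ) : SuperAnalyticAt w (fun v => F v ^ k) := by
  induction k with
  | zero => simpa using const (one_mem _) w
  | succ k ih => simpa only [pow_succ] using ih.mul hF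

theorem eventually (hF : SuperAnalyticAt w F) : ∀ᶠ v in 𝓝 w, SuperAnalyticAt v F := by
  induction hF with
  | smul c a hc ha => exact hc.eventually_analyticAt.mono fun v hv => smul c a hv ha
  | add F G _ _ h1 h2 => filter_upwards [h1, h2] with v hv1 hv2 using add _ _ hv1 hv2
  | congr F G _ h ih =>
    filter_upwards [ih, eventually_eventually_nhds.2 h] with v hv1 hv2 using congr _ _ hv1 hv2

theorem mem_lowAlg (hF : SuperAnalyticAt w F) : F w ∈ lowAlg L := by
  induction hF with
  | smul c a hc ha => exact Subalgebra.smul_mem _ ha _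
  | add F G _ _ h1 h2 => exact add_mem h1 h2
  | congr F G _ h ih => exact h.eq_of_nhds ▸ ih

theorem dual (hF : SuperAnalyticAt w F) (ℓ : Module.Dual ℂ (Gr L)) :
    AnalyticAt ℂ (fun v => ℓ (F v)) w := by
  induction hF with
  | smul c a hc ha => simpa only [map_smul, smul_eq_mul] using hc.fun_mul analyticAt_const
  | add F G _ _ h1 h2 => simpa only [map_add] using h1.fun_add h2
  | congr F G _ h ih => exact ih.congr (h.fun_comp ℓ)

theorem body (hF : SuperAnalyticAt w F) : AnalyticAt ℂ (fun v => N2.body (F v)) w :=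
  hF.dual (N2.body (L := L)).toLinearMap

theorem exists_deriv (hF : SuperAnalyticAt w F) : ∃ F' : ℂ → Gr L, SuperAnalyticAt w F' ∧
    ∀ᶠ v in 𝓝 w, HasWeakDerivAt F (F' v) v := by
  induction hF with
  | smul c a hc ha =>
    refine ⟨fun v => deriv c v • a, smul _ _ hc.deriv ha, ?_⟩
    filter_upwards [hc.eventually_analyticAt] with v hv
    simpa using HasWeakDerivAt.smul hv.differentiableAt.hasDerivAt (.const a v)
  | add F G _ _ h1 h2 =>
    obtain ⟨F', hF', h1⟩ := h1
    obtain ⟨G', hG', h2⟩ := h2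
    refine ⟨_, add _ _ hF' hG', ?_⟩
    filter_upwards [h1, h2] with v h1 h2 using h1.add h2
  | congr F G _ h ih =>
    obtain ⟨F', hF', h1⟩ := ih
    refine ⟨F', hF', ?_⟩
    filter_upwards [h1, eventually_eventually_nhds.2 h] with v h1 h2 using h1.congr h2

theorem wderiv (hF : SuperAnalyticAt w F) : SuperAnalyticAt w (N2.wderiv F) := by
  obtain ⟨F', hF', h⟩ := hF.exists_deriv
  exact congr _ _ hF' (h.mono fun v hv => hv.wderiv_eq.symm)

theorem hasWeakDerivAt (hF : SuperAnalyticAt w F) : HasWeakDerivAt F (N2.wderiv F w) w := by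
  obtain ⟨F', hF', h⟩ := hF.exists_deriv
  rw [h.self_of_nhds.wderiv_eq]
  exact h.self_of_nhds

theorem wderiv_iterate (hF : SuperAnalyticAt w F) (l : ℕ) :
    SuperAnalyticAt w (N2.wderiv^[l] F) := by
  induction l with
  | zero => exact hF
  | succ l ih => rw [Function.iterate_succ_apply']; exact ih.wderiv

theorem hasWeakDerivAt_mul (hF : SuperAnalyticAt w F) {a b : Gr L}
    (h : HasWeakDerivAt F a w) (h' : HasWeakDerivAt G b w) :
    HasWeakDerivAt (fun v => F v * G v) (a * G w + F w * b) w := by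
  induction hF generalizing a with
  | smul c x hc hx =>
    have h1 := HasWeakDerivAt.smul hc.differentiableAt.hasDerivAt (.const x w)
    have h2 := HasWeakDerivAt.smul hc.differentiableAt.hasDerivAt
      (h'.linear (LinearMap.mulLeft ℂ x))
    simp only [smul_mul_assoc]
    rw [h.unique h1]
    simpa using h2
  | add F F' h1 h2 ih1 ih2 =>
    have := (ih1 h1.hasWeakDerivAt).add (ih2 h2.hasWeakDerivAt)
    rw [h.unique (h1.hasWeakDerivAt.add h2.hasWeakDerivAt)]
    simp only [add_mul]
    convert! this using 1
    abel
  | congr F F' h1 h2 ih =>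
    rw [← h2.eq_of_nhds]
    exact (ih (h.congr h2.symm)).congr (h2.mono fun v hv => by simp only [hv])

theorem wderiv_add (hF : SuperAnalyticAt w F) (hG : SuperAnalyticAt w G) :
    N2.wderiv (fun v => F v + G v) w = N2.wderiv F w + N2.wderiv G w :=
  (hF.hasWeakDerivAt.add hG.hasWeakDerivAt).wderiv_eq

theorem wderiv_mem (hF : SuperAnalyticAt w F) (W : Submodule ℂ (Gr L))
    (h : ∀ᶠ v in 𝓝 w, F v ∈ W) : N2.wderiv F w ∈ W :=
  hF.hasWeakDerivAt.mem W h

theorem wderiv_iterate_mem (hF : SuperAnalyticAt w F) (W : Submodule ℂ (Gr L))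
    (h : ∀ᶠ v in 𝓝 w, F v ∈ W) (l : ℕ) : ∀ᶠ v in 𝓝 w, N2.wderiv^[l] F v ∈ W := by
  induction l with
  | zero => exact h
  | succ l ih =>
    rw [Function.iterate_succ_apply']
    filter_upwards [(hF.wderiv_iterate l).eventually, eventually_eventually_nhds.2 ih]
      with v h1 h2 using h1.wderiv_mem W h2

theorem wderiv_iterate_add (hF : SuperAnalyticAt w F) (hG : SuperAnalyticAt w G) (l : ℕ) :
    N2.wderiv^[l] (fun v => F v + G v) =ᶠ[𝓝 w]
      fun v => N2.wderiv^[l] F v + N2.wderiv^[l] G v := by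
  induction l with
  | zero => rfl
  | succ l ih =>
    simp only [Function.iterate_succ_apply']
    refine (wderiv_eventuallyEq ih).trans ?_
    filter_upwards [(hF.wderiv_iterate l).eventually, (hG.wderiv_iterate l).eventually]
      with v h1 h2 using h1.wderiv_add h2

/-- Two super-analytic functions agreeing on a punctured neighbourhood agree near the point. -/
theorem eventuallyEq_of_punctured (hF : SuperAnalyticAt w F) (hG : SuperAnalyticAt w G)
    (h : ∀ᶠ v in 𝓝[≠] w, F v = G v) : F =ᶠ[𝓝 w] G := by
  have h1 : F w = G w := eq_of_dual fun ℓ => by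
    have h2 := tendsto_nhdsWithin_of_tendsto_nhds (s := {w}ᶜ) (hF.dual ℓ).continuousAt.tendsto
    have h3 := tendsto_nhdsWithin_of_tendsto_nhds (s := {w}ᶜ) (hG.dual ℓ).continuousAt.tendsto
    exact tendsto_nhds_unique (h2.congr' (h.mono fun v hv => by rw [hv])) h3
  filter_upwards [eventually_nhdsWithin_iff.1 h] with v hv
  by_cases hvw : v = w
  · rw [hvw, h1]
  · exact hv hvw

theorem exists_sum (hF : SuperAnalyticAt w F) : ∃ (n : ℕ) (c : Fin n → ℂ → ℂ) (a : Fin n → Gr L),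
    (∀ i, a i ∈ lowAlg L) ∧ F =ᶠ[𝓝 w] fun v => ∑ i, c i v • a i := by
  induction hF with
  | smul c a hc ha => exact ⟨1, fun _ => c, fun _ => a, fun _ => ha, by simp⟩
  | add F G _ _ h1 h2 =>
    obtain ⟨n, c, a, ha, h1⟩ := h1
    obtain ⟨m, e, b, hb, h2⟩ := h2
    refine ⟨n + m, Fin.append c e, Fin.append a b, ?_, ?_⟩
    · exact Fin.addCases (by simpa using ha) (by simpa using hb)
    · filter_upwards [h1, h2] with v h1 h2
      simp [Fin.sum_univ_add, h1, h2]
  | congr F G _ h ih =>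
    obtain ⟨n, c, a, ha, h1⟩ := ih
    exact ⟨n, c, a, ha, h.symm.trans h1⟩

/-- Soul parts of a germ of an even function are uniformly nilpotent. -/
theorem exists_soul_pow_eq_zero (hF : SuperAnalyticAt w F) (he : ∀ᶠ v in 𝓝 w, F v ∈ even L) :
    ∃ m : ℕ, ∀ᶠ v in 𝓝 w, soul (F v) ^ m = 0 := by
  obtain ⟨n, c, a, ha, h⟩ := hF.exists_sum
  choose x hx y hy hxy using fun i => exists_lowEven_add_lowOdd (ha i)
  let N : Fin n → lowEvenAlg L := fun i =>
    (⟨x i, hx i⟩ : lowEvenAlg L) - algebraMap ℂ (lowEvenAlg L) (N2.body (x i))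
  have hnil : IsNilpotent (Ideal.span (Set.range N)) := by
    refine (Ideal.FG.isNilpotent_iff_le_nilradical
      (Submodule.fg_span (Set.finite_range N))).2 (Ideal.span_le.2 ?_)
    rintro _ ⟨i, rfl⟩
    exact isNilpotent_lowEvenAlg (hx i)
  obtain ⟨m, hm⟩ := hnil
  refine ⟨m, ?_⟩
  filter_upwards [h, he] with v hv hev
  have h1 : F v = ∑ i, c i v • x i := by
    have h2 : F v = ∑ i, c i v • x i + ∑ i, c i v • y i := by
      rw [hv, ← Finset.sum_add_distrib]
      simp only [← smul_add, hxy]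
    have h3 : ∑ i, c i v • y i = 0 := by
      refine eq_zero_of_even_of_odd (L := L) ?_
        (Submodule.sum_mem _ fun i _ => Submodule.smul_mem _ _ (hy i).1)
      have h4 : ∑ i, c i v • y i = F v - ∑ i, c i v • x i := by rw [h2, add_sub_cancel_left]
      rw [h4]
      exact sub_mem hev (Submodule.sum_mem _ fun i _ => Submodule.smul_mem _ _ (hx i).1)
    rw [h2, h3, add_zero]
  have h2 : soul (F v) = ((∑ i, c i v • N i : lowEvenAlg L) : Gr L) := by
    simp only [soul, h1, N, map_sum, map_smul, AddSubmonoidClass.coe_finsetSum,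
      Subalgebra.coe_smul, Subalgebra.coe_sub, Subalgebra.coe_algebraMap, smul_sub,
      Finset.sum_sub_distrib]
    congr 1
    refine Finset.sum_congr rfl fun i _ => ?_
    rw [smul_eq_mul, map_mul, Algebra.smul_def]
  have h3 : (∑ i, c i v • N i) ∈ Ideal.span (Set.range N) :=
    Submodule.sum_mem _ fun i _ => by
      rw [Algebra.smul_def]
      exact Ideal.mul_mem_left _ _ (Ideal.subset_span ⟨i, rfl⟩)
  have h4 : (∑ i, c i v • N i) ^ m = 0 := by
    have := Ideal.pow_mem_pow h3 m
    rwa [hm, Submodule.zero_eq_bot, Submodule.mem_bot] at this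
  rw [h2, ← Subalgebra.coe_pow, h4, Subalgebra.coe_zero]

theorem inverse (hF : SuperAnalyticAt w F) (he : ∀ᶠ v in 𝓝 w, F v ∈ even L)
    (hu : IsUnit (F w)) : SuperAnalyticAt w (fun v => Ring.inverse (F v)) := by
  obtain ⟨m, hm⟩ := hF.exists_soul_pow_eq_zero he
  have hb := hF.body
  have hb0 := body_ne_zero_of_isUnit hu
  have hN : SuperAnalyticAt w (fun v => soul (F v)) := by
    refine sub hF ?_
    simp only [Algebra.algebraMap_eq_smul_one]
    exact csmul hb (const (one_mem _) w)
  have hG : SuperAnalyticAt w (fun v => (N2.body (F v))⁻¹ •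
      ∑ j ∈ Finset.range m, (-((N2.body (F v))⁻¹ • soul (F v))) ^ j) :=
    csmul (hb.inv hb0) (sum _ fun j _ => (csmul (hb.inv hb0) hN).neg.pow j)
  refine congr _ _ hG ?_
  filter_upwards [hm, hb.continuousAt.eventually_ne hb0, he] with v hv hv0 hve
  set x := -((N2.body (F v))⁻¹ • soul (F v)) with hx
  have h1 : F v = N2.body (F v) • (1 - x) := by
    rw [hx, sub_neg_eq_add, smul_add, smul_smul, mul_inv_cancel₀ hv0, one_smul, soul,
      ← Algebra.algebraMap_eq_smul_one, add_sub_cancel]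
  have h2 : x ^ m = 0 := by
    rw [hx, neg_pow, smul_pow, hv, smul_zero, mul_zero]
  have h3 : F v * ((N2.body (F v))⁻¹ • ∑ j ∈ Finset.range m, x ^ j) = 1 := by
    nth_rewrite 1 [h1]
    rw [smul_mul_smul_comm, mul_inv_cancel₀ hv0, one_smul, mul_neg_geom_sum, h2, sub_zero]
  have hU := isUnit_of_body_ne_zero hve hv0
  rw [← mul_one (Ring.inverse (F v)), ← h3, ← mul_assoc, Ring.inverse_mul_cancel _ hU, one_mul]

end SuperAnalyticAt

/-! ### Taylor expansion in the soul -/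

/-- The extension of a function on the body to supernumbers by Taylor expansion. -/
noncomputable def taylor (F : ℂ → Gr L) (z : Gr L) : Gr L :=
  ∑ᶠ l : ℕ, ((l.factorial : ℂ)⁻¹) • (soul z ^ l * wderiv^[l] F (body z))

theorem taylor_eq_sum (F : ℂ → Gr L) {z : Gr L} {m : ℕ} (hm : soul z ^ m = 0) :
    taylor F z = ∑ l ∈ Finset.range m,
      ((l.factorial : ℂ)⁻¹) • (soul z ^ l * wderiv^[l] F (body z)) := by
  refine finsum_eq_sum_of_support_subset _ fun l hl => ?_
  rw [Finset.coe_range, Set.mem_Iio]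
  by_contra h
  exact hl (by simp [pow_eq_zero_of_le (not_lt.1 h) hm])

theorem taylor_congr {F G : ℂ → Gr L} {z : Gr L} (h : F =ᶠ[𝓝 (body z)] G) :
    taylor F z = taylor G z := by
  simp only [taylor, fun l => (wderiv_iterate_eventuallyEq h l).eq_of_nhds]

@[simp] theorem soul_algebraMap (w : ℂ) : soul (algebraMap ℂ (Gr L) w) = 0 := by simp [soul]

theorem taylor_algebraMap (F : ℂ → Gr L) (w : ℂ) : taylor F (algebraMap ℂ (Gr L) w) = F w := by
  rw [taylor_eq_sum F (m := 1) (by simp)]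
  simp

theorem taylor_mem (W : Submodule ℂ (Gr L)) {F : ℂ → Gr L} {z : Gr L} (hz : z ∈ even L)
    (hW : ∀ x ∈ even L, ∀ y ∈ W, x * y ∈ W)
    (hF : SuperAnalyticAt (body z) F) (h : ∀ᶠ v in 𝓝 (body z), F v ∈ W) : taylor F z ∈ W := by
  obtain ⟨m, hm⟩ := soul_nilpotent hz
  rw [taylor_eq_sum F hm]
  exact Submodule.sum_mem _ fun l _ => Submodule.smul_mem _ _
    (hW _ (even_pow_mem (soul_mem_even hz) l) _ (hF.wderiv_iterate_mem W h l).self_of_nhds)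

theorem taylor_add {F G : ℂ → Gr L} {z : Gr L} (hz : z ∈ even L)
    (hF : SuperAnalyticAt (body z) F) (hG : SuperAnalyticAt (body z) G) :
    taylor (fun v => F v + G v) z = taylor F z + taylor G z := by
  obtain ⟨m, hm⟩ := soul_nilpotent hz
  simp only [taylor_eq_sum _ hm, ← Finset.sum_add_distrib, ← smul_add, ← mul_add]
  refine Finset.sum_congr rfl fun l _ => ?_
  rw [(hF.wderiv_iterate_add hG l).eq_of_nhds]

theorem wderiv_iterate_smul {c : ℂ → ℂ} {w : ℂ} (hc : AnalyticAt ℂ c w) (a : Gr L) (l : ℕ) :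
    wderiv^[l] (fun v => c v • a) =ᶠ[𝓝 w] fun v => iteratedDeriv l c v • a := by
  induction l with
  | zero => simp
  | succ l ih =>
    rw [Function.iterate_succ_apply', iteratedDeriv_succ]
    refine (wderiv_eventuallyEq ih).trans ?_
    filter_upwards [(hc.iterated_deriv l).eventually_analyticAt] with v hv
    rw [← iteratedDeriv_eq_iterate] at hv
    simpa using (HasWeakDerivAt.smul hv.differentiableAt.hasDerivAt (.const a v)).wderiv_eq

theorem sum_range_mul_sum_range_of_pow_eq_zero {A : Type*} [Ring A] [Algebra ℂ A] {s : A} {m : ℕ}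
    (hs : s ^ m = 0) (x y : ℕ → ℂ) :
    (∑ i ∈ Finset.range m, x i • s ^ i) * ∑ j ∈ Finset.range m, y j • s ^ j
      = ∑ l ∈ Finset.range m, (∑ p ∈ Finset.HasAntidiagonal.antidiagonal l, x p.1 * y p.2) • s ^ l := by
  rw [Finset.sum_mul_sum, ← Finset.sum_product']
  have h1 : ∀ l ∈ Finset.range m, (∑ p ∈ Finset.HasAntidiagonal.antidiagonal l, x p.1 * y p.2) • s ^ l
      = ∑ p ∈ ((Finset.range m ×ˢ Finset.range m).filter (fun p => p.1 + p.2 < m)).filter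
          (fun p => p.1 + p.2 = l), (x p.1 • s ^ p.1) * (y p.2 • s ^ p.2) := by
    intro l hl
    rw [Finset.sum_smul]
    have : ((Finset.range m ×ˢ Finset.range m).filter (fun p => p.1 + p.2 < m)).filter
        (fun p => p.1 + p.2 = l) = Finset.HasAntidiagonal.antidiagonal l := by
      ext ⟨i, j⟩
      simp only [Finset.mem_filter, Finset.mem_product, Finset.mem_range,
        Finset.HasAntidiagonal.mem_antidiagonal] at hl ⊢
      omega
    rw [this]
    refine Finset.sum_congr rfl fun p hp => ?_
    rw [smul_mul_smul_comm, ← pow_add, Finset.HasAntidiagonal.mem_antidiagonal.1 hp]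
  rw [Finset.sum_congr rfl h1, Finset.sum_fiberwise_of_maps_to (g := fun p : ℕ × ℕ => p.1 + p.2)
    (fun p hp => Finset.mem_range.2 (Finset.mem_filter.1 hp).2)]
  refine (Finset.sum_subset (Finset.filter_subset _ _) fun p hp hp' => ?_).symm
  have : m ≤ p.1 + p.2 := by
    by_contra h
    exact hp' (Finset.mem_filter.2 ⟨hp, not_le.1 h⟩)
  rw [smul_mul_smul_comm, ← pow_add, pow_eq_zero_of_le this hs, smul_zero]

theorem iteratedDeriv_mul_div_factorial {c e : ℂ → ℂ} {w : ℂ} (hc : AnalyticAt ℂ c w)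
    (he : AnalyticAt ℂ e w) (l : ℕ) :
    (l.factorial : ℂ)⁻¹ * iteratedDeriv l (fun v => c v * e v) w
      = ∑ p ∈ Finset.HasAntidiagonal.antidiagonal l, ((p.1.factorial : ℂ)⁻¹ * iteratedDeriv p.1 c w)
        * ((p.2.factorial : ℂ)⁻¹ * iteratedDeriv p.2 e w) := by
  have := iteratedDeriv_mul (n := l) hc.contDiffAt he.contDiffAt
  change iteratedDeriv l (fun v => c v * e v) w = _ at this
  rw [this, Finset.mul_sum, Finset.Nat.sum_antidiagonal_eq_sum_range_succ_mk]
  refine Finset.sum_congr rfl fun i hi => ?_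
  have hi' : i ≤ l := Nat.lt_succ_iff.1 (Finset.mem_range.1 hi)
  rw [Nat.cast_choose ℂ hi']
  have := Nat.factorial_ne_zero l
  have := Nat.factorial_ne_zero i
  have := Nat.factorial_ne_zero (l - i)
  field_simp

theorem taylor_smul {c : ℂ → ℂ} {z : Gr L} (hc : AnalyticAt ℂ c (body z)) (a : Gr L) {m : ℕ}
    (hm : soul z ^ m = 0) : taylor (fun v => c v • a) z
      = (∑ l ∈ Finset.range m, ((l.factorial : ℂ)⁻¹ * iteratedDeriv l c (body z)) • soul z ^ l)
        * a := by
  rw [taylor_eq_sum _ hm, Finset.sum_mul]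
  refine Finset.sum_congr rfl fun l _ => ?_
  rw [(wderiv_iterate_smul hc a l).eq_of_nhds, mul_smul_comm, smul_smul, smul_mul_assoc]

theorem taylor_mul {F G : ℂ → Gr L} {z : Gr L} (hz : z ∈ even L)
    (hF : SuperAnalyticAt (body z) F) (hG : SuperAnalyticAt (body z) G) :
    taylor (fun v => F v * G v) z = taylor F z * taylor G z := by
  obtain ⟨m, hm⟩ := soul_nilpotent hz
  induction hF with
  | smul c a hc ha =>
    have hF := SuperAnalyticAt.smul c a hc ha
    induction hG with
    | smul e b he hb =>
      have h1 : (fun v => c v • a * e v • b) = fun v => (c v * e v) • (a * b) := by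
        ext v
        rw [smul_mul_smul_comm]
      rw [h1, taylor_smul (hc.fun_mul he) _ hm, taylor_smul hc _ hm, taylor_smul he _ hm]
      simp only [iteratedDeriv_mul_div_factorial hc he]
      rw [← sum_range_mul_sum_range_of_pow_eq_zero hm
        (fun l => (l.factorial : ℂ)⁻¹ * iteratedDeriv l c (body z))
        (fun l => (l.factorial : ℂ)⁻¹ * iteratedDeriv l e (body z))]
      have h2 : ∑ l ∈ Finset.range m,
          ((l.factorial : ℂ)⁻¹ * iteratedDeriv l e (body z)) • soul z ^ l ∈ even L :=
        Submodule.sum_mem _ fun l _ => Submodule.smul_mem _ _ (even_pow_mem (soul_mem_even hz) l)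
      rw [mul_assoc, mul_assoc, ← mul_assoc a, ← even_comm h2 a, mul_assoc]
    | add F G h1 h2 ih1 ih2 =>
      simp only [mul_add]
      rw [taylor_add hz (hF.mul h1) (hF.mul h2), ih1, ih2, taylor_add hz h1 h2, mul_add]
    | congr F G h h' ih =>
      rw [← taylor_congr h', ← ih]
      exact taylor_congr (h'.mono fun v hv => by simp only [hv])
  | add F F' h1 h2 ih1 ih2 =>
    simp only [add_mul]
    rw [taylor_add hz (h1.mul hG) (h2.mul hG), ih1, ih2, taylor_add hz h1 h2, add_mul]
  | congr F F' h h' ih =>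
    rw [← taylor_congr h', ← ih]
    exact taylor_congr (h'.mono fun v hv => by simp only [hv])

theorem taylor_const {a : Gr L} {z : Gr L} (hz : z ∈ even L) : taylor (fun _ => a) z = a := by
  obtain ⟨m, hm⟩ := soul_nilpotent hz
  have hm' : soul z ^ (m + 1) = 0 := pow_eq_zero_of_le (Nat.le_succ m) hm
  have := taylor_smul (c := fun _ => 1) (z := z) analyticAt_const a hm'
  simp only [one_smul] at this
  rw [this, Finset.sum_range_succ']
  simp [iteratedDeriv_const]

theorem superAnalyticAt_algebraMap (w : ℂ) :
    SuperAnalyticAt w (fun v => algebraMap ℂ (Gr L) v) := by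
  simp only [Algebra.algebraMap_eq_smul_one]
  exact .smul _ _ analyticAt_id (one_mem _)

theorem taylor_id {z : Gr L} (hz : z ∈ even L) :
    taylor (fun v => algebraMap ℂ (Gr L) v) z = z := by
  obtain ⟨m, hm⟩ := soul_nilpotent hz
  have hm' : soul z ^ (m + 1 + 1) = 0 := pow_eq_zero_of_le (by omega) hm
  simp only [Algebra.algebraMap_eq_smul_one]
  rw [taylor_smul (c := fun v => v) (z := z) analyticAt_id _ hm', Finset.sum_range_succ',
    Finset.sum_range_succ']
  have h2 : ∀ l : ℕ, iteratedDeriv (l + 1 + 1) (fun v : ℂ => v) (body z) = 0 := by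
    intro l
    rw [iteratedDeriv_succ', iteratedDeriv_succ']
    simp
  simp [h2, iteratedDeriv_one, soul, Algebra.algebraMap_eq_smul_one]

theorem taylor_pow {F : ℂ → Gr L} {z : Gr L} (hz : z ∈ even L)
    (hF : SuperAnalyticAt (body z) F) (k : ℕ) :
    taylor (fun v => F v ^ k) z = taylor F z ^ k := by
  induction k with
  | zero => simpa using taylor_const hz
  | succ k ih => simp only [pow_succ]; rw [taylor_mul hz (hF.pow k) hF, ih]

theorem taylor_sum {ι : Type*} (s : Finset ι) {F : ι → ℂ → Gr L} {z : Gr L} (hz : z ∈ even L)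
    (hF : ∀ i ∈ s, SuperAnalyticAt (body z) (F i)) :
    taylor (fun v => ∑ i ∈ s, F i v) z = ∑ i ∈ s, taylor (F i) z := by
  classical
  induction s using Finset.induction_on with
  | empty => simpa using taylor_const hz
  | insert i s hi ih =>
    have h' : ∀ j ∈ s, SuperAnalyticAt (body z) (F j) :=
      fun j hj => hF j (Finset.mem_insert_of_mem hj)
    simp only [Finset.sum_insert hi]
    rw [taylor_add hz (hF i (Finset.mem_insert_self _ _)) (.sum _ h'), ih h']

theorem wderiv_iterate_zero (l : ℕ) (w : ℂ) :
    wderiv^[l] (fun _ => (0 : Gr L)) =ᶠ[𝓝 w] fun _ => 0 := by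
  have := wderiv_iterate_smul (w := w) (c := fun _ => 0) analyticAt_const (0 : Gr L) l
  simpa using this

theorem wderiv_iterate_sum {ι : Type*} (s : Finset ι) {F : ι → ℂ → Gr L} {w : ℂ} (l : ℕ)
    (hF : ∀ i ∈ s, SuperAnalyticAt w (F i)) :
    wderiv^[l] (fun v => ∑ i ∈ s, F i v) =ᶠ[𝓝 w] fun v => ∑ i ∈ s, wderiv^[l] (F i) v := by
  classical
  induction s using Finset.induction_on with
  | empty => simpa using wderiv_iterate_zero l w
  | insert i s hi ih =>
    have h' : ∀ j ∈ s, SuperAnalyticAt w (F j) :=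
      fun j hj => hF j (Finset.mem_insert_of_mem hj)
    simp only [Finset.sum_insert hi]
    refine ((hF i (Finset.mem_insert_self _ _)).wderiv_iterate_add (.sum _ h') l).trans ?_
    filter_upwards [ih h'] with v hv
    rw [hv]

/-! ### Coefficient functions and functions on the body -/

/-- The restriction of a superfunction to the body. -/
noncomputable def Coeff.onBody (f : Coeff L) (v : ℂ) : Gr L := ∑ᶠ k, f k v • zetaProd k

namespace Coeff

theorem isAnalytic_empty (f : Coeff L) : f.IsAnalytic ∅ :=
  ⟨fun _ _ h => h.elim, fun _ _ _ h => h.elim, fun _ h => h.elim⟩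

theorem onBody_zero (v : ℂ) : (0 : Coeff L).onBody v = 0 := by simp [onBody]

theorem onBody_neg (f : Coeff L) (v : ℂ) : (-f).onBody v = -f.onBody v := by
  simp [onBody, finsum_neg_distrib]

theorem zetaProd_mem_lowAlg {k : Finset (Gen L)} (h : ∀ i ∈ k, IsLow i) :
    zetaProd k ∈ lowAlg L :=
  list_prod_mem fun x hx => by
    obtain ⟨i, hi, rfl⟩ := List.mem_map.1 hx
    exact Algebra.subset_adjoin ⟨i, h i ((Finset.mem_sort _).1 hi), rfl⟩

namespace IsAnalytic

variable {f g : Coeff L} {V : Set ℂ} {w : ℂ}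

theorem superAnalyticAt_term (hf : f.IsAnalytic V) (hV : IsOpen V) (hw : w ∈ V)
    (k : Finset (Gen L)) : SuperAnalyticAt w (fun v => f k v • zetaProd k) := by
  by_cases h : ∃ i ∈ k, ¬ IsLow i
  · refine .congr _ _ (.zero w) ?_
    filter_upwards [hV.mem_nhds hw] with v hv
    rw [hf.low k h v hv, zero_smul]
  · push Not at h
    exact .smul _ _ (hf.analytic k w hw) (zetaProd_mem_lowAlg h)

theorem exists_finset (hf : f.IsAnalytic V) (hV : IsOpen V) (hw : w ∈ V) :
    ∃ S : Finset (Finset (Gen L)), ∀ᶠ v in 𝓝 w, ∀ k ∉ S, f k =ᶠ[𝓝 v] 0 := by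
  refine ⟨(hf.finite w hw).toFinset, ?_⟩
  obtain ⟨r, hr, hB⟩ := Metric.isOpen_iff.1 hV w hw
  filter_upwards [Metric.ball_mem_nhds w hr] with v hv k hk
  simp only [Set.Finite.mem_toFinset, Set.mem_ofPred_eq, not_not] at hk
  have := ((hf.analytic k).mono hB).eqOn_zero_of_preconnected_of_eventuallyEq_zero
    (convex_ball w r).isPreconnected (Metric.mem_ball_self hr) hk
  exact this.eventuallyEq_of_mem (Metric.isOpen_ball.mem_nhds hv)

theorem onBody_eventuallyEq {S : Finset (Finset (Gen L))}
    (hS : ∀ᶠ v in 𝓝 w, ∀ k ∉ S, f k =ᶠ[𝓝 v] 0) :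
    f.onBody =ᶠ[𝓝 w] fun v => ∑ k ∈ S, f k v • zetaProd k := by
  filter_upwards [hS] with v hv
  refine finsum_eq_sum_of_support_subset _ fun k hk => ?_
  by_contra h
  exact hk (by simp [(hv k h).eq_of_nhds])

theorem superAnalyticAt (hf : f.IsAnalytic V) (hV : IsOpen V) (hw : w ∈ V) :
    SuperAnalyticAt w f.onBody := by
  obtain ⟨S, hS⟩ := hf.exists_finset hV hw
  exact .congr _ _ (.sum S fun k _ => hf.superAnalyticAt_term hV hw k)
    (onBody_eventuallyEq hS).symm

theorem finsum_iteratedDeriv (hf : f.IsAnalytic V) (hV : IsOpen V) (hw : w ∈ V) (l : ℕ) :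
    ∑ᶠ k, iteratedDeriv l (f k) w • zetaProd k = wderiv^[l] f.onBody w := by
  obtain ⟨S, hS⟩ := hf.exists_finset hV hw
  rw [(wderiv_iterate_eventuallyEq (onBody_eventuallyEq hS) l).eq_of_nhds,
    (wderiv_iterate_sum S l fun k _ => hf.superAnalyticAt_term hV hw k).eq_of_nhds]
  rw [finsum_eq_sum_of_support_subset (s := S)]
  · refine Finset.sum_congr rfl fun k _ => ?_
    rw [(wderiv_iterate_smul (hf.analytic k w hw) _ l).eq_of_nhds]
  · intro k hk
    by_contra h
    refine hk ?_
    have h1 : iteratedDeriv l (f k) w = iteratedDeriv l (0 : ℂ → ℂ) w :=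
      (hS.self_of_nhds k h).iteratedDeriv_eq l
    simp [h1]

theorem eval_eq_taylor (hf : f.IsAnalytic V) (hV : IsOpen V) {z : Gr L} (hz : body z ∈ V) :
    f.eval z = taylor f.onBody z := by
  simp only [eval, taylor, hf.finsum_iteratedDeriv hV hz]

theorem eval_algebraMap (hf : f.IsAnalytic V) (hV : IsOpen V) (hw : w ∈ V) :
    f.eval (algebraMap ℂ (Gr L) w) = f.onBody w := by
  rw [hf.eval_eq_taylor hV (by simpa using hw), taylor_algebraMap]

theorem der (hf : f.IsAnalytic V) (hV : IsOpen V) : f.der.IsAnalytic V where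
  analytic k := (hf.analytic k).deriv
  low k hk w hw := by
    have : f k =ᶠ[𝓝 w] fun _ => 0 := by
      filter_upwards [hV.mem_nhds hw] with v hv using hf.low k hk v hv
    simp [Coeff.der, this.deriv_eq]
  finite w hw := (hf.finite w hw).subset fun k hk h => hk <| by
    have : f k =ᶠ[𝓝 w] fun _ => 0 := h
    filter_upwards [this.deriv] with v hv
    simp [Coeff.der, hv]

theorem onBody_der (hf : f.IsAnalytic V) (hV : IsOpen V) (hw : w ∈ V) :
    f.der.onBody w = wderiv f.onBody w := by
  have := hf.finsum_iteratedDeriv hV hw 1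
  simp only [iteratedDeriv_one] at this
  exact this

theorem eval_der (hf : f.IsAnalytic V) (hV : IsOpen V) {z : Gr L} (hz : body z ∈ V) :
    f.der.eval z = taylor (wderiv f.onBody) z := by
  rw [(hf.der hV).eval_eq_taylor hV hz]
  refine taylor_congr ?_
  filter_upwards [hV.mem_nhds hz] with v hv using hf.onBody_der hV hv

theorem finite_support (hf : f.IsAnalytic V) (hw : w ∈ V) :
    (Function.support fun k => f k w • zetaProd k).Finite :=
  (hf.finite w hw).subset fun k hk h => hk <| by
    have : f k w = 0 := h.eq_of_nhds
    simp [this]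

theorem onBody_add (hf : f.IsAnalytic V) (hg : g.IsAnalytic V) (hw : w ∈ V) :
    (f + g).onBody w = f.onBody w + g.onBody w := by
  simp only [onBody, Pi.add_apply, add_smul]
  exact finsum_add_distrib (hf.finite_support hw) (hg.finite_support hw)

theorem add (hf : f.IsAnalytic V) (hg : g.IsAnalytic V) : (f + g).IsAnalytic V where
  analytic k := (hf.analytic k).add (hg.analytic k)
  low k hk w hw := by simp [hf.low k hk w hw, hg.low k hk w hw]
  finite w hw := ((hf.finite w hw).union (hg.finite w hw)).subset fun k hk => by
    by_contra h
    simp only [Set.mem_union, Set.mem_ofPred_eq, not_or, not_not] at h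
    refine hk ?_
    filter_upwards [h.1, h.2] with v h1 h2
    simp [h1, h2]

theorem neg (hf : f.IsAnalytic V) : (-f).IsAnalytic V where
  analytic k := (hf.analytic k).neg
  low k hk w hw := by simp [hf.low k hk w hw]
  finite w hw := (hf.finite w hw).subset fun k hk h => hk <| by
    filter_upwards [h] with v h1
    simp [h1]

theorem zero (V : Set ℂ) : (0 : Coeff L).IsAnalytic V where
  analytic k := analyticOnNhd_const
  low k hk w hw := rfl
  finite w hw := by
    refine Set.finite_empty.subset fun k hk => hk ?_
    rfl

end IsAnalytic

end Coeff

/-! ### Points over the body -/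

/-- The point with body coordinate `w` and odd coordinates `θ`, `θ'`. -/
noncomputable def bodyPoint (w : ℂ) (θ θ' : odd L) : SPoint L where
  z := algebraMap ℂ (Gr L) w
  θp := θ
  θm := θ'
  z_even := algebraMap_mem_even w
  θp_odd := θ.2
  θm_odd := θ'.2

@[simp] theorem base_bodyPoint (w : ℂ) (θ θ' : odd L) : (bodyPoint w θ θ').base = w :=
  body_algebraMap w

theorem image_base_dom {s : Set (SPoint L)} (hs : IsOpen s) :
    IsOpen (SPoint.base '' s) ∧ ∀ x, x ∈ s ↔ x.base ∈ SPoint.base '' s := by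
  obtain ⟨U, hU, rfl⟩ := isOpen_induced_iff.1 hs
  have h : SPoint.base '' (SPoint.base (L := L) ⁻¹' U) = U :=
    Set.image_preimage_eq _ fun w => ⟨bodyPoint w 0 0, by simp⟩
  rw [h]
  exact ⟨hU, fun x => Iff.rfl⟩

theorem SFun.eval_bodyPoint {H : SFun L} {V : Set ℂ} (hH : H.IsAnalytic V) (hV : IsOpen V) {w : ℂ}
    (hw : w ∈ V) (θ θ' : odd L) : H.eval (bodyPoint w θ θ') =
      H.c0.onBody w + θ * H.c1.onBody w + θ' * H.c2.onBody w + θ * θ' * H.c12.onBody w := by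
  simp only [SFun.eval, bodyPoint, hH.h0.eval_algebraMap hV hw, hH.h1.eval_algebraMap hV hw,
    hH.h2.eval_algebraMap hV hw, hH.h12.eval_algebraMap hV hw]

/-- Equations holding for all odd `θ`, `θ'` can be compared coefficientwise. -/
theorem coeff_eq_of_forall_odd (hL : 1 < L) {a b c d a' b' c' d' : Gr L}
    (ha : b ∈ lowAlg L) (hb : b' ∈ lowAlg L) (hc : c ∈ lowAlg L) (hc' : c' ∈ lowAlg L)
    (hd : d ∈ lowAlg L) (hd' : d' ∈ lowAlg L)
    (h : ∀ θ θ' : odd L, a + θ * b + θ' * c + θ * θ' * d = a' + θ * b' + θ' * c' + θ * θ' * d') :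
    a = a' ∧ b = b' ∧ c = c' ∧ d = d' := by
  have h1 : a = a' := by simpa using h 0 0
  have h2 : b = b' := eq_of_odd_mul hL ha hb fun θ hθ => by simpa [h1] using h ⟨θ, hθ⟩ 0
  have h3 : c = c' := eq_of_odd_mul hL hc hc' fun θ hθ => by simpa [h1] using h 0 ⟨θ, hθ⟩
  refine ⟨h1, h2, h3, sub_eq_zero.1 (eq_zero_of_odd_mul_odd_mul hL (sub_mem hd hd')
    fun θ hθ θ' hθ' => ?_)⟩
  have := h ⟨θ, hθ⟩ ⟨θ', hθ'⟩
  rw [h1, h2, h3] at this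
  rw [mul_sub, sub_eq_zero]
  simpa using this

theorem SFun.IsAnalytic.Dp {H : SFun L} {V : Set ℂ} (hH : H.IsAnalytic V) (hV : IsOpen V) :
    H.Dp.IsAnalytic V :=
  ⟨hH.h1.add (.zero V), (Coeff.IsAnalytic.zero V).add (.zero V), hH.h12.add (hH.h0.der hV),
    (Coeff.IsAnalytic.zero V).add (hH.h1.der hV).neg⟩

theorem SFun.IsAnalytic.Dm {H : SFun L} {V : Set ℂ} (hH : H.IsAnalytic V) (hV : IsOpen V) :
    H.Dm.IsAnalytic V :=
  ⟨hH.h2.add (.zero V), hH.h12.neg.add (hH.h0.der hV), (Coeff.IsAnalytic.zero V).add (.zero V),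
    (Coeff.IsAnalytic.zero V).add (hH.h2.der hV)⟩

theorem SFun.eval_Dp_bodyPoint {H : SFun L} {V : Set ℂ} (hH : H.IsAnalytic V) (hV : IsOpen V)
    {w : ℂ} (hw : w ∈ V) (θ θ' : odd L) : H.Dp.eval (bodyPoint w θ θ') =
      H.c1.onBody w + θ * 0 + θ' * (H.c12.onBody w + wderiv H.c0.onBody w)
        + θ * θ' * -wderiv H.c1.onBody w := by
  rw [SFun.eval_bodyPoint (hH.Dp hV) hV hw]
  have h0 : H.Dp.c0.onBody w = H.c1.onBody w := by
    refine (hH.h1.onBody_add (.zero V) hw).trans ?_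
    rw [Coeff.onBody_zero, add_zero]
  have h1 : H.Dp.c1.onBody w = 0 := by
    refine ((Coeff.IsAnalytic.zero V).onBody_add (.zero V) hw).trans ?_
    rw [Coeff.onBody_zero, add_zero]
  have h2 : H.Dp.c2.onBody w = H.c12.onBody w + wderiv H.c0.onBody w := by
    refine (hH.h12.onBody_add (hH.h0.der hV) hw).trans ?_
    rw [hH.h0.onBody_der hV hw]
  have h3 : H.Dp.c12.onBody w = -wderiv H.c1.onBody w := by
    refine ((Coeff.IsAnalytic.zero V).onBody_add (hH.h1.der hV).neg hw).trans ?_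
    rw [Coeff.onBody_zero, zero_add, Coeff.onBody_neg, hH.h1.onBody_der hV hw]
  rw [h0, h1, h2, h3]

theorem SFun.eval_Dm_bodyPoint {H : SFun L} {V : Set ℂ} (hH : H.IsAnalytic V) (hV : IsOpen V)
    {w : ℂ} (hw : w ∈ V) (θ θ' : odd L) : H.Dm.eval (bodyPoint w θ θ') =
      H.c2.onBody w + θ * (-H.c12.onBody w + wderiv H.c0.onBody w) + θ' * 0
        + θ * θ' * wderiv H.c2.onBody w := by
  rw [SFun.eval_bodyPoint (hH.Dm hV) hV hw]
  have h0 : H.Dm.c0.onBody w = H.c2.onBody w := by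
    refine (hH.h2.onBody_add (.zero V) hw).trans ?_
    rw [Coeff.onBody_zero, add_zero]
  have h1 : H.Dm.c1.onBody w = -H.c12.onBody w + wderiv H.c0.onBody w := by
    refine (hH.h12.neg.onBody_add (hH.h0.der hV) hw).trans ?_
    rw [hH.h0.onBody_der hV hw, Coeff.onBody_neg]
  have h2 : H.Dm.c2.onBody w = 0 := by
    refine ((Coeff.IsAnalytic.zero V).onBody_add (.zero V) hw).trans ?_
    rw [Coeff.onBody_zero, add_zero]
  have h3 : H.Dm.c12.onBody w = wderiv H.c2.onBody w := by
    refine ((Coeff.IsAnalytic.zero V).onBody_add (hH.h2.der hV) hw).trans ?_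
    rw [Coeff.onBody_zero, zero_add, hH.h2.onBody_der hV hw]
  rw [h0, h1, h2, h3]

theorem isComponents_of_dom_eq_empty {H : SPoint L →. SPoint L} (h : H.Dom = ∅) :
    IsComponents H 0 0 0 0 0 := by
  have h2 : ∀ x y, y ∈ H x → False := fun x y hy => by
    have : x ∈ H.Dom := (PFun.mem_dom _ _).2 ⟨y, hy⟩
    rwa [h] at this
  have h3 : SPoint.base '' H.Dom = ∅ := by rw [h, Set.image_empty]
  refine ⟨?_, ?_, ?_, ?_, ?_, ?_, fun x y hy => (h2 x y hy).elim, fun x y hy => (h2 x y hy).elim,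
    fun x y hy => (h2 x y hy).elim, ?_⟩
  iterate 5 exact h3.symm ▸ Coeff.isAnalytic_empty _
  · rw [h]; exact fun _ h => h.elim
  · rw [h]; exact fun _ h => h.elim

/-- The component functions of a superconformal map. -/
theorem IsSuperconformal.exists_isComponents (hL : 1 < L) {H : SPoint L →. SPoint L}
    (hH : IsSuperconformal H) : ∃ f gp gm ψp ψm : Coeff L, IsComponents H f gp gm ψp ψm := by
  obtain ⟨hopen, Z, P, M, hZ, hP, hM, hval, heq, -, -⟩ := hH
  obtain ⟨hV, hmem⟩ := image_base_dom hopen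
  set V := SPoint.base '' H.Dom with hVdef
  have hlow : ∀ {f : Coeff L}, f.IsAnalytic V → ∀ {w}, w ∈ V → f.onBody w ∈ lowAlg L :=
    fun hf w hw => (hf.superAnalyticAt hV hw).mem_lowAlg
  have hlow' : ∀ {f : Coeff L}, f.IsAnalytic V → ∀ {w}, w ∈ V → wderiv f.onBody w ∈ lowAlg L :=
    fun hf w hw => (hf.superAnalyticAt hV hw).wderiv.mem_lowAlg
  have hdom : ∀ {w}, w ∈ V → ∀ θ θ', bodyPoint w θ θ' ∈ H.Dom := fun hw θ θ' => by
    rw [hmem, base_bodyPoint]; exact hw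
  have hpar : ∀ {w}, w ∈ V → Z.c0.onBody w ∈ even L ∧ P.c0.onBody w ∈ odd L ∧
      M.c0.onBody w ∈ odd L ∧ P.c1.onBody w ∈ even L ∧ M.c2.onBody w ∈ even L := by
    intro w hw
    have h1 : ∀ θ θ', Z.eval (bodyPoint w θ θ') ∈ even L ∧ P.eval (bodyPoint w θ θ') ∈ odd L ∧
        M.eval (bodyPoint w θ θ') ∈ odd L := by
      intro θ θ'
      obtain ⟨y, hy⟩ := (PFun.mem_dom _ _).1 (hdom hw θ θ')
      obtain ⟨e1, e2, e3⟩ := hval _ y hy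
      exact ⟨e1 ▸ y.z_even, e2 ▸ y.θp_odd, e3 ▸ y.θm_odd⟩
    have h2 := h1 0 0
    simp only [SFun.eval_bodyPoint hZ hV hw, SFun.eval_bodyPoint hP hV hw,
      SFun.eval_bodyPoint hM hV hw, ZeroMemClass.coe_zero, zero_mul, add_zero] at h2
    refine ⟨h2.1, h2.2.1, h2.2.2, even_of_odd_mul hL (hlow hP.h1 hw) fun θ hθ => ?_,
      even_of_odd_mul hL (hlow hM.h2 hw) fun θ hθ => ?_⟩
    · have := (h1 ⟨θ, hθ⟩ 0).2.1
      simp only [SFun.eval_bodyPoint hP hV hw, ZeroMemClass.coe_zero, zero_mul, mul_zero,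
        add_zero] at this
      simpa using sub_mem this h2.2.1
    · have := (h1 0 ⟨θ, hθ⟩).2.2
      simp only [SFun.eval_bodyPoint hM hV hw, ZeroMemClass.coe_zero, zero_mul,
        add_zero] at this
      simpa using sub_mem this h2.2.2
  have hrelM : ∀ {w}, w ∈ V → M.c1.onBody w = 0 ∧ M.c12.onBody w = -wderiv M.c0.onBody w := by
    intro w hw
    have := coeff_eq_of_forall_odd hL (a := M.c1.onBody w) (a' := 0) (b' := 0) (c' := 0) (d' := 0)
      (zero_mem _) (zero_mem _) (add_mem (hlow hM.h12 hw) (hlow' hM.h0 hw)) (zero_mem _)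
      (neg_mem (hlow' hM.h1 hw)) (zero_mem _) fun θ θ' => by
        rw [← SFun.eval_Dp_bodyPoint hM hV hw, (heq _ (hdom hw θ θ')).1]
        simp
    exact ⟨this.1, eq_neg_of_add_eq_zero_left this.2.2.1⟩
  have hrelP : ∀ {w}, w ∈ V → P.c2.onBody w = 0 ∧ P.c12.onBody w = wderiv P.c0.onBody w := by
    intro w hw
    have := coeff_eq_of_forall_odd hL (a := P.c2.onBody w) (a' := 0) (b' := 0) (c' := 0) (d' := 0)
      (add_mem (neg_mem (hlow hP.h12 hw)) (hlow' hP.h0 hw)) (zero_mem _) (zero_mem _) (zero_mem _)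
      (hlow' hP.h2 hw) (zero_mem _) fun θ θ' => by
        rw [← SFun.eval_Dm_bodyPoint hP hV hw, (heq _ (hdom hw θ θ')).2.1]
        simp
    exact ⟨this.1, (neg_add_eq_zero.1 this.2.1)⟩
  have hZp : ∀ {w}, w ∈ V → Z.c1.onBody w = P.c1.onBody w * M.c0.onBody w ∧
      Z.c12.onBody w + wderiv Z.c0.onBody w = M.c2.onBody w * P.c1.onBody w
        - M.c0.onBody w * wderiv P.c0.onBody w - M.c0.onBody w * wderiv P.c0.onBody w := by
    intro w hw
    obtain ⟨-, hp0, hm0, hp1, hm2⟩ := hpar hw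
    have h1 : ∀ θ : odd L, Z.c1.onBody w + θ * (Z.c12.onBody w + wderiv Z.c0.onBody w)
        = M.c0.onBody w * P.c1.onBody w + θ * (M.c2.onBody w * P.c1.onBody w
        - M.c0.onBody w * wderiv P.c0.onBody w - M.c0.onBody w * wderiv P.c0.onBody w) := by
      intro θ
      have := (heq _ (hdom hw 0 θ)).2.2.1
      rw [SFun.eval_Dp_bodyPoint hZ hV hw, SFun.eval_Dp_bodyPoint hP hV hw,
        SFun.eval_bodyPoint hM hV hw, (hrelP hw).2] at this
      simp only [ZeroMemClass.coe_zero, zero_mul, add_zero] at this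
      rw [sub_eq_zero.1 this]
      have e1 : M.c0.onBody w * (θ : Gr L) = -(θ * M.c0.onBody w) := odd_anticomm hm0 θ.2
      have e2 : (θ : Gr L) * M.c2.onBody w * θ = 0 := odd_mul_mul_self θ.2 _
      simp only [mul_add, add_mul, ← mul_assoc, e1, e2, neg_mul, mul_sub, add_zero]
      abel
    have h2 : Z.c1.onBody w = M.c0.onBody w * P.c1.onBody w := by simpa using h1 0
    refine ⟨h2.trans (even_comm hp1 _).symm, eq_of_odd_mul hL
      (add_mem (hlow hZ.h12 hw) (hlow' hZ.h0 hw))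
      (sub_mem (sub_mem (mul_mem (hlow hM.h2 hw) (hlow hP.h1 hw))
        (mul_mem (hlow hM.h0 hw) (hlow' hP.h0 hw)))
        (mul_mem (hlow hM.h0 hw) (hlow' hP.h0 hw))) fun θ hθ => ?_⟩
    have := h1 ⟨θ, hθ⟩
    rwa [h2, add_right_inj] at this
  have hZm : ∀ {w}, w ∈ V → Z.c2.onBody w = M.c2.onBody w * P.c0.onBody w ∧
      -Z.c12.onBody w + wderiv Z.c0.onBody w = P.c1.onBody w * M.c2.onBody w
        - P.c0.onBody w * wderiv M.c0.onBody w - P.c0.onBody w * wderiv M.c0.onBody w := by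
    intro w hw
    obtain ⟨-, hp0, hm0, hp1, hm2⟩ := hpar hw
    have h1 : ∀ θ : odd L, Z.c2.onBody w + θ * (-Z.c12.onBody w + wderiv Z.c0.onBody w)
        = P.c0.onBody w * M.c2.onBody w + θ * (P.c1.onBody w * M.c2.onBody w
        - P.c0.onBody w * wderiv M.c0.onBody w - P.c0.onBody w * wderiv M.c0.onBody w) := by
      intro θ
      have := (heq _ (hdom hw θ 0)).2.2.2
      rw [SFun.eval_Dm_bodyPoint hZ hV hw, SFun.eval_Dm_bodyPoint hM hV hw,
        SFun.eval_bodyPoint hP hV hw, (hrelM hw).2] at this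
      simp only [ZeroMemClass.coe_zero, zero_mul, add_zero, mul_zero, neg_neg] at this
      rw [sub_eq_zero.1 this]
      have e1 : P.c0.onBody w * (θ : Gr L) = -(θ * P.c0.onBody w) := odd_anticomm hp0 θ.2
      have e2 : (θ : Gr L) * P.c1.onBody w * θ = 0 := odd_mul_mul_self θ.2 _
      simp only [mul_add, add_mul, ← mul_assoc, e1, e2, neg_mul, mul_sub, add_zero]
      abel
    have h2 : Z.c2.onBody w = P.c0.onBody w * M.c2.onBody w := by simpa using h1 0
    refine ⟨h2.trans (even_comm hm2 _).symm, eq_of_odd_mul hL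
      (add_mem (neg_mem (hlow hZ.h12 hw)) (hlow' hZ.h0 hw))
      (sub_mem (sub_mem (mul_mem (hlow hP.h1 hw) (hlow hM.h2 hw))
        (mul_mem (hlow hP.h0 hw) (hlow' hM.h0 hw)))
        (mul_mem (hlow hP.h0 hw) (hlow' hM.h0 hw))) fun θ hθ => ?_⟩
    have := h1 ⟨θ, hθ⟩
    rwa [h2, add_right_inj] at this
  have hder : ∀ {w}, w ∈ V → wderiv P.c0.onBody w ∈ odd L ∧ wderiv M.c0.onBody w ∈ odd L := by
    intro w hw
    exact ⟨(hP.h0.superAnalyticAt hV hw).wderiv_mem _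
        (Filter.Eventually.mono (hV.mem_nhds hw) fun v hv => (hpar hv).2.1),
      (hM.h0.superAnalyticAt hV hw).wderiv_mem _
        (Filter.Eventually.mono (hV.mem_nhds hw) fun v hv => (hpar hv).2.2.1)⟩
  have hcond : ∀ {w}, w ∈ V → wderiv Z.c0.onBody w = wderiv P.c0.onBody w * M.c0.onBody w
      - P.c0.onBody w * wderiv M.c0.onBody w + P.c1.onBody w * M.c2.onBody w ∧
      Z.c12.onBody w = wderiv P.c0.onBody w * M.c0.onBody w
        + P.c0.onBody w * wderiv M.c0.onBody w := by
    intro w hw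
    obtain ⟨-, hp0, hm0, hp1, hm2⟩ := hpar hw
    have h1 := (hZp hw).2
    have h2 := (hZm hw).2
    have e1 : M.c0.onBody w * wderiv P.c0.onBody w = -(wderiv P.c0.onBody w * M.c0.onBody w) :=
      odd_anticomm hm0 (hder hw).1
    rw [e1, even_comm hm2] at h1
    constructor
    · have : wderiv Z.c0.onBody w = (2⁻¹ : ℂ) • ((Z.c12.onBody w + wderiv Z.c0.onBody w)
          + (-Z.c12.onBody w + wderiv Z.c0.onBody w)) := by module
      rw [this, h1, h2]
      module
    · have : Z.c12.onBody w = (2⁻¹ : ℂ) • ((Z.c12.onBody w + wderiv Z.c0.onBody w)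
          - (-Z.c12.onBody w + wderiv Z.c0.onBody w)) := by module
      rw [this, h1, h2]
      module
  have hev : ∀ {f : Coeff L}, f.IsAnalytic V → ∀ {x : SPoint L}, x ∈ H.Dom →
      f.eval x.z = taylor f.onBody x.z ∧ f.der.eval x.z = taylor (wderiv f.onBody) x.z ∧
        SuperAnalyticAt (body x.z) f.onBody := by
    intro f hf x hx
    have hx' : body x.z ∈ V := (hmem x).1 hx
    exact ⟨hf.eval_eq_taylor hV hx', hf.eval_der hV hx', hf.superAnalyticAt hV hx'⟩
  have hnear : ∀ {x : SPoint L}, x ∈ H.Dom → ∀ᶠ v in 𝓝 (body x.z), v ∈ V :=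
    fun hx => hV.mem_nhds ((hmem _).1 hx)
  refine ⟨Z.c0, P.c1, M.c2, P.c0, M.c0, hZ.h0, hP.h1, hM.h2, hP.h0, hM.h0, ?_, ?_, ?_, ?_, ?_⟩
  · intro x hx
    rw [(hev hZ.h0 hx).1, (hev hP.h1 hx).1, (hev hM.h2 hx).1, (hev hP.h0 hx).1,
      (hev hM.h0 hx).1]
    exact ⟨taylor_mem _ x.z_even (fun _ h _ h' => even_mul_mem h h') (hev hZ.h0 hx).2.2
        ((hnear hx).mono fun v hv => (hpar hv).1),
      taylor_mem _ x.z_even (fun _ h _ h' => even_mul_mem h h') (hev hP.h1 hx).2.2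
        ((hnear hx).mono fun v hv => (hpar hv).2.2.2.1),
      taylor_mem _ x.z_even (fun _ h _ h' => even_mul_mem h h') (hev hM.h2 hx).2.2
        ((hnear hx).mono fun v hv => (hpar hv).2.2.2.2),
      taylor_mem _ x.z_even (fun _ h _ h' => even_mul_odd_mem h h') (hev hP.h0 hx).2.2
        ((hnear hx).mono fun v hv => (hpar hv).2.1),
      taylor_mem _ x.z_even (fun _ h _ h' => even_mul_odd_mem h h') (hev hM.h0 hx).2.2
        ((hnear hx).mono fun v hv => (hpar hv).2.2.1)⟩
  · intro x y hy
    have hx : x ∈ H.Dom := (PFun.mem_dom _ _).2 ⟨y, hy⟩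
    have h1 : Z.c1.eval x.z = P.c1.eval x.z * M.c0.eval x.z := by
      rw [(hev hZ.h1 hx).1, (hev hP.h1 hx).1, (hev hM.h0 hx).1,
        ← taylor_mul x.z_even (hev hP.h1 hx).2.2 (hev hM.h0 hx).2.2]
      exact taylor_congr ((hnear hx).mono fun v hv => (hZp hv).1)
    have h2 : Z.c2.eval x.z = M.c2.eval x.z * P.c0.eval x.z := by
      rw [(hev hZ.h2 hx).1, (hev hM.h2 hx).1, (hev hP.h0 hx).1,
        ← taylor_mul x.z_even (hev hM.h2 hx).2.2 (hev hP.h0 hx).2.2]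
      exact taylor_congr ((hnear hx).mono fun v hv => (hZm hv).1)
    have h3 : Z.c12.eval x.z = P.c0.der.eval x.z * M.c0.eval x.z
        + P.c0.eval x.z * M.c0.der.eval x.z := by
      have a1 := (hev hP.h0 hx).2.2
      have a2 := (hev hM.h0 hx).2.2
      rw [(hev hZ.h12 hx).1, (hev hP.h0 hx).1, (hev hM.h0 hx).1, (hev hP.h0 hx).2.1,
        (hev hM.h0 hx).2.1, ← taylor_mul x.z_even a1.wderiv a2,
        ← taylor_mul x.z_even a1 a2.wderiv,
        ← taylor_add x.z_even (a1.wderiv.mul a2) (a1.mul a2.wderiv)]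
      exact taylor_congr ((hnear hx).mono fun v hv => (hcond hv).2)
    rw [(hval x y hy).1, SFun.eval, h1, h2, h3, ← mul_assoc, ← mul_assoc]
  · intro x y hy
    have hx : x ∈ H.Dom := (PFun.mem_dom _ _).2 ⟨y, hy⟩
    have h1 : P.c2.eval x.z = 0 := by
      rw [(hev hP.h2 hx).1, ← taylor_const (a := (0 : Gr L)) x.z_even]
      exact taylor_congr ((hnear hx).mono fun v hv => (hrelP hv).1)
    have h2 : P.c12.eval x.z = P.c0.der.eval x.z := by
      rw [(hev hP.h12 hx).1, (hev hP.h0 hx).2.1]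
      exact taylor_congr ((hnear hx).mono fun v hv => (hrelP hv).2)
    rw [(hval x y hy).2.1, SFun.eval, h1, h2, mul_zero, add_zero]
  · intro x y hy
    have hx : x ∈ H.Dom := (PFun.mem_dom _ _).2 ⟨y, hy⟩
    have h1 : M.c1.eval x.z = 0 := by
      rw [(hev hM.h1 hx).1, ← taylor_const (a := (0 : Gr L)) x.z_even]
      exact taylor_congr ((hnear hx).mono fun v hv => (hrelM hv).1)
    have h2 : M.c12.eval x.z = -M.c0.der.eval x.z := by
      have : (fun v => -wderiv M.c0.onBody v) = fun v => algebraMap ℂ (Gr L) (-1) *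
          wderiv M.c0.onBody v := by ext v; simp
      have h3 : M.c12.eval x.z = algebraMap ℂ (Gr L) (-1) * M.c0.der.eval x.z := by
        rw [(hev hM.h12 hx).1, (hev hM.h0 hx).2.1,
          ← taylor_const (a := algebraMap ℂ (Gr L) (-1)) x.z_even,
          ← taylor_mul x.z_even (.const (Subalgebra.algebraMap_mem _ _) _)
            (hev hM.h0 hx).2.2.wderiv]
        exact taylor_congr ((hnear hx).mono fun v hv => by simp [(hrelM hv).2])
      simpa using h3
    rw [(hval x y hy).2.2, SFun.eval, h1, h2, mul_zero, add_zero, mul_neg, sub_eq_add_neg]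
  · intro x hx
    have a1 := (hev hP.h0 hx).2.2
    have a2 := (hev hM.h0 hx).2.2
    have hneg : ∀ F : ℂ → Gr L, SuperAnalyticAt (body x.z) F →
        taylor (fun v => -F v) x.z = -taylor F x.z := fun F hF => by
      rw [eq_neg_iff_add_eq_zero, ← taylor_add x.z_even hF.neg hF]
      simpa using taylor_const (a := (0 : Gr L)) x.z_even
    rw [(hev hZ.h0 hx).2.1, (hev hP.h0 hx).1, (hev hM.h0 hx).1, (hev hP.h0 hx).2.1,
      (hev hM.h0 hx).2.1, (hev hP.h1 hx).1, (hev hM.h2 hx).1, ← taylor_mul x.z_even a1.wderiv a2,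
      ← taylor_mul x.z_even a1 a2.wderiv,
      ← taylor_mul x.z_even (hev hP.h1 hx).2.2 (hev hM.h2 hx).2.2, sub_eq_add_neg,
      ← hneg _ (a1.mul a2.wderiv), ← taylor_add x.z_even (a1.wderiv.mul a2) (a1.mul a2.wderiv).neg,
      ← taylor_add x.z_even (.add _ _ (a1.wderiv.mul a2) (a1.mul a2.wderiv).neg)
        ((hev hP.h1 hx).2.2.mul (hev hM.h2 hx).2.2)]
    refine taylor_congr ((hnear hx).mono fun v hv => ?_)
    rw [(hcond hv).1, sub_eq_add_neg]

/-! ### Integer powers -/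

theorem zpow_eq_of_sq_eq_zero {R : Type*} [Ring R] (u v : Rˣ) {δ : R} (hv : (v : R) = u + δ)
    (hc : Commute (u : R) δ) (hδ : δ * δ = 0) (k : ℤ) :
    ((v ^ k : Rˣ) : R) = ((u ^ k : Rˣ) : R) + k • (((u ^ (k - 1) : Rˣ) : R) * δ) := by
  set x : R := ((u⁻¹ : Rˣ) : R) * δ with hx
  have hcx : Commute ((u⁻¹ : Rˣ) : R) δ := hc.units_inv_left
  have hx2 : x * x = 0 := by
    rw [hx, mul_assoc, ← mul_assoc δ, ← hcx.eq, mul_assoc, hδ, mul_zero, mul_zero]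
  have hux : Commute (u : R) x := (Commute.refl (u : R)).units_inv_right.mul_right hc
  have key : ∀ (t : Rˣ) (y : R), (t : R) = 1 + y → y * y = 0 → ∀ m : ℕ,
      ((t ^ m : Rˣ) : R) = 1 + m • y := by
    intro t y ht hy m
    induction m with
    | zero => simp
    | succ m ih =>
      rw [pow_succ, Units.val_mul, ih, ht, add_mul, mul_add, mul_add, smul_mul_assoc,
        smul_mul_assoc, hy]
      simp only [smul_zero, one_mul, mul_one, add_smul, one_smul]
      abel
  let t : Rˣ := ⟨1 + x, 1 - x, by noncomm_ring; simp [hx2], by noncomm_ring; simp [hx2]⟩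
  have hvt : v = u * t := Units.ext <| by
    simp [t, hv, hx, mul_add]
  have htk : ((t ^ k : Rˣ) : R) = 1 + k • x := by
    obtain ⟨m, rfl | rfl⟩ := k.eq_nat_or_neg
    · simpa using key t x rfl hx2 m
    · have := key t⁻¹ (-x) (by simp [t, sub_eq_add_neg]) (by simpa using hx2) m
      rw [zpow_neg, ← inv_zpow, zpow_natCast, this]
      simp
  have hcomm : Commute u t := Units.ext <| by
    simpa [t, mul_add, add_mul] using hux.eq
  rw [hvt, hcomm.mul_zpow, Units.val_mul, htk, mul_add, mul_one, mul_smul_comm, hx, ← mul_assoc,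
    ← Units.val_mul, zpow_sub_one]

theorem ipow_add_of_sq_eq_zero {f δ : Gr L} (hf : f ∈ even L) (hu : IsUnit f) (hδ : δ ∈ even L)
    (hδ2 : δ * δ = 0) (k : ℤ) : ipow (f + δ) k = ipow f k + k • (ipow f (k - 1) * δ) := by
  obtain ⟨u, rfl⟩ := hu
  have h : IsUnit ((u : Gr L) + δ) := by
    refine isUnit_of_body_ne_zero (add_mem hf hδ) ?_
    have h1 : body δ = 0 := by
      have := congrArg body hδ2
      rwa [map_mul, map_zero, mul_self_eq_zero] at this
    rw [map_add, h1, add_zero]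
    exact body_ne_zero_of_isUnit u.isUnit
  obtain ⟨v, hv⟩ := h
  rw [← hv, ipow_unit, ipow_unit, ipow_unit]
  exact zpow_eq_of_sq_eq_zero u v hv (even_comm hf δ) hδ2 k

theorem ipow_algebraMap {u : ℂ} (hu : u ≠ 0) (k : ℤ) :
    ipow (algebraMap ℂ (Gr L) u) k = algebraMap ℂ (Gr L) (u ^ k) := by
  have h := ipow_unit (Units.map (algebraMap ℂ (Gr L)).toMonoidHom (Units.mk0 u hu)) k
  rw [← map_zpow] at h
  refine h.trans ?_
  change algebraMap ℂ (Gr L) ((Units.mk0 u hu ^ k : ℂˣ) : ℂ) = _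
  rw [Units.val_zpow_eq_zpow_val, Units.val_mk0]

theorem ipow_mul_ipow {x : Gr L} (hx : IsUnit x) (j k : ℤ) :
    ipow x j * ipow x k = ipow x (j + k) := by
  obtain ⟨u, rfl⟩ := hx
  rw [ipow_unit, ipow_unit, ipow_unit, zpow_add, Units.val_mul]

theorem ipow_zero (x : Gr L) : ipow x 0 = 1 := by simp [ipow]

theorem ipow_one (x : Gr L) : ipow x 1 = x := by simp [ipow]

theorem ipow_natCast (x : Gr L) (k : ℕ) : ipow x k = x ^ k := by simp [ipow]

theorem isUnit_ipow {x : Gr L} (hx : IsUnit x) (k : ℤ) : IsUnit (ipow x k) := by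
  obtain ⟨u, rfl⟩ := hx
  rw [ipow_unit]
  exact Units.isUnit _

theorem ipow_mem_lowEven {x : Gr L} (hx : x ∈ lowEven L) (k : ℤ) : ipow x k ∈ lowEven L :=
  ⟨ipow_mem_even hx.1 k, Subalgebra.mul_mem (lowAlg L) (Subalgebra.pow_mem (lowAlg L) hx.2 _)
    (Subalgebra.pow_mem (lowAlg L) (inverse_mem_lowEven hx).2 _)⟩

theorem odd_add_mul_ipow {f g ψ ψ' θ : Gr L} (hf : f ∈ even L) (hu : IsUnit f) (hg : g ∈ even L)
    (hψ : ψ ∈ odd L) (hψ' : ψ' ∈ odd L) (hθ : θ ∈ odd L) (k : ℤ) :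
    (ψ + θ * g) * ipow (f + θ * g * ψ') k
      = ψ * ipow f k + θ * (g * ipow f (k - 1) * (f - k • (ψ * ψ'))) := by
  have hδ : θ * g * ψ' ∈ even L := odd_mul_odd_mem (odd_mul_even_mem hθ hg) hψ'
  have hδ2 : θ * g * ψ' * (θ * g * ψ') = 0 := by
    have : θ * (g * ψ') * θ = 0 := odd_mul_mul_self hθ _
    rw [← mul_assoc, ← mul_assoc, mul_assoc θ, this]
    simp
  rw [ipow_add_of_sq_eq_zero hf hu hδ hδ2]
  have hF := even_comm (ipow_mem_even hf (k - 1))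
  have e1 : ipow f k = ipow f (k - 1) * f := by
    conv_lhs => rw [← sub_add_cancel k 1, ← ipow_mul_ipow hu, ipow_one]
  have e2 : θ * g * (ipow f (k - 1) * (θ * g * ψ')) = 0 := by
    have : θ * (g * ipow f (k - 1)) * θ = 0 := odd_mul_mul_self hθ _
    calc _ = θ * (g * ipow f (k - 1)) * θ * (g * ψ') := by simp only [mul_assoc]
      _ = 0 := by rw [this, zero_mul]
  have e3 : ψ * (ipow f (k - 1) * (θ * g * ψ')) = -(θ * (g * ipow f (k - 1) * (ψ * ψ'))) := by
    simp only [← mul_assoc]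
    rw [← hF ψ, mul_assoc _ ψ θ, odd_anticomm hψ hθ, mul_neg, neg_mul, neg_mul, ← mul_assoc, hF θ,
      mul_assoc _ ψ g, ← even_comm hg ψ, ← mul_assoc, mul_assoc θ _ g, hF g, ← mul_assoc]
  rw [add_mul, mul_add, mul_add, mul_smul_comm, mul_smul_comm, e2, e3, mul_sub, mul_sub, e1]
  simp only [mul_smul_comm, smul_neg, smul_zero, add_zero, mul_assoc]
  abel

/-! ### Expressions of maps of the sphere over the body -/

/-- The components over the body of a superconformal map of superspace. -/
structure BodyMap (L : ℕ∞) where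
  dom : Set ℂ
  f : ℂ → Gr L
  gp : ℂ → Gr L
  gm : ℂ → Gr L
  ψp : ℂ → Gr L
  ψm : ℂ → Gr L
  isOpen : IsOpen dom
  f_an : ∀ w ∈ dom, SuperAnalyticAt w f
  gp_an : ∀ w ∈ dom, SuperAnalyticAt w gp
  gm_an : ∀ w ∈ dom, SuperAnalyticAt w gm
  ψp_an : ∀ w ∈ dom, SuperAnalyticAt w ψp
  ψm_an : ∀ w ∈ dom, SuperAnalyticAt w ψm
  f_even : ∀ w ∈ dom, f w ∈ even L
  gp_even : ∀ w ∈ dom, gp w ∈ even L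
  gm_even : ∀ w ∈ dom, gm w ∈ even L
  ψp_odd : ∀ w ∈ dom, ψp w ∈ odd L
  ψm_odd : ∀ w ∈ dom, ψm w ∈ odd L
  cond : ∀ w ∈ dom, wderiv f w = wderiv ψp w * ψm w - ψp w * wderiv ψm w + gp w * gm w

/-- `B` describes the partial map `H` of superspace. -/
structure BodyMap.Represents (B : BodyMap L) (H : SPoint L →. SPoint L) : Prop where
  mem_dom : ∀ x, x ∈ H.Dom ↔ x.base ∈ B.dom
  z_eq : ∀ w ∈ B.dom, ∀ (θ θ' : odd L), ∀ y ∈ H (bodyPoint w θ θ'),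
    y.z = B.f w + θ * (B.gp w * B.ψm w) + θ' * (B.gm w * B.ψp w)
      + θ * θ' * (wderiv B.ψp w * B.ψm w + B.ψp w * wderiv B.ψm w)
  θp_eq : ∀ w ∈ B.dom, ∀ (θ θ' : odd L), ∀ y ∈ H (bodyPoint w θ θ'),
    y.θp = B.ψp w + θ * B.gp w + θ' * 0 + θ * θ' * wderiv B.ψp w
  θm_eq : ∀ w ∈ B.dom, ∀ (θ θ' : odd L), ∀ y ∈ H (bodyPoint w θ θ'),
    y.θm = B.ψm w + θ * 0 + θ' * B.gm w + θ * θ' * -wderiv B.ψm w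

namespace IsComponents

variable {H : SPoint L →. SPoint L} {f gp gm ψp ψm : Coeff L}

/-- The restriction of the component functions to the body. -/
noncomputable def bodyMap (hH : IsComponents H f gp gm ψp ψm) (ho : IsOpen H.Dom) : BodyMap L where
  dom := SPoint.base '' H.Dom
  f := f.onBody
  gp := gp.onBody
  gm := gm.onBody
  ψp := ψp.onBody
  ψm := ψm.onBody
  isOpen := (image_base_dom ho).1
  f_an w hw := hH.f_analytic.superAnalyticAt (image_base_dom ho).1 hw
  gp_an w hw := hH.gp_analytic.superAnalyticAt (image_base_dom ho).1 hw
  gm_an w hw := hH.gm_analytic.superAnalyticAt (image_base_dom ho).1 hw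
  ψp_an w hw := hH.ψp_analytic.superAnalyticAt (image_base_dom ho).1 hw
  ψm_an w hw := hH.ψm_analytic.superAnalyticAt (image_base_dom ho).1 hw
  f_even w hw := by
    have := (hH.parity (bodyPoint w 0 0) (by rw [(image_base_dom ho).2]; simpa using hw)).1
    rwa [bodyPoint, hH.f_analytic.eval_algebraMap (image_base_dom ho).1 hw] at this
  gp_even w hw := by
    have := (hH.parity (bodyPoint w 0 0) (by rw [(image_base_dom ho).2]; simpa using hw)).2.1
    rwa [bodyPoint, hH.gp_analytic.eval_algebraMap (image_base_dom ho).1 hw] at this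
  gm_even w hw := by
    have := (hH.parity (bodyPoint w 0 0) (by rw [(image_base_dom ho).2]; simpa using hw)).2.2.1
    rwa [bodyPoint, hH.gm_analytic.eval_algebraMap (image_base_dom ho).1 hw] at this
  ψp_odd w hw := by
    have := (hH.parity (bodyPoint w 0 0) (by rw [(image_base_dom ho).2]; simpa using hw)).2.2.2.1
    rwa [bodyPoint, hH.ψp_analytic.eval_algebraMap (image_base_dom ho).1 hw] at this
  ψm_odd w hw := by
    have := (hH.parity (bodyPoint w 0 0) (by rw [(image_base_dom ho).2]; simpa using hw)).2.2.2.2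
    rwa [bodyPoint, hH.ψm_analytic.eval_algebraMap (image_base_dom ho).1 hw] at this
  cond w hw := by
    have hV := (image_base_dom ho).1
    have := hH.cond (bodyPoint w 0 0) (by rw [(image_base_dom ho).2]; simpa using hw)
    simp only [bodyPoint, (hH.f_analytic.der hV).eval_algebraMap hV hw,
      (hH.ψp_analytic.der hV).eval_algebraMap hV hw, (hH.ψm_analytic.der hV).eval_algebraMap hV hw,
      hH.gp_analytic.eval_algebraMap hV hw, hH.gm_analytic.eval_algebraMap hV hw,
      hH.ψp_analytic.eval_algebraMap hV hw, hH.ψm_analytic.eval_algebraMap hV hw,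
      hH.f_analytic.onBody_der hV hw, hH.ψp_analytic.onBody_der hV hw,
      hH.ψm_analytic.onBody_der hV hw] at this
    exact this

theorem represents (hH : IsComponents H f gp gm ψp ψm) (ho : IsOpen H.Dom) :
    (hH.bodyMap ho).Represents H := by
  have hV := (image_base_dom ho).1
  refine ⟨(image_base_dom ho).2, ?_, ?_, ?_⟩
  · intro w hw θ θ' y hy
    have := hH.z_eq _ y hy
    simp only [bodyPoint, (hH.ψp_analytic.der hV).eval_algebraMap hV hw,
      (hH.ψm_analytic.der hV).eval_algebraMap hV hw, hH.f_analytic.eval_algebraMap hV hw,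
      hH.gp_analytic.eval_algebraMap hV hw, hH.gm_analytic.eval_algebraMap hV hw,
      hH.ψp_analytic.eval_algebraMap hV hw, hH.ψm_analytic.eval_algebraMap hV hw,
      hH.ψp_analytic.onBody_der hV hw, hH.ψm_analytic.onBody_der hV hw] at this
    simp only [← mul_assoc] at this ⊢
    exact this
  · intro w hw θ θ' y hy
    have := hH.θp_eq _ y hy
    simp only [bodyPoint, (hH.ψp_analytic.der hV).eval_algebraMap hV hw,
      hH.gp_analytic.eval_algebraMap hV hw, hH.ψp_analytic.eval_algebraMap hV hw,
      hH.ψp_analytic.onBody_der hV hw] at this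
    rw [mul_zero, add_zero]
    exact this
  · intro w hw θ θ' y hy
    have := hH.θm_eq _ y hy
    simp only [bodyPoint, (hH.ψm_analytic.der hV).eval_algebraMap hV hw,
      hH.gm_analytic.eval_algebraMap hV hw, hH.ψm_analytic.eval_algebraMap hV hw,
      hH.ψm_analytic.onBody_der hV hw] at this
    rw [mul_zero, add_zero, mul_neg, ← sub_eq_add_neg]
    exact this

end IsComponents

namespace BodyMap

variable {B : BodyMap L} {H : SPoint L →. SPoint L} {w : ℂ}

theorem eventually_mem_dom (hw : w ∈ B.dom) : ∀ᶠ v in 𝓝 w, v ∈ B.dom := B.isOpen.mem_nhds hw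

theorem Represents.exists_mem (hB : B.Represents H) (hw : w ∈ B.dom) (θ θ' : odd L) :
    ∃ y, y ∈ H (bodyPoint w θ θ') :=
  (PFun.mem_dom _ _).1 ((hB.mem_dom _).2 (by simpa using hw))

theorem Represents.mem_dom_of_mem (hB : B.Represents H) {θ θ' : odd L} {y : SPoint L}
    (hy : y ∈ H (bodyPoint w θ θ')) : w ∈ B.dom := by
  simpa using (hB.mem_dom _).1 ((PFun.mem_dom _ _).2 ⟨y, hy⟩)

/-- Two representations with the same values over a body point have the same components there. -/
theorem Represents.components_eq (hL : 1 < L) (hB : B.Represents H) {B' : BodyMap L}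
    {H' : SPoint L →. SPoint L} (hB' : B'.Represents H') {w' : ℂ} (hw : w ∈ B.dom)
    (hw' : w' ∈ B'.dom) (hH : ∀ θ θ' : odd L, H (bodyPoint w θ θ') = H' (bodyPoint w' θ θ')) :
    B.f w = B'.f w' ∧ B.gp w = B'.gp w' ∧ B.gm w = B'.gm w' ∧ B.ψp w = B'.ψp w' ∧
      B.ψm w = B'.ψm w' := by
  have hf : B.f w = B'.f w' := by
    obtain ⟨y, hy⟩ := hB.exists_mem hw 0 0
    have h1 := hB.z_eq w hw 0 0 y hy
    have h2 := hB'.z_eq w' hw' 0 0 y (hH 0 0 ▸ hy)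
    simpa using h1.symm.trans h2
  have hp := coeff_eq_of_forall_odd hL (B.gp_an w hw).mem_lowAlg (B'.gp_an w' hw').mem_lowAlg
    (zero_mem _) (zero_mem _) (B.ψp_an w hw).wderiv.mem_lowAlg (B'.ψp_an w' hw').wderiv.mem_lowAlg
    fun θ θ' => by
      obtain ⟨y, hy⟩ := hB.exists_mem hw θ θ'
      exact (hB.θp_eq w hw θ θ' y hy).symm.trans (hB'.θp_eq w' hw' θ θ' y (hH θ θ' ▸ hy))
  have hm := coeff_eq_of_forall_odd hL (zero_mem _) (zero_mem _)
    (B.gm_an w hw).mem_lowAlg (B'.gm_an w' hw').mem_lowAlg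
    (neg_mem (B.ψm_an w hw).wderiv.mem_lowAlg) (neg_mem (B'.ψm_an w' hw').wderiv.mem_lowAlg)
    fun θ θ' => by
      obtain ⟨y, hy⟩ := hB.exists_mem hw θ θ'
      exact (hB.θm_eq w hw θ θ' y hy).symm.trans (hB'.θm_eq w' hw' θ θ' y (hH θ θ' ▸ hy))
  exact ⟨hf, hp.2.1, hm.2.2.1, hp.1, hm.1⟩

end BodyMap

namespace Sphere

variable {n : ℤ}

theorem mem_southChart_or (Q : Sphere L n) : (∃ y, y ∈ chart .south Q) ∨ ∃ y, y ∈ chart .north Q := by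
  induction Q using Quot.ind with
  | mk s =>
    cases s with
    | inl x => exact Or.inl ⟨x, Part.mem_some x⟩
    | inr x => exact Or.inr ⟨x, Part.mem_some x⟩

open Classical in
theorem south_mem_of_north {Q : Sphere L n} {y : SPoint L} (hy : y ∈ chart .north Q)
    (hu : IsUnit y.z) : transition Complex.I n y ∈ chart .south Q := by
  rw [← point_of_mem_chart _ _ _ hy]
  change _ ∈ (if IsUnit y.z then Part.some (transition Complex.I n y) else Part.none)
  rw [if_pos hu]
  exact Part.mem_some _

open Classical in
theorem north_mem_of_south {Q : Sphere L n} {y : SPoint L} (hy : y ∈ chart .south Q)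
    (hu : IsUnit y.z) : transition (-Complex.I) n y ∈ chart .north Q := by
  rw [← point_of_mem_chart _ _ _ hy]
  change _ ∈ (if IsUnit y.z then Part.some (transition (-Complex.I) n y) else Part.none)
  rw [if_pos hu]
  exact Part.mem_some _

open Classical in
theorem isUnit_of_mem_both {Q : Sphere L n} {y y' : SPoint L} (hy : y ∈ chart .south Q)
    (hy' : y' ∈ chart .north Q) : IsUnit y'.z ∧ y = transition Complex.I n y' := by
  have h : y ∈ chart .south (point .north y' : Sphere L n) := by
    rwa [point_of_mem_chart _ _ _ hy']
  change y ∈ (if IsUnit y'.z then Part.some (transition Complex.I n y') else Part.none) at h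
  split_ifs at h with hu
  · exact ⟨hu, Part.mem_some_iff.1 h⟩
  · exact absurd h (Part.notMem_none _)

theorem point_north_eq {y : SPoint L} (hu : IsUnit y.z) :
    (point .north y : Sphere L n) = point .south (transition Complex.I n y) :=
  Quot.sound (Glue.glue y hu)

theorem eq_of_mem_chart {β : Pole} {Q Q' : Sphere L n} {y : SPoint L} (h : y ∈ chart β Q)
    (h' : y ∈ chart β Q') : Q = Q' := by
  rw [← point_of_mem_chart _ _ _ h, ← point_of_mem_chart _ _ _ h']

theorem point_injective (α : Pole) : Function.Injective (point α : SPoint L → Sphere L n) := by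
  intro x y h
  have := congrArg (chart α) h
  rwa [chart_point, chart_point, Part.some_inj] at this

end Sphere

/-- The expressions over the body, in all pairs of charts, of an injective superconformal map of
the sphere, with their compatibilities. -/
structure SphereMap (L : ℕ∞) (n : ℤ) where
  B : Pole → Pole → BodyMap L
  cover : ∀ α w, w ∈ (B α .south).dom ∨ w ∈ (B α .north).dom
  isUnit_gp : ∀ α β, ∀ w ∈ (B α β).dom, IsUnit ((B α β).gp w)
  isUnit_gm : ∀ α β, ∀ w ∈ (B α β).dom, IsUnit ((B α β).gm w)
  isUnit_f : ∀ α, ∀ w ∈ (B α .south).dom, w ∈ (B α .north).dom → IsUnit ((B α .north).f w)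
  f_rel : ∀ α, ∀ w ∈ (B α .south).dom, w ∈ (B α .north).dom →
    (B α .south).f w = Ring.inverse ((B α .north).f w)
  mem_south : ∀ α, ∀ w ∈ (B α .north).dom, IsUnit ((B α .north).f w) → w ∈ (B α .south).dom
  mem_north : ∀ α, ∀ w ∈ (B α .south).dom, IsUnit ((B α .south).f w) → w ∈ (B α .north).dom
  ψp_rel : ∀ α, ∀ w ∈ (B α .south).dom, w ∈ (B α .north).dom → (B α .south).ψp w
    = Complex.I • ((B α .north).ψp w * ipow ((B α .north).f w) (n - 1))
  ψm_rel : ∀ α, ∀ w ∈ (B α .south).dom, w ∈ (B α .north).dom → (B α .south).ψm w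
    = Complex.I • ((B α .north).ψm w * ipow ((B α .north).f w) (-n - 1))
  gp_rel : ∀ α, ∀ w ∈ (B α .south).dom, w ∈ (B α .north).dom → (B α .south).gp w
    = Complex.I • ((B α .north).gp w * ipow ((B α .north).f w) (n - 1 - 1)
      * ((B α .north).f w - (n - 1) • ((B α .north).ψp w * (B α .north).ψm w)))
  gm_rel : ∀ α, ∀ w ∈ (B α .south).dom, w ∈ (B α .north).dom → (B α .south).gm w
    = Complex.I • ((B α .north).gm w * ipow ((B α .north).f w) (-n - 1 - 1)
      * ((B α .north).f w - (-n - 1) • ((B α .north).ψm w * (B α .north).ψp w)))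
  dom_inv : ∀ β u, u ≠ 0 → (u ∈ (B .north β).dom ↔ u⁻¹ ∈ (B .south β).dom)
  f_inv : ∀ β u, u ≠ 0 → u ∈ (B .north β).dom → (B .north β).f u = (B .south β).f u⁻¹
  ψp_inv : ∀ β u, u ≠ 0 → u ∈ (B .north β).dom → (B .north β).ψp u = (B .south β).ψp u⁻¹
  ψm_inv : ∀ β u, u ≠ 0 → u ∈ (B .north β).dom → (B .north β).ψm u = (B .south β).ψm u⁻¹
  gp_inv : ∀ β u, u ≠ 0 → u ∈ (B .north β).dom →
    (B .north β).gp u = (Complex.I * u ^ (n - 1)) • (B .south β).gp u⁻¹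
  gm_inv : ∀ β u, u ≠ 0 → u ∈ (B .north β).dom →
    (B .north β).gm u = (Complex.I * u ^ (-n - 1)) • (B .south β).gm u⁻¹

theorem exists_odd_mul_eq_zero (hL : 1 < L) {g : Gr L} (hg : g ∈ lowEven L) (hu : ¬ IsUnit g) :
    ∃ θ ∈ odd L, θ ≠ 0 ∧ θ * g = 0 := by
  classical
  have hb : body g = 0 := by
    by_contra h
    exact hu (isUnit_of_body_ne_zero hg.1 h)
  have hn : ∃ m, g ^ m = 0 := isNilpotent_of_body_eq_zero hg.1 hb
  have h0 : Nat.find hn ≠ 0 := fun h => by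
    have := Nat.find_spec hn
    rw [h, pow_zero] at this
    exact one_ne_zero this
  obtain ⟨k, hk⟩ := Nat.exists_eq_succ_of_ne_zero h0
  have h1 : g ^ k ≠ 0 := Nat.find_min hn (by omega)
  have h2 : g ^ (k + 1) = 0 := by
    have := Nat.find_spec hn
    rwa [hk] at this
  have h3 : ∃ θ ∈ odd L, θ * g ^ k ≠ 0 := by
    by_contra! h
    exact h1 (eq_zero_of_odd_mul hL (Subalgebra.pow_mem (lowAlg L) hg.2 k) h)
  obtain ⟨θ, hθ, hne⟩ := h3
  exact ⟨θ * g ^ k, odd_mul_even_mem hθ (even_pow_mem hg.1 k), hne, by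
    rw [mul_assoc, ← pow_succ, h2, mul_zero]⟩

namespace Sphere

variable {n : ℤ} {T : Sphere L n → Sphere L n} {B : Pole → Pole → BodyMap L}

theorem transition_bodyPoint (s : ℂ) {u : ℂ} (hu : u ≠ 0) (θ θ' : odd L) :
    transition s n (bodyPoint u θ θ') =
      bodyPoint u⁻¹ ((s * u ^ (n - 1)) • θ) ((s * u ^ (-n - 1)) • θ') := by
  have key : ∀ (θ : odd L) (k : ℤ), s • ((θ : Gr L) * ipow (algebraMap ℂ (Gr L) u) k)
      = (((s * u ^ k) • θ : odd L) : Gr L) := by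
    intro θ k
    rw [ipow_algebraMap hu, ← Algebra.commutes, ← Algebra.smul_def, smul_smul,
      Submodule.coe_smul]
  ext1
  · change Ring.inverse (algebraMap ℂ (Gr L) u) = algebraMap ℂ (Gr L) u⁻¹
    have h := Ring.inverse_unit (Units.map (algebraMap ℂ (Gr L)).toMonoidHom (Units.mk0 u hu))
    refine h.trans ?_
    rw [← map_inv]
    simp
  · exact key θ _
  · exact key θ' _

theorem expr_north_bodyPoint (β : Pole) {u : ℂ} (hu : u ≠ 0) (θ θ' : odd L) :
    expr T .north β (bodyPoint u θ θ') = expr T .south β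
      (bodyPoint u⁻¹ ((Complex.I * u ^ (n - 1)) • θ) ((Complex.I * u ^ (-n - 1)) • θ')) := by
  have h : IsUnit (bodyPoint u θ θ').z := (IsUnit.mk0 u hu).map (algebraMap ℂ (Gr L))
  rw [expr, expr, point_north_eq h, transition_bodyPoint _ hu]

variable (hB : ∀ α β, (B α β).Represents (expr T α β))
include hB

theorem isUnit_g_of_injective (hL : 1 < L) (hT : Function.Injective T) (α β : Pole) {w : ℂ}
    (hw : w ∈ (B α β).dom) : IsUnit ((B α β).gp w) ∧ IsUnit ((B α β).gm w) := by
  obtain ⟨y₀, hy₀⟩ := (hB α β).exists_mem hw 0 0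
  have z₀ := (hB α β).z_eq w hw 0 0 y₀ hy₀
  have p₀ := (hB α β).θp_eq w hw 0 0 y₀ hy₀
  have m₀ := (hB α β).θm_eq w hw 0 0 y₀ hy₀
  simp only [ZeroMemClass.coe_zero, zero_mul, add_zero] at z₀ p₀ m₀
  constructor
  · by_contra hu
    obtain ⟨θ, hθ, hne, h0⟩ := exists_odd_mul_eq_zero hL
      ⟨(B α β).gp_even w hw, ((B α β).gp_an w hw).mem_lowAlg⟩ hu
    obtain ⟨y, hy⟩ := (hB α β).exists_mem hw ⟨θ, hθ⟩ 0
    have z₁ := (hB α β).z_eq w hw _ _ y hy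
    have p₁ := (hB α β).θp_eq w hw _ _ y hy
    have m₁ := (hB α β).θm_eq w hw _ _ y hy
    simp only [ZeroMemClass.coe_zero, zero_mul, mul_zero, add_zero, ← mul_assoc, h0] at z₁ p₁ m₁
    have hyy : y = y₀ := SPoint.ext (z₁.trans z₀.symm) (p₁.trans p₀.symm) (m₁.trans m₀.symm)
    have := point_injective α (hT (eq_of_mem_chart hy (hyy ▸ hy₀)))
    exact hne (congrArg SPoint.θp this)
  · by_contra hu
    obtain ⟨θ, hθ, hne, h0⟩ := exists_odd_mul_eq_zero hL
      ⟨(B α β).gm_even w hw, ((B α β).gm_an w hw).mem_lowAlg⟩ hu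
    obtain ⟨y, hy⟩ := (hB α β).exists_mem hw 0 ⟨θ, hθ⟩
    have z₁ := (hB α β).z_eq w hw _ _ y hy
    have p₁ := (hB α β).θp_eq w hw _ _ y hy
    have m₁ := (hB α β).θm_eq w hw _ _ y hy
    simp only [ZeroMemClass.coe_zero, zero_mul, mul_zero, add_zero, ← mul_assoc, h0] at z₁ p₁ m₁
    have hyy : y = y₀ := SPoint.ext (z₁.trans z₀.symm) (p₁.trans p₀.symm) (m₁.trans m₀.symm)
    have := point_injective α (hT (eq_of_mem_chart hy (hyy ▸ hy₀)))
    exact hne (congrArg SPoint.θm this)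

theorem target_rel (hL : 1 < L) (α : Pole) {w : ℂ} (hS : w ∈ (B α .south).dom)
    (hN : w ∈ (B α .north).dom) :
    IsUnit ((B α .north).f w) ∧ (B α .south).f w = Ring.inverse ((B α .north).f w) ∧
    (B α .south).ψp w = Complex.I • ((B α .north).ψp w * ipow ((B α .north).f w) (n - 1)) ∧
    (B α .south).ψm w = Complex.I • ((B α .north).ψm w * ipow ((B α .north).f w) (-n - 1)) ∧
    (B α .south).gp w = Complex.I • ((B α .north).gp w * ipow ((B α .north).f w) (n - 1 - 1)
      * ((B α .north).f w - (n - 1) • ((B α .north).ψp w * (B α .north).ψm w))) ∧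
    (B α .south).gm w = Complex.I • ((B α .north).gm w * ipow ((B α .north).f w) (-n - 1 - 1)
      * ((B α .north).f w - (-n - 1) • ((B α .north).ψm w * (B α .north).ψp w))) := by
  have key : ∀ θ θ' : odd L, ∃ y ∈ expr T α .south (bodyPoint w θ θ'),
      ∃ y' ∈ expr T α .north (bodyPoint w θ θ'), IsUnit y'.z ∧ y = transition Complex.I n y' := by
    intro θ θ'
    obtain ⟨y, hy⟩ := (hB α .south).exists_mem hS θ θ'
    obtain ⟨y', hy'⟩ := (hB α .north).exists_mem hN θ θ'
    exact ⟨y, hy, y', hy', isUnit_of_mem_both hy hy'⟩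
  have h0 : IsUnit ((B α .north).f w) ∧ (B α .south).f w = Ring.inverse ((B α .north).f w) ∧
      (B α .south).ψp w = Complex.I • ((B α .north).ψp w * ipow ((B α .north).f w) (n - 1)) ∧
      (B α .south).ψm w = Complex.I • ((B α .north).ψm w * ipow ((B α .north).f w) (-n - 1)) := by
    obtain ⟨y, hy, y', hy', hu, rfl⟩ := key 0 0
    have z₁ := (hB α .south).z_eq w hS _ _ _ hy
    have p₁ := (hB α .south).θp_eq w hS _ _ _ hy
    have m₁ := (hB α .south).θm_eq w hS _ _ _ hy
    have z₂ := (hB α .north).z_eq w hN _ _ _ hy'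
    have p₂ := (hB α .north).θp_eq w hN _ _ _ hy'
    have m₂ := (hB α .north).θm_eq w hN _ _ _ hy'
    simp only [ZeroMemClass.coe_zero, zero_mul, add_zero, transition] at z₁ p₁ m₁ z₂ p₂ m₂
    rw [z₂] at z₁ p₁ m₁ hu
    rw [p₂] at p₁
    rw [m₂] at m₁
    exact ⟨hu, z₁.symm, p₁.symm, m₁.symm⟩
  obtain ⟨hu, hf, hp, hm⟩ := h0
  have hfl : (B α .north).f w ∈ lowEven L :=
    ⟨(B α .north).f_even w hN, ((B α .north).f_an w hN).mem_lowAlg⟩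
  have hψ := ((B α .north).ψp_an w hN).mem_lowAlg
  have hψ' := ((B α .north).ψm_an w hN).mem_lowAlg
  refine ⟨hu, hf, hp, hm, ?_, ?_⟩
  · refine eq_of_odd_mul hL ((B α .south).gp_an w hS).mem_lowAlg
      (Subalgebra.smul_mem _ (mul_mem (mul_mem ((B α .north).gp_an w hN).mem_lowAlg
        (ipow_mem_lowEven hfl _).2) (sub_mem hfl.2 (zsmul_mem (mul_mem hψ hψ') _))) _)
      fun θ hθ => ?_
    obtain ⟨y, hy, y', hy', hu, rfl⟩ := key ⟨θ, hθ⟩ 0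
    have p₁ := (hB α .south).θp_eq w hS _ _ _ hy
    have z₂ := (hB α .north).z_eq w hN _ _ _ hy'
    have p₂ := (hB α .north).θp_eq w hN _ _ _ hy'
    simp only [ZeroMemClass.coe_zero, zero_mul, mul_zero, add_zero, transition, ← mul_assoc]
      at p₁ z₂ p₂
    rw [z₂, p₂, odd_add_mul_ipow hfl.1 ‹_› ((B α .north).gp_even w hN) ((B α .north).ψp_odd w hN)
      ((B α .north).ψm_odd w hN) hθ, smul_add, hp, add_right_inj] at p₁
    rw [← p₁, mul_smul_comm]
  · refine eq_of_odd_mul hL ((B α .south).gm_an w hS).mem_lowAlg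
      (Subalgebra.smul_mem _ (mul_mem (mul_mem ((B α .north).gm_an w hN).mem_lowAlg
        (ipow_mem_lowEven hfl _).2) (sub_mem hfl.2 (zsmul_mem (mul_mem hψ' hψ) _))) _)
      fun θ hθ => ?_
    obtain ⟨y, hy, y', hy', hu, rfl⟩ := key 0 ⟨θ, hθ⟩
    have p₁ := (hB α .south).θm_eq w hS _ _ _ hy
    have z₂ := (hB α .north).z_eq w hN _ _ _ hy'
    have p₂ := (hB α .north).θm_eq w hN _ _ _ hy'
    simp only [ZeroMemClass.coe_zero, zero_mul, mul_zero, add_zero, transition, ← mul_assoc]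
      at p₁ z₂ p₂
    rw [z₂, p₂, odd_add_mul_ipow hfl.1 ‹_› ((B α .north).gm_even w hN) ((B α .north).ψm_odd w hN)
      ((B α .north).ψp_odd w hN) hθ, smul_add, hm, add_right_inj] at p₁
    rw [← p₁, mul_smul_comm]

theorem mem_dom_inv (β : Pole) {u : ℂ} (hu : u ≠ 0) :
    u ∈ (B .north β).dom ↔ u⁻¹ ∈ (B .south β).dom := by
  have h1 := (hB .north β).mem_dom (bodyPoint u 0 0)
  have h2 := (hB .south β).mem_dom (bodyPoint u⁻¹ 0 0)
  rw [base_bodyPoint] at h1 h2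
  rw [← h1, ← h2, PFun.mem_dom, PFun.mem_dom, expr_north_bodyPoint β hu, smul_zero, smul_zero]

theorem source_rel (hL : 1 < L) (β : Pole) {u : ℂ} (hu : u ≠ 0) (h : u ∈ (B .north β).dom) :
    (B .north β).f u = (B .south β).f u⁻¹ ∧ (B .north β).ψp u = (B .south β).ψp u⁻¹ ∧
    (B .north β).ψm u = (B .south β).ψm u⁻¹ ∧
    (B .north β).gp u = (Complex.I * u ^ (n - 1)) • (B .south β).gp u⁻¹ ∧
    (B .north β).gm u = (Complex.I * u ^ (-n - 1)) • (B .south β).gm u⁻¹ := by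
  have h' := (mem_dom_inv hB β hu).1 h
  have h0 : (B .north β).f u = (B .south β).f u⁻¹ ∧ (B .north β).ψp u = (B .south β).ψp u⁻¹ ∧
      (B .north β).ψm u = (B .south β).ψm u⁻¹ := by
    obtain ⟨y, hy⟩ := (hB .north β).exists_mem h 0 0
    have z₁ := (hB .north β).z_eq u h _ _ _ hy
    have p₁ := (hB .north β).θp_eq u h _ _ _ hy
    have m₁ := (hB .north β).θm_eq u h _ _ _ hy
    rw [expr_north_bodyPoint β hu, smul_zero, smul_zero] at hy
    have z₂ := (hB .south β).z_eq _ h' _ _ _ hy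
    have p₂ := (hB .south β).θp_eq _ h' _ _ _ hy
    have m₂ := (hB .south β).θm_eq _ h' _ _ _ hy
    simp only [ZeroMemClass.coe_zero, zero_mul, add_zero] at z₁ p₁ m₁ z₂ p₂ m₂
    exact ⟨z₁.symm.trans z₂, p₁.symm.trans p₂, m₁.symm.trans m₂⟩
  obtain ⟨hf, hp, hm⟩ := h0
  refine ⟨hf, hp, hm, ?_, ?_⟩
  · refine eq_of_odd_mul hL ((B .north β).gp_an u h).mem_lowAlg
      (Subalgebra.smul_mem _ ((B .south β).gp_an _ h').mem_lowAlg _) fun θ hθ => ?_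
    obtain ⟨y, hy⟩ := (hB .north β).exists_mem h ⟨θ, hθ⟩ 0
    have p₁ := (hB .north β).θp_eq u h _ _ _ hy
    rw [expr_north_bodyPoint β hu, smul_zero] at hy
    have p₂ := (hB .south β).θp_eq _ h' _ _ _ hy
    simp only [ZeroMemClass.coe_zero, zero_mul, mul_zero, add_zero, Submodule.coe_smul] at p₁ p₂
    rw [p₁, hp, add_right_inj] at p₂
    rw [p₂, smul_mul_assoc, mul_smul_comm]
  · refine eq_of_odd_mul hL ((B .north β).gm_an u h).mem_lowAlg
      (Subalgebra.smul_mem _ ((B .south β).gm_an _ h').mem_lowAlg _) fun θ hθ => ?_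
    obtain ⟨y, hy⟩ := (hB .north β).exists_mem h 0 ⟨θ, hθ⟩
    have p₁ := (hB .north β).θm_eq u h _ _ _ hy
    rw [expr_north_bodyPoint β hu, smul_zero] at hy
    have p₂ := (hB .south β).θm_eq _ h' _ _ _ hy
    simp only [ZeroMemClass.coe_zero, zero_mul, mul_zero, add_zero, Submodule.coe_smul] at p₁ p₂
    rw [p₁, hm, add_right_inj] at p₂
    rw [p₂, smul_mul_assoc, mul_smul_comm]

theorem cover_of_represents (α : Pole) (w : ℂ) :
    w ∈ (B α .south).dom ∨ w ∈ (B α .north).dom := by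
  rcases mem_southChart_or (T (point α (bodyPoint w 0 0))) with ⟨y, hy⟩ | ⟨y, hy⟩
  · exact Or.inl ((hB α .south).mem_dom_of_mem hy)
  · exact Or.inr ((hB α .north).mem_dom_of_mem hy)

theorem mem_south_of_isUnit (α : Pole) {w : ℂ} (hw : w ∈ (B α .north).dom)
    (hu : IsUnit ((B α .north).f w)) : w ∈ (B α .south).dom := by
  obtain ⟨y, hy⟩ := (hB α .north).exists_mem hw 0 0
  have z₁ := (hB α .north).z_eq w hw _ _ _ hy
  simp only [ZeroMemClass.coe_zero, zero_mul, add_zero] at z₁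
  exact (hB α .south).mem_dom_of_mem (south_mem_of_north hy (z₁ ▸ hu))

theorem mem_north_of_isUnit (α : Pole) {w : ℂ} (hw : w ∈ (B α .south).dom)
    (hu : IsUnit ((B α .south).f w)) : w ∈ (B α .north).dom := by
  obtain ⟨y, hy⟩ := (hB α .south).exists_mem hw 0 0
  have z₁ := (hB α .south).z_eq w hw _ _ _ hy
  simp only [ZeroMemClass.coe_zero, zero_mul, add_zero] at z₁
  exact (hB α .north).mem_dom_of_mem (north_mem_of_south hy (z₁ ▸ hu))

omit hB in
/-- The expressions over the body of an injective map represented by `B`. -/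
def sphereMap (hB : ∀ α β, (B α β).Represents (expr T α β)) (hL : 1 < L)
    (hT : Function.Injective T) : SphereMap L n where
  B := B
  cover := cover_of_represents hB
  isUnit_gp α β _ hw := (isUnit_g_of_injective hB hL hT α β hw).1
  isUnit_gm α β _ hw := (isUnit_g_of_injective hB hL hT α β hw).2
  isUnit_f α _ hS hN := (target_rel hB hL α hS hN).1
  f_rel α _ hS hN := (target_rel hB hL α hS hN).2.1
  mem_south α _ := mem_south_of_isUnit hB α
  mem_north α _ := mem_north_of_isUnit hB α
  ψp_rel α _ hS hN := (target_rel hB hL α hS hN).2.2.1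
  ψm_rel α _ hS hN := (target_rel hB hL α hS hN).2.2.2.1
  gp_rel α _ hS hN := (target_rel hB hL α hS hN).2.2.2.2.1
  gm_rel α _ hS hN := (target_rel hB hL α hS hN).2.2.2.2.2
  dom_inv β _ hu := mem_dom_inv hB β hu
  f_inv β _ hu h := (source_rel hB hL β hu h).1
  ψp_inv β _ hu h := (source_rel hB hL β hu h).2.1
  ψm_inv β _ hu h := (source_rel hB hL β hu h).2.2.1
  gp_inv β _ hu h := (source_rel hB hL β hu h).2.2.2.1
  gm_inv β _ hu h := (source_rel hB hL β hu h).2.2.2.2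

end Sphere

/-! ### Entire functions of polynomial growth -/

theorem eq_sum_of_entire_of_inversion {φ φ' : ℂ → ℂ} (hφ : Differentiable ℂ φ)
    (hφ' : Differentiable ℂ φ') (m : ℕ) (h : ∀ u ≠ 0, φ' u = u ^ m * φ u⁻¹) (w : ℂ) :
    φ w = ∑ j ∈ Finset.range (m + 1), w ^ j * ((j.factorial : ℂ)⁻¹ * iteratedDeriv j φ 0) := by
  obtain ⟨C, hC⟩ := (isCompact_closedBall (0 : ℂ) 1).exists_bound_of_continuousOn
    hφ'.continuous.continuousOn
  have hC0 : 0 ≤ C := (norm_nonneg _).trans (hC 0 (by simp))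
  have hbound : ∀ R : ℝ, 1 ≤ R → ∀ z ∈ Metric.sphere (0 : ℂ) R, ‖φ z‖ ≤ C * R ^ m := by
    intro R hR z hz
    have hzn : ‖z‖ = R := by simpa using hz
    have hz0 : z ≠ 0 := by
      rintro rfl
      simp at hzn
      linarith
    have h1 := h z⁻¹ (inv_ne_zero hz0)
    rw [inv_inv] at h1
    have h2 : φ z = z ^ m * φ' z⁻¹ := by
      rw [h1, ← mul_assoc, ← mul_pow, mul_inv_cancel₀ hz0, one_pow, one_mul]
    rw [h2, norm_mul, norm_pow, hzn, mul_comm]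
    refine mul_le_mul_of_nonneg_right (hC _ ?_) (by positivity)
    rw [mem_closedBall_zero_iff, norm_inv, hzn]
    exact inv_le_one_of_one_le₀ hR
  have hzero : ∀ j, m < j → iteratedDeriv j φ 0 = 0 := by
    intro j hj
    have h1 : ∀ R : ℝ, 1 ≤ R → ‖iteratedDeriv j φ 0‖ ≤ (j.factorial * C) * R⁻¹ := by
      intro R hR
      have hR0 : 0 < R := by linarith
      refine (Complex.norm_iteratedDeriv_le_of_forall_mem_sphere_norm_le j hR0
        hφ.diffContOnCl (hbound R hR)).trans ?_
      rw [div_le_iff₀ (by positivity), ← mul_assoc, mul_assoc _ R⁻¹]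
      refine mul_le_mul_of_nonneg_left ?_ (by positivity)
      rw [← div_eq_inv_mul, le_div_iff₀ hR0, ← pow_succ]
      exact pow_le_pow_right₀ hR hj
    have h2 : Filter.Tendsto (fun R : ℝ => (j.factorial * C) * R⁻¹) Filter.atTop (𝓝 0) := by
      simpa using tendsto_inv_atTop_zero.const_mul ((j.factorial : ℝ) * C)
    have h3 : ‖iteratedDeriv j φ 0‖ ≤ 0 := ge_of_tendsto h2
      (Filter.eventually_atTop.2 ⟨1, fun R hR => h1 R hR⟩)
    exact norm_le_zero_iff.1 h3
  have hs := Complex.hasSum_taylorSeries_of_entire hφ 0 w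
  refine (hs.unique (hasSum_sum_of_ne_finset_zero (s := Finset.range (m + 1)) ?_)).trans ?_
  · intro j hj
    rw [hzero j (by simpa using hj), smul_zero, smul_zero]
  · refine Finset.sum_congr rfl fun j _ => ?_
    simp only [sub_zero, smul_eq_mul]
    ring

theorem exists_sum_of_entire_of_inversion {A A' : ℂ → Gr L} (hA : ∀ w, SuperAnalyticAt w A)
    (hA' : ∀ w, SuperAnalyticAt w A') (m : ℕ) (h : ∀ u ≠ 0, A' u = u ^ m • A u⁻¹)
    (W : Submodule ℂ (Gr L)) (hW : ∀ w, A w ∈ W) :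
    ∃ p : ℕ → Gr L, (∀ j, p j ∈ W ⊓ Subalgebra.toSubmodule (lowAlg L)) ∧
      ∀ w, A w = ∑ j ∈ Finset.range (m + 1), w ^ j • p j := by
  refine ⟨fun j => (j.factorial : ℂ)⁻¹ • wderiv^[j] A 0, fun j => Submodule.smul_mem _ _
    ⟨((hA 0).wderiv_iterate_mem W (.of_forall hW) j).self_of_nhds,
      ((hA 0).wderiv_iterate j).mem_lowAlg⟩, fun w => eq_of_dual fun ℓ => ?_⟩
  have hd : ∀ j v, iteratedDeriv j (fun v => ℓ (A v)) v = ℓ (wderiv^[j] A v) := by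
    intro j
    induction j with
    | zero => simp
    | succ j ih =>
      intro v
      rw [iteratedDeriv_succ, show iteratedDeriv j (fun v => ℓ (A v)) = _ from funext ih,
        Function.iterate_succ_apply']
      exact (((hA v).wderiv_iterate j).hasWeakDerivAt ℓ).deriv
  have := eq_sum_of_entire_of_inversion (φ := fun v => ℓ (A v)) (φ' := fun v => ℓ (A' v))
    (fun v => ((hA v).dual ℓ).differentiableAt) (fun v => ((hA' v).dual ℓ).differentiableAt) m
    (fun u hu => by simp only [h u hu, map_smul, smul_eq_mul]) w
  simp only [hd] at this
  rw [this, map_sum]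
  simp only [map_smul, smul_eq_mul]

theorem coeff_eq_zero_of_forall_sum_eq_zero {N : ℕ} {q : ℕ → Gr L}
    (h : ∀ w : ℂ, ∑ j ∈ Finset.range N, w ^ j • q j = 0) : ∀ j < N, q j = 0 := by
  intro j hj
  refine eq_of_dual fun ℓ => ?_
  let P : Polynomial ℂ := ∑ i ∈ Finset.range N, Polynomial.monomial i (ℓ (q i))
  have hP : P = 0 := Polynomial.funext fun w => by
    have := congrArg ℓ (h w)
    simp only [map_sum, map_smul, smul_eq_mul, map_zero] at this
    simp only [P, Polynomial.eval_finsetSum, Polynomial.eval_monomial, Polynomial.eval_zero]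
    rw [← this]
    exact Finset.sum_congr rfl fun i _ => mul_comm _ _
  have := congrArg (fun p => Polynomial.coeff p j) hP
  simp only [P, Polynomial.finsetSum_coeff, Polynomial.coeff_monomial, Polynomial.coeff_zero]
    at this
  rw [map_zero, ← this]
  simp [hj]

namespace SphereMap

variable {n : ℤ} (S : SphereMap L n)

open Classical in
/-- The function glued from functions on the two target charts. -/
noncomputable def glue (A : Pole → Pole → ℂ → Gr L) (α : Pole) (w : ℂ) : Gr L :=
  if w ∈ (S.B α .south).dom then A α .south w else A α .north w

theorem glue_eq {A : Pole → Pole → ℂ → Gr L}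
    (hglue : ∀ α, ∀ w ∈ (S.B α .south).dom, w ∈ (S.B α .north).dom →
      A α .south w = A α .north w) (α β : Pole) {w : ℂ} (hw : w ∈ (S.B α β).dom) :
    S.glue A α w = A α β w := by
  unfold glue
  cases β with
  | south => rw [if_pos hw]
  | north =>
    split_ifs with h
    · exact hglue α w h hw
    · rfl

/-- Functions on the charts that match under both changes of charts are polynomial. -/
theorem exists_sum_of_section {A : Pole → Pole → ℂ → Gr L}
    (han : ∀ α β, ∀ w ∈ (S.B α β).dom, SuperAnalyticAt w (A α β))
    (hglue : ∀ α, ∀ w ∈ (S.B α .south).dom, w ∈ (S.B α .north).dom →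
      A α .south w = A α .north w) {c : ℂ} (hc : c ≠ 0) (m : ℤ)
    (hinv : ∀ β u, u ≠ 0 → u ∈ (S.B .north β).dom →
      A .north β u = (c * u ^ m) • A .south β u⁻¹)
    (W : Submodule ℂ (Gr L)) (hW : ∀ β, ∀ w ∈ (S.B .south β).dom, A .south β w ∈ W) :
    ∃ p : ℕ → Gr L, (∀ j, p j ∈ W ⊓ Subalgebra.toSubmodule (lowAlg L)) ∧
      ∀ β, ∀ w ∈ (S.B .south β).dom,
        A .south β w = ∑ j ∈ Finset.range (m + 1).toNat, w ^ j • p j := by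
  have hex : ∀ α w, ∃ β, w ∈ (S.B α β).dom := fun α w => (S.cover α w).elim
    (fun h => ⟨_, h⟩) fun h => ⟨_, h⟩
  have hg : ∀ α w, SuperAnalyticAt w (S.glue A α) := by
    intro α w
    obtain ⟨β, hβ⟩ := hex α w
    refine .congr _ _ (han α β w hβ) ?_
    filter_upwards [(S.B α β).eventually_mem_dom hβ] with v hv
    rw [S.glue_eq hglue α β hv]
  have hgi : ∀ u ≠ 0, S.glue A .north u = (c * u ^ m) • S.glue A .south u⁻¹ := by
    intro u hu
    obtain ⟨β, hβ⟩ := hex .north u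
    rw [S.glue_eq hglue _ β hβ, S.glue_eq hglue _ β ((S.dom_inv β u hu).1 hβ), hinv β u hu hβ]
  have hgW : ∀ w, S.glue A .south w ∈ W := by
    intro w
    obtain ⟨β, hβ⟩ := hex .south w
    rw [S.glue_eq hglue _ β hβ]
    exact hW β w hβ
  suffices ∃ p : ℕ → Gr L, (∀ j, p j ∈ W ⊓ Subalgebra.toSubmodule (lowAlg L)) ∧
      ∀ w, S.glue A .south w = ∑ j ∈ Finset.range (m + 1).toNat, w ^ j • p j by
    obtain ⟨p, hp, h⟩ := this
    exact ⟨p, hp, fun β w hw => by rw [← S.glue_eq hglue _ β hw, h]⟩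
  rcases le_or_gt 0 m with hm | hm
  · lift m to ℕ using hm
    refine exists_sum_of_entire_of_inversion (hg .south)
      (A' := fun u => c⁻¹ • S.glue A .north u)
      (fun w => .csmul (c := fun _ => c⁻¹) analyticAt_const (hg .north w)) m (fun u hu => ?_)
      W hgW
    rw [hgi u hu, smul_smul, ← mul_assoc, inv_mul_cancel₀ hc, one_mul, zpow_natCast]
  · obtain ⟨k, hk⟩ : ∃ k : ℕ, m = -(k + 1 : ℕ) := ⟨(-m - 1).toNat, by omega⟩
    have han' : ∀ w, SuperAnalyticAt w (fun u => (c⁻¹ * u ^ (k + 1)) • S.glue A .north u) :=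
      fun w => .csmul (by fun_prop) (hg .north w)
    have hi : ∀ u ≠ 0, (c⁻¹ * u ^ (k + 1)) • S.glue A .north u = S.glue A .south u⁻¹ := by
      intro u hu
      have : c⁻¹ * u ^ (k + 1) * (c * u ^ m) = 1 := by
        rw [hk, zpow_neg, zpow_natCast]
        field_simp
      rw [hgi u hu, smul_smul, this, one_smul]
    obtain ⟨p, hp, h⟩ := exists_sum_of_entire_of_inversion (hg .south) han' 0
      (fun u hu => by rw [hi u hu, pow_zero, one_smul]) W hgW
    have h' : ∀ w, S.glue A .south w = p 0 := fun w => by simpa using h w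
    have h0 : (fun u => (c⁻¹ * u ^ (k + 1)) • S.glue A .north u) =ᶠ[𝓝 0] fun _ => p 0 :=
      (han' 0).eventuallyEq_of_punctured (.const (hp 0).2 0) <| by
        filter_upwards [self_mem_nhdsWithin] with u hu
        rw [hi u hu, h']
    have h1 : p 0 = 0 := by simpa using h0.eq_of_nhds.symm
    refine ⟨fun _ => 0, fun _ => zero_mem _, fun w => ?_⟩
    rw [h' w, h1]
    simp

end SphereMap

/-! ### The Möbius form of the even component -/

theorem inverse_eq_of_mul_eq_one {x y : Gr L} (hx : x ∈ even L) (h : x * y = 1) :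
    Ring.inverse x = y := by
  have hu : IsUnit x := ⟨⟨x, y, h, by rw [← even_comm hx, h]⟩, rfl⟩
  rw [← mul_one (Ring.inverse x), ← h, ← mul_assoc, Ring.inverse_mul_cancel _ hu, one_mul]

theorem inverse_smul {c : ℂ} (hc : c ≠ 0) {x : Gr L} (hx : x ∈ even L) (hu : IsUnit x) :
    Ring.inverse (c • x) = c⁻¹ • Ring.inverse x :=
  inverse_eq_of_mul_eq_one (Submodule.smul_mem _ _ hx) (by
    rw [smul_mul_smul_comm, mul_inv_cancel₀ hc, Ring.mul_inverse_cancel _ hu, one_smul])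

theorem exists_mobius_of_relations {R : Type*} [CommRing R] {v₀ v₁ v₂ y₀ y₁ y₂ d e h : R}
    (h₀ : y₁ * v₀ - y₀ * v₁ = v₀) (h₁ : 2 * y₂ * v₀ - 2 * y₀ * v₂ = v₁)
    (h₂ : y₂ * v₁ - y₁ * v₂ = v₂) (hd : d * d = v₀) (he : d * e = 1) (hh : 2 * h = 1) :
    ∃ a b c : R, a * d - b * c = 1 ∧ v₁ = 2 * c * d ∧ v₂ = c * c ∧ y₀ = b * d ∧
      y₁ = a * d + b * c ∧ y₂ = a * c := by
  have he2 : e * e * v₀ = 1 := by linear_combination (-e * e) * hd + (d * e + 1) * he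
  have hy1 : y₁ = 1 + y₀ * v₁ * (e * e) := by
    linear_combination (e * e) * h₀ + (1 - y₁) * he2
  have hy2 : y₂ = h * (v₁ + 2 * y₀ * v₂) * (e * e) := by
    linear_combination h * (e * e) * h₁ - y₂ * he2 - (e * e) * v₀ * y₂ * hh
  have hdisc : v₁ * v₁ = 4 * v₀ * v₂ := by
    have e1 : v₁ * v₁ - 4 * v₀ * v₂ = 0 := by
      linear_combination (2 * v₀) * h₂ - v₁ * h₁ + 2 * v₂ * h₀
    linear_combination e1
  have hv2 : v₂ = h * h * (v₁ * v₁) * (e * e) := by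
    linear_combination (-h * h * e * e) * hdisc + (-(2*h+1) * v₂) * hh + (-4 * h * h * v₂) * he2
  refine ⟨(1 + y₀ * e * (h * v₁ * e)) * e, y₀ * e, h * v₁ * e, ?_, ?_, ?_, ?_, ?_, ?_⟩
  · linear_combination (1 + y₀ * e * (h * v₁ * e)) * he
  · linear_combination (-v₁) * hh - (2 * h * v₁) * he
  · linear_combination hv2
  · linear_combination (-y₀) * he
  · linear_combination hy1 - (1 + y₀ * e * (h * v₁ * e)) * he - (y₀ * v₁ * e * e) * hh
  · rw [hy2, hv2]
    linear_combination (y₀ * h ^ 2 * v₁ ^ 2 * e ^ 4) * hh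

theorem hasWeakDerivAt_quadratic (p : ℕ → Gr L) (w : ℂ) :
    HasWeakDerivAt (fun v => ∑ j ∈ Finset.range 3, v ^ j • p j) (p 1 + (2 * w) • p 2) w := by
  intro ℓ
  have h1 : (fun v : ℂ => ℓ (∑ j ∈ Finset.range 3, v ^ j • p j))
      = fun v => ℓ (p 0) + v * ℓ (p 1) + v ^ 2 * ℓ (p 2) := by
    ext v
    simp [Finset.sum_range_succ]
  rw [h1]
  have h2 := (((hasDerivAt_const w (ℓ (p 0))).add ((hasDerivAt_id w).mul_const (ℓ (p 1)))).add
    ((hasDerivAt_pow 2 w).mul_const (ℓ (p 2))))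
  refine h2.congr_deriv ?_
  simp

theorem inverse_deriv_relation {R : Type*} [CommRing R] {a b a' b' i j : R} (h₁ : a * b = 1)
    (h₂ : a' * b + a * b' = 0) (h₃ : a' * i = 1) (h₄ : b' * j = 1) :
    i = -(b * b * j) ∧ a * i = -(b * j) := by
  have h : i = -(b * b * j) := by
    linear_combination (-i * b' * j) * h₁ - i * h₄ + i * b * j * h₂ - b * b * j * h₃
  exact ⟨h, by linear_combination a * h - b * j * h₁⟩

/-- The relations among the coefficients of two quadratic polynomials `X`, `Y` with
`Y' X - Y X' = X`, `X ≠ 0`, make `Y / X` a Möbius transformation. -/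
theorem exists_mobius {p q : ℕ → Gr L} (hp : ∀ j, p j ∈ lowEven L) (hq : ∀ j, q j ∈ lowEven L)
    (h₀ : q 1 * p 0 - q 0 * p 1 = p 0)
    (h₁ : (2 : ℂ) • (q 2 * p 0) - (2 : ℂ) • (q 0 * p 2) = p 1)
    (h₂ : q 2 * p 1 - q 1 * p 2 = p 2) (hne : body (p 0) ≠ 0 ∨ body (p 2) ≠ 0) :
    ∃ a ∈ lowEven L, ∃ b ∈ lowEven L, ∃ c ∈ lowEven L, ∃ d ∈ lowEven L, a * d - b * c = 1 ∧
      p 0 = d * d ∧ p 1 = (2 : ℂ) • (c * d) ∧ p 2 = c * c ∧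
      q 0 = b * d ∧ q 1 = a * d + b * c ∧ q 2 = a * c := by
  have key : ∀ v₀ v₁ v₂ y₀ y₁ y₂ : lowEvenAlg L, y₁ * v₀ - y₀ * v₁ = v₀ →
      2 * y₂ * v₀ - 2 * y₀ * v₂ = v₁ → y₂ * v₁ - y₁ * v₂ = v₂ → body (v₀ : Gr L) ≠ 0 →
      ∃ a b c d : lowEvenAlg L, a * d - b * c = 1 ∧ v₀ = d * d ∧ v₁ = 2 * c * d ∧ v₂ = c * c ∧
        y₀ = b * d ∧ y₁ = a * d + b * c ∧ y₂ = a * c := by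
    intro v₀ v₁ v₂ y₀ y₁ y₂ h₀ h₁ h₂ hb
    obtain ⟨d, hd, hdu, hdd⟩ := exists_lowEven_sqrt v₀.2 (isUnit_of_body_ne_zero v₀.2.1 hb)
    have he : (⟨d, hd⟩ : lowEvenAlg L) * ⟨Ring.inverse d, inverse_mem_lowEven hd⟩ = 1 :=
      Subtype.ext (Ring.mul_inverse_cancel _ hdu)
    have hd' : (⟨d, hd⟩ : lowEvenAlg L) * ⟨d, hd⟩ = v₀ := Subtype.ext hdd
    have hh : (2 : lowEvenAlg L) * algebraMap ℂ (lowEvenAlg L) 2⁻¹ = 1 := by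
      rw [← map_ofNat (algebraMap ℂ (lowEvenAlg L)) 2, ← map_mul]
      simp
    obtain ⟨a, b, c, g₁, g₂, g₃, g₄, g₅, g₆⟩ := exists_mobius_of_relations h₀ h₁ h₂ hd' he hh
    exact ⟨a, b, c, ⟨d, hd⟩, g₁, hd'.symm, g₂, g₃, g₄, g₅, g₆⟩
  have two : ∀ x : lowEvenAlg L, ((2 * x : lowEvenAlg L) : Gr L) = (2 : ℂ) • (x : Gr L) := by
    intro x
    rw [two_mul, two_smul]
    rfl
  let P : ℕ → lowEvenAlg L := fun j => ⟨p j, hp j⟩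
  let Q : ℕ → lowEvenAlg L := fun j => ⟨q j, hq j⟩
  have H₀ : Q 1 * P 0 - Q 0 * P 1 = P 0 := Subtype.ext h₀
  have H₁ : 2 * Q 2 * P 0 - 2 * Q 0 * P 2 = P 1 := by
    rw [mul_assoc, mul_assoc]
    refine Subtype.ext ?_
    rw [Subalgebra.coe_sub, two, two]
    exact h₁
  have H₂ : Q 2 * P 1 - Q 1 * P 2 = P 2 := Subtype.ext h₂
  have fin : ∀ a b c d : lowEvenAlg L, a * d - b * c = 1 → P 0 = d * d → P 1 = 2 * c * d →
      P 2 = c * c → Q 0 = b * d → Q 1 = a * d + b * c → Q 2 = a * c → _ :=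
    fun a b c d g₁ g₂ g₃ g₄ g₅ g₆ g₇ => (⟨a, a.2, b, b.2, c, c.2, d, d.2, congrArg Subtype.val g₁,
      congrArg Subtype.val g₂, by
        have := congrArg Subtype.val g₃
        rwa [mul_assoc, two] at this, congrArg Subtype.val g₄,
      congrArg Subtype.val g₅, congrArg Subtype.val g₆, congrArg Subtype.val g₇⟩ :
      ∃ a ∈ lowEven L, ∃ b ∈ lowEven L, ∃ c ∈ lowEven L, ∃ d ∈ lowEven L, a * d - b * c = 1 ∧
      p 0 = d * d ∧ p 1 = (2 : ℂ) • (c * d) ∧ p 2 = c * c ∧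
      q 0 = b * d ∧ q 1 = a * d + b * c ∧ q 2 = a * c)
  rcases hne with hne | hne
  · obtain ⟨a, b, c, d, g₁, g₂, g₃, g₄, g₅, g₆, g₇⟩ := key _ _ _ _ _ _ H₀ H₁ H₂ hne
    exact fin a b c d g₁ g₂ g₃ g₄ g₅ g₆ g₇
  · obtain ⟨a, b, c, d, g₁, g₂, g₃, g₄, g₅, g₆, g₇⟩ := key (P 2) (P 1) (P 0) (-Q 2) (-Q 1) (-Q 0)
      (by linear_combination H₂) (by linear_combination H₁) (by linear_combination H₀) hne
    exact fin (-b) (-a) d c (by linear_combination g₁) g₄ (by linear_combination g₃) g₂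
      (by linear_combination -g₇) (by linear_combination -g₆) (by linear_combination -g₅)

namespace SphereMap

variable {n : ℤ} (S : SphereMap L n)

theorem f_lowEven (α β : Pole) {w : ℂ} (hw : w ∈ (S.B α β).dom) : (S.B α β).f w ∈ lowEven L :=
  ⟨(S.B α β).f_even w hw, ((S.B α β).f_an w hw).mem_lowAlg⟩

theorem wderiv_f_lowEven (α β : Pole) {w : ℂ} (hw : w ∈ (S.B α β).dom) :
    wderiv (S.B α β).f w ∈ lowEven L :=
  ⟨((S.B α β).f_an w hw).wderiv_mem _
    (((S.B α β).eventually_mem_dom hw).mono fun v hv => (S.B α β).f_even v hv),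
    ((S.B α β).f_an w hw).wderiv.mem_lowAlg⟩

theorem isUnit_wderiv_f (α β : Pole) {w : ℂ} (hw : w ∈ (S.B α β).dom) :
    IsUnit (wderiv (S.B α β).f w) := by
  refine isUnit_of_body_ne_zero (S.wderiv_f_lowEven α β hw).1 ?_
  rw [(S.B α β).cond w hw]
  simp only [map_add, map_sub, map_mul, body_odd ((S.B α β).ψp_odd w hw),
    body_odd ((S.B α β).ψm_odd w hw), mul_zero, zero_mul, sub_zero, zero_add]
  exact mul_ne_zero (body_ne_zero_of_isUnit (S.isUnit_gp α β w hw))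
    (body_ne_zero_of_isUnit (S.isUnit_gm α β w hw))

theorem inverse_wderiv_f_an (α β : Pole) {w : ℂ} (hw : w ∈ (S.B α β).dom) :
    SuperAnalyticAt w (fun v => Ring.inverse (wderiv (S.B α β).f v)) :=
  ((S.B α β).f_an w hw).wderiv.inverse
    (((S.B α β).eventually_mem_dom hw).mono fun _ hv => (S.wderiv_f_lowEven α β hv).1)
    (S.isUnit_wderiv_f α β hw)

theorem wderiv_f_inv (β : Pole) {u : ℂ} (hu : u ≠ 0) (h : u ∈ (S.B .north β).dom) :
    Ring.inverse (wderiv (S.B .north β).f u)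
      = (-u ^ 2) • Ring.inverse (wderiv (S.B .south β).f u⁻¹) := by
  have h' := (S.dom_inv β u hu).1 h
  have h1 : (fun v => (S.B .south β).f v⁻¹) =ᶠ[𝓝 u] (S.B .north β).f := by
    filter_upwards [(S.B .north β).eventually_mem_dom h, eventually_ne_nhds hu] with v hv hv0
    exact (S.f_inv β v hv0 hv).symm
  have h2 := ((((S.B .south β).f_an _ h').hasWeakDerivAt.comp (hasDerivAt_inv hu)).congr
    h1).wderiv_eq
  rw [h2, inverse_smul (by simpa using hu) (S.wderiv_f_lowEven _ β h').1 (S.isUnit_wderiv_f _ β h')]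
  congr 1
  rw [inv_neg, inv_inv]

theorem f_mul_f (α : Pole) {w : ℂ} (hS : w ∈ (S.B α .south).dom) (hN : w ∈ (S.B α .north).dom) :
    (S.B α .south).f w * (S.B α .north).f w = 1 := by
  rw [S.f_rel α w hS hN, Ring.inverse_mul_cancel _ (S.isUnit_f α w hS hN)]

theorem inverse_wderiv_f_glue (α : Pole) {w : ℂ} (hS : w ∈ (S.B α .south).dom)
    (hN : w ∈ (S.B α .north).dom) :
    Ring.inverse (wderiv (S.B α .south).f w) = -((S.B α .north).f w * (S.B α .north).f w
      * Ring.inverse (wderiv (S.B α .north).f w)) ∧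
    (S.B α .south).f w * Ring.inverse (wderiv (S.B α .south).f w)
      = -((S.B α .north).f w * Ring.inverse (wderiv (S.B α .north).f w)) := by
  have h1 := S.f_mul_f α hS hN
  have h2 : wderiv (S.B α .south).f w * (S.B α .north).f w
      + (S.B α .south).f w * wderiv (S.B α .north).f w = 0 := by
    refine (((S.B α .south).f_an w hS).hasWeakDerivAt_mul ((S.B α .south).f_an w hS).hasWeakDerivAt
      ((S.B α .north).f_an w hN).hasWeakDerivAt).unique ((HasWeakDerivAt.const 1 w).congr ?_)
    filter_upwards [(S.B α .south).eventually_mem_dom hS, (S.B α .north).eventually_mem_dom hN]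
      with v hv hv' using (S.f_mul_f α hv hv').symm
  have h3 := Ring.mul_inverse_cancel _ (S.isUnit_wderiv_f α .south hS)
  have h4 := Ring.mul_inverse_cancel _ (S.isUnit_wderiv_f α .north hN)
  have := inverse_deriv_relation (R := lowEvenAlg L) (a := ⟨_, S.f_lowEven α .south hS⟩)
    (b := ⟨_, S.f_lowEven α .north hN⟩) (a' := ⟨_, S.wderiv_f_lowEven α .south hS⟩)
    (b' := ⟨_, S.wderiv_f_lowEven α .north hN⟩)
    (i := ⟨_, inverse_mem_lowEven (S.wderiv_f_lowEven α .south hS)⟩)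
    (j := ⟨_, inverse_mem_lowEven (S.wderiv_f_lowEven α .north hN)⟩)
    (Subtype.ext h1) (Subtype.ext h2) (Subtype.ext h3) (Subtype.ext h4)
  exact ⟨congrArg Subtype.val this.1, congrArg Subtype.val this.2⟩

/-- The pullback of the vector field `∂/∂z`. -/
noncomputable def pullField (α : Pole) : Pole → ℂ → Gr L
  | .south => fun w => Ring.inverse (wderiv (S.B α .south).f w)
  | .north => fun w => -((S.B α .north).f w * (S.B α .north).f w
      * Ring.inverse (wderiv (S.B α .north).f w))

/-- The pullback of the vector field `z ∂/∂z`. -/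
noncomputable def pullEuler (α : Pole) : Pole → ℂ → Gr L
  | .south => fun w => (S.B α .south).f w * Ring.inverse (wderiv (S.B α .south).f w)
  | .north => fun w => -((S.B α .north).f w * Ring.inverse (wderiv (S.B α .north).f w))

theorem exists_quadratic_pullField : ∃ p : ℕ → Gr L, (∀ j, p j ∈ lowEven L) ∧
    ∀ β, ∀ w ∈ (S.B .south β).dom, S.pullField .south β w
      = ∑ j ∈ Finset.range 3, w ^ j • p j := by
  refine S.exists_sum_of_section (A := S.pullField) ?_
    (fun α w hS hN => (S.inverse_wderiv_f_glue α hS hN).1) (c := -1) (by simp) 2 ?_ (even L) ?_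
  · rintro α (_ | _) w hw
    · exact S.inverse_wderiv_f_an α _ hw
    · exact ((((S.B α .north).f_an w hw).mul ((S.B α .north).f_an w hw)).mul
        (S.inverse_wderiv_f_an α _ hw)).neg
  · rintro (_ | _) u hu h
    · simp only [pullField, S.wderiv_f_inv _ hu h]
      congr 1
      rw [neg_one_mul]
      rfl
    · simp only [pullField, S.wderiv_f_inv _ hu h, S.f_inv _ u hu h, mul_smul_comm, smul_neg]
      congr 2
      rw [neg_one_mul]
      rfl
  · rintro (_ | _) w hw
    · exact inverse_mem_even (S.wderiv_f_lowEven _ _ hw).1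
    · exact neg_mem (even_mul_mem (even_mul_mem ((S.B _ _).f_even w hw) ((S.B _ _).f_even w hw))
        (inverse_mem_even (S.wderiv_f_lowEven _ _ hw).1))

theorem exists_quadratic_pullEuler : ∃ q : ℕ → Gr L, (∀ j, q j ∈ lowEven L) ∧
    ∀ β, ∀ w ∈ (S.B .south β).dom, S.pullEuler .south β w
      = ∑ j ∈ Finset.range 3, w ^ j • q j := by
  refine S.exists_sum_of_section (A := S.pullEuler) ?_
    (fun α w hS hN => (S.inverse_wderiv_f_glue α hS hN).2) (c := -1) (by simp) 2 ?_ (even L) ?_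
  · rintro α (_ | _) w hw
    · exact ((S.B α .south).f_an w hw).mul (S.inverse_wderiv_f_an α _ hw)
    · exact (((S.B α .north).f_an w hw).mul (S.inverse_wderiv_f_an α _ hw)).neg
  · rintro (_ | _) u hu h
    · simp only [pullEuler, S.wderiv_f_inv _ hu h, S.f_inv _ u hu h, mul_smul_comm]
      congr 1
      rw [neg_one_mul]
      rfl
    · simp only [pullEuler, S.wderiv_f_inv _ hu h, S.f_inv _ u hu h, mul_smul_comm, smul_neg]
      congr 2
      rw [neg_one_mul]
      rfl
  · rintro (_ | _) w hw
    · exact even_mul_mem ((S.B _ _).f_even w hw) (inverse_mem_even (S.wderiv_f_lowEven _ _ hw).1)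
    · exact neg_mem (even_mul_mem ((S.B _ _).f_even w hw)
        (inverse_mem_even (S.wderiv_f_lowEven _ _ hw).1))

/-- `f` in the two southern expressions, in terms of the coefficients of a Möbius
transformation. -/
theorem exists_mobius_south : ∃ a ∈ lowEven L, ∃ b ∈ lowEven L, ∃ c ∈ lowEven L,
    ∃ d ∈ lowEven L, a * d - b * c = 1 ∧
      ∀ β, ∀ w ∈ (S.B .south β).dom,
        S.pullField .south β w = (w • c + d) * (w • c + d) ∧
        S.pullEuler .south β w = (w • a + b) * (w • c + d) := by
  obtain ⟨p, hp, hX⟩ := S.exists_quadratic_pullField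
  obtain ⟨q, hq, hY⟩ := S.exists_quadratic_pullEuler
  have hode : ∀ w : ℂ, (q 1 + (2 * w) • q 2) * ∑ j ∈ Finset.range 3, w ^ j • p j
      - (∑ j ∈ Finset.range 3, w ^ j • q j) * (p 1 + (2 * w) • p 2)
      = ∑ j ∈ Finset.range 3, w ^ j • p j := by
    intro w
    have dX := hasWeakDerivAt_quadratic p w
    have dY := hasWeakDerivAt_quadratic q w
    rcases S.cover .south w with hw | hw
    · have hF := (S.B .south .south).f_an w hw
      have h1 : wderiv (S.B .south .south).f w * (∑ j ∈ Finset.range 3, w ^ j • p j)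
          + (S.B .south .south).f w * (p 1 + (2 * w) • p 2) = q 1 + (2 * w) • q 2 := by
        refine (hF.hasWeakDerivAt_mul hF.hasWeakDerivAt dX).unique (dY.congr ?_)
        filter_upwards [(S.B .south .south).eventually_mem_dom hw] with v hv
        rw [← hX .south v hv, ← hY .south v hv]
        rfl
      have h2 : wderiv (S.B .south .south).f w * (∑ j ∈ Finset.range 3, w ^ j • p j) = 1 := by
        rw [← hX .south w hw]
        exact Ring.mul_inverse_cancel _ (S.isUnit_wderiv_f _ _ hw)
      have h3 : ∑ j ∈ Finset.range 3, w ^ j • q j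
          = (S.B .south .south).f w * ∑ j ∈ Finset.range 3, w ^ j • p j := by
        rw [← hX .south w hw, ← hY .south w hw]
        rfl
      have hXe : ∑ j ∈ Finset.range 3, w ^ j • p j ∈ even L :=
        Submodule.sum_mem _ fun j _ => Submodule.smul_mem _ _ (hp j).1
      rw [h3, ← h1, h2, add_mul, one_mul, mul_assoc, mul_assoc, even_comm hXe, add_sub_cancel_right]
    · have hF := (S.B .south .north).f_an w hw
      have h1 : wderiv (S.B .south .north).f w * (∑ j ∈ Finset.range 3, w ^ j • q j)
          + (S.B .south .north).f w * (q 1 + (2 * w) • q 2) = p 1 + (2 * w) • p 2 := by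
        refine (hF.hasWeakDerivAt_mul hF.hasWeakDerivAt dY).unique (dX.congr ?_)
        filter_upwards [(S.B .south .north).eventually_mem_dom hw] with v hv
        rw [← hX .north v hv, ← hY .north v hv]
        simp only [pullField, pullEuler, mul_neg, mul_assoc]
      have h2 : wderiv (S.B .south .north).f w * (∑ j ∈ Finset.range 3, w ^ j • q j)
          = -(S.B .south .north).f w := by
        rw [← hY .north w hw, pullEuler, mul_neg, even_comm ((S.B .south .north).f_even w hw),
          ← mul_assoc, Ring.mul_inverse_cancel _ (S.isUnit_wderiv_f _ _ hw), one_mul]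
      have h3 : ∑ j ∈ Finset.range 3, w ^ j • p j
          = (S.B .south .north).f w * ∑ j ∈ Finset.range 3, w ^ j • q j := by
        rw [← hX .north w hw, ← hY .north w hw]
        simp only [pullField, pullEuler, mul_neg, mul_assoc]
      have hYe : ∑ j ∈ Finset.range 3, w ^ j • q j ∈ even L :=
        Submodule.sum_mem _ fun j _ => Submodule.smul_mem _ _ (hq j).1
      have hFe := (S.B .south .north).f_even w hw
      rw [h3, ← h1, h2, mul_add, mul_neg, ← even_comm hFe, ← mul_assoc, ← even_comm hFe,
        ← even_comm hYe, ← mul_assoc]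
      abel
  have hcoef := coeff_eq_zero_of_forall_sum_eq_zero (N := 3) (q := fun j => match j with
      | 0 => q 1 * p 0 - q 0 * p 1 - p 0
      | 1 => (2 : ℂ) • (q 2 * p 0) - (2 : ℂ) • (q 0 * p 2) - p 1
      | _ => q 2 * p 1 - q 1 * p 2 - p 2) (fun w => by
        refine Eq.trans ?_ (sub_eq_zero.2 (hode w))
        simp only [Finset.sum_range_succ, Finset.sum_range_zero, zero_add, add_mul, mul_add,
          smul_mul_assoc, mul_smul_comm]
        module)
  have h₀ : q 1 * p 0 - q 0 * p 1 = p 0 := sub_eq_zero.1 (hcoef 0 (by norm_num))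
  have h₁ : (2 : ℂ) • (q 2 * p 0) - (2 : ℂ) • (q 0 * p 2) = p 1 :=
    sub_eq_zero.1 (hcoef 1 (by norm_num))
  have h₂ : q 2 * p 1 - q 1 * p 2 = p 2 := sub_eq_zero.1 (hcoef 2 (by norm_num))
  have hne : body (p 0) ≠ 0 ∨ body (p 2) ≠ 0 := by
    by_contra! hcon
    have hb1 : body (p 1) = 0 := by
      rw [← h₁]
      simp [hcon.1, hcon.2]
    have hX0 : ∀ w : ℂ, body (∑ j ∈ Finset.range 3, w ^ j • p j) = 0 := by
      intro w
      simp [Finset.sum_range_succ, hcon.1, hcon.2, hb1]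
    have hnS : ∀ w, w ∉ (S.B .south .south).dom := by
      intro w hw
      refine body_ne_zero_of_isUnit (S.isUnit_wderiv_f _ _ hw).ringInverse ?_
      exact (congrArg body (hX .south w hw)).trans (hX0 w)
    have hN : ∀ w, w ∈ (S.B .south .north).dom := fun w =>
      (S.cover .south w).resolve_left (hnS w)
    refine body_ne_zero_of_isUnit (S.isUnit_wderiv_f _ _ (hN 0)) ?_
    refine ((S.B .south .north).f_an 0 (hN 0)).wderiv_mem
      (LinearMap.ker (body (L := L)).toLinearMap) (.of_forall fun v => ?_)
    change body _ = 0
    by_contra h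
    exact hnS v (S.mem_south _ _ (hN v) (isUnit_of_body_ne_zero ((S.B _ _).f_even v (hN v)) h))
  obtain ⟨a, ha, b, hb, c, hc, d, hd, hdet, e₀, e₁, e₂, e₃, e₄, e₅⟩ :=
    exists_mobius hp hq h₀ h₁ h₂ hne
  refine ⟨a, ha, b, hb, c, hc, d, hd, hdet, fun β w hw => ⟨?_, ?_⟩⟩
  · rw [hX β w hw]
    simp only [Finset.sum_range_succ, Finset.sum_range_zero, e₀, e₁, e₂, add_mul, mul_add,
      smul_mul_assoc, mul_smul_comm]
    rw [even_comm hd.1 c]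
    module
  · rw [hY β w hw]
    simp only [Finset.sum_range_succ, Finset.sum_range_zero, e₃, e₄, e₅, add_mul, mul_add,
      smul_mul_assoc, mul_smul_comm]
    module

end SphereMap

theorem ipow_mul {x y : Gr L} (hx : x ∈ even L) (hu : IsUnit x) (hv : IsUnit y) (k : ℤ) :
    ipow (x * y) k = ipow x k * ipow y k := by
  obtain ⟨u, rfl⟩ := hu
  obtain ⟨v, rfl⟩ := hv
  have h : Commute u v := Units.ext (even_comm hx v)
  rw [← Units.val_mul, ipow_unit, ipow_unit, ipow_unit, h.mul_zpow, Units.val_mul]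

theorem ipow_smul {c : ℂ} (hc : c ≠ 0) {x : Gr L} (hu : IsUnit x) (k : ℤ) :
    ipow (c • x) k = c ^ k • ipow x k := by
  rw [Algebra.smul_def, ipow_mul (algebraMap_mem_even c)
    ((IsUnit.mk0 c hc).map (algebraMap ℂ (Gr L))) hu, ipow_algebraMap hc, ← Algebra.smul_def]

theorem SuperAnalyticAt.ipow {F : ℂ → Gr L} {w : ℂ} (hF : SuperAnalyticAt w F)
    (he : ∀ᶠ v in 𝓝 w, F v ∈ even L) (hu : IsUnit (F w)) (k : ℤ) :
    SuperAnalyticAt w (fun v => N2.ipow (F v) k) :=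
  (hF.pow _).mul ((hF.inverse he hu).pow _)

/-- The linear function `w ↦ w p + q` in the southern coordinate, and its homogenization in the
northern one. -/
noncomputable def lin (p q : Gr L) : Pole → ℂ → Gr L
  | .south => fun w => w • p + q
  | .north => fun u => p + u • q

theorem lin_inv (p q : Gr L) {u : ℂ} (hu : u ≠ 0) :
    lin p q .north u = u • lin p q .south u⁻¹ := by
  simp [lin, smul_smul, hu]

theorem lin_mem {W : Submodule ℂ (Gr L)} {p q : Gr L} (hp : p ∈ W) (hq : q ∈ W) (α : Pole)
    (w : ℂ) : lin p q α w ∈ W := by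
  cases α
  · exact add_mem (Submodule.smul_mem _ _ hp) hq
  · exact add_mem hp (Submodule.smul_mem _ _ hq)

theorem lin_an {p q : Gr L} (hp : p ∈ lowAlg L) (hq : q ∈ lowAlg L) (α : Pole) (w : ℂ) :
    SuperAnalyticAt w (lin p q α) := by
  cases α
  · exact .add _ _ (.smul _ _ analyticAt_id hp) (.const hq w)
  · exact .add _ _ (.const hp w) (.smul _ _ analyticAt_id hq)

namespace SphereMap

variable {n : ℤ}

/-- The even component of `S` is the Möbius transformation with coefficients `a`, `b`, `c`, `d`. -/
structure IsMobius (S : SphereMap L n) (a b c d : Gr L) : Prop where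
  ha : a ∈ lowEven L
  hb : b ∈ lowEven L
  hc : c ∈ lowEven L
  hd : d ∈ lowEven L
  det : a * d - b * c = 1
  f_south : ∀ α, ∀ w ∈ (S.B α .south).dom, (S.B α .south).f w * lin c d α w = lin a b α w
  f_north : ∀ α, ∀ w ∈ (S.B α .north).dom, (S.B α .north).f w * lin a b α w = lin c d α w
  wderiv_f : ∀ w ∈ (S.B .south .south).dom,
    Ring.inverse (wderiv (S.B .south .south).f w) = lin c d .south w * lin c d .south w

theorem body_lin_ne_zero {a b c d : Gr L} (h : a * d - b * c = 1) (α : Pole) (w : ℂ)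
    (ht : body (lin c d α w) = 0) : body (lin a b α w) ≠ 0 := by
  intro hs
  have h1 := congrArg body h
  simp only [map_sub, map_mul, map_one] at h1
  cases α <;> simp only [lin, map_add, map_smul, smul_eq_mul] at hs ht
  · exact one_ne_zero (by linear_combination -h1 + body a * ht - body c * hs)
  · exact one_ne_zero (by linear_combination -h1 - body b * ht + body d * hs)

theorem eventually_body_lin_ne_zero {a b c d : Gr L} (h : a * d - b * c = 1) (α : Pole) (w : ℂ) :
    ∀ᶠ v in 𝓝[≠] w, body (lin c d α v) ≠ 0 := by
  by_cases ht : body (lin c d α w) = 0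
  · filter_upwards [self_mem_nhdsWithin] with v hv h0
    have h1 := congrArg body h
    simp only [map_sub, map_mul, map_one] at h1
    have hvw : v - w ≠ 0 := sub_ne_zero.2 hv
    cases α <;> simp only [lin, map_add, map_smul, smul_eq_mul] at ht h0
    · have hc : body c = 0 := (mul_eq_zero.1 (show (v - w) * body c = 0 by
        linear_combination h0 - ht)).resolve_left hvw
      exact one_ne_zero (by linear_combination -h1 + body a * ht - (body a * w + body b) * hc)
    · have hd : body d = 0 := (mul_eq_zero.1 (show (v - w) * body d = 0 by
        linear_combination h0 - ht)).resolve_left hvw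
      exact one_ne_zero (by linear_combination -h1 - body b * ht + (body a + body b * w) * hd)
  · refine Filter.Eventually.filter_mono nhdsWithin_le_nhds ?_
    refine ContinuousAt.eventually_ne ?_ ht
    cases α <;> simp only [lin, map_add, map_smul, smul_eq_mul] <;> fun_prop

/-- Equalities over the southern source chart extend to the northern one. -/
theorem eq_north_of_eq_south (S : SphereMap L n) {β : Pole} {A E : Pole → ℂ → Gr L}
    (hA : ∀ u ∈ (S.B .north β).dom, SuperAnalyticAt u (A .north))
    (hE : ∀ u, SuperAnalyticAt u (E .north)) {c : ℂ} {m : ℤ}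
    (hAinv : ∀ u ≠ 0, u ∈ (S.B .north β).dom → A .north u = (c * u ^ m) • A .south u⁻¹)
    (hEinv : ∀ u ≠ 0, E .north u = (c * u ^ m) • E .south u⁻¹)
    (h : ∀ w ∈ (S.B .south β).dom, A .south w = E .south w) :
    ∀ u ∈ (S.B .north β).dom, A .north u = E .north u := by
  intro u hu
  refine ((hA u hu).eventuallyEq_of_punctured (hE u) ?_).eq_of_nhds
  have h0 : ∀ᶠ v in 𝓝[≠] u, v ≠ 0 := by
    by_cases hu0 : u = 0
    · subst hu0
      exact self_mem_nhdsWithin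
    · exact (eventually_ne_nhds hu0).filter_mono nhdsWithin_le_nhds
  filter_upwards [h0, ((S.B .north β).eventually_mem_dom hu).filter_mono nhdsWithin_le_nhds]
    with v hv0 hv
  rw [hAinv v hv0 hv, hEinv v hv0, h _ ((S.dom_inv β v hv0).1 hv)]

theorem exists_isMobius (S : SphereMap L n) : ∃ a b c d : Gr L, S.IsMobius a b c d := by
  obtain ⟨a, ha, b, hb, c, hc, d, hd, hdet, h⟩ := S.exists_mobius_south
  have hte : ∀ α w, lin c d α w ∈ even L := lin_mem hc.1 hd.1
  have hcan : ∀ {x y t : Gr L}, t ∈ even L → body t ≠ 0 → x * t = y * t → x = y :=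
    fun ht hb hxy => (isUnit_of_body_ne_zero ht hb).mul_left_injective hxy
  have hS : ∀ w ∈ (S.B .south .south).dom,
      (S.B .south .south).f w * lin c d .south w = lin a b .south w := by
    intro w hw
    obtain ⟨h1, h2⟩ := h .south w hw
    have hu : IsUnit (lin c d .south w * lin c d .south w) :=
      h1 ▸ (S.isUnit_wderiv_f .south .south hw).ringInverse
    have hb := body_ne_zero_of_isUnit hu
    rw [map_mul] at hb
    refine hcan (hte .south w) (left_ne_zero_of_mul hb) ?_
    refine Eq.trans ?_ h2
    rw [mul_assoc]
    exact congrArg _ h1.symm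
  have hN : ∀ w ∈ (S.B .south .north).dom,
      (S.B .south .north).f w * lin a b .south w = lin c d .south w := by
    intro w hw
    refine ((((S.B .south .north).f_an w hw).mul (lin_an ha.2 hb.2 .south w)).eventuallyEq_of_punctured
      (lin_an hc.2 hd.2 .south w) ?_).eq_of_nhds
    filter_upwards [eventually_body_lin_ne_zero hdet .south w,
      ((S.B .south .north).eventually_mem_dom hw).filter_mono nhdsWithin_le_nhds] with v hv hvd
    obtain ⟨h1, h2⟩ := h .north v hvd
    refine hcan (hte .south v) hv ?_
    rw [mul_assoc]
    refine Eq.trans (congrArg _ h2.symm) (Eq.trans ?_ h1)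
    simp only [pullField, pullEuler, mul_neg, mul_assoc]
  refine ⟨a, b, c, d, ha, hb, hc, hd, hdet, ?_, ?_, fun w hw => (h .south w hw).1⟩
  · rintro (_ | _)
    · exact hS
    · exact S.eq_north_of_eq_south (β := .south)
        (A := fun α w => (S.B α .south).f w * lin c d α w) (E := lin a b) (c := 1) (m := 1)
        (fun u hu => ((S.B .north .south).f_an u hu).mul (lin_an hc.2 hd.2 _ _))
        (lin_an ha.2 hb.2 _) (fun u hu hud => by
          simp only [S.f_inv _ u hu hud, lin_inv c d hu, mul_smul_comm, one_mul, zpow_one])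
        (fun u hu => by rw [lin_inv a b hu, one_mul, zpow_one]) hS
  · rintro (_ | _)
    · exact hN
    · exact S.eq_north_of_eq_south (β := .north)
        (A := fun α w => (S.B α .north).f w * lin a b α w) (E := lin c d) (c := 1) (m := 1)
        (fun u hu => ((S.B .north .north).f_an u hu).mul (lin_an ha.2 hb.2 _ _))
        (lin_an hc.2 hd.2 _) (fun u hu hud => by
          simp only [S.f_inv _ u hu hud, lin_inv a b hu, mul_smul_comm, one_mul, zpow_one])
        (fun u hu => by rw [lin_inv c d hu, one_mul, zpow_one]) hN

namespace IsMobius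

variable {S : SphereMap L n} {a b c d : Gr L} (hM : S.IsMobius a b c d)
include hM

theorem den_mem (α : Pole) (w : ℂ) : lin c d α w ∈ lowEven L := lin_mem hM.hc hM.hd α w

theorem num_mem (α : Pole) (w : ℂ) : lin a b α w ∈ lowEven L := lin_mem hM.ha hM.hb α w

theorem den_an (α : Pole) (w : ℂ) : SuperAnalyticAt w (lin c d α) := lin_an hM.hc.2 hM.hd.2 α w

theorem num_an (α : Pole) (w : ℂ) : SuperAnalyticAt w (lin a b α) := lin_an hM.ha.2 hM.hb.2 α w

theorem isUnit_den {α : Pole} {w : ℂ} (hw : w ∈ (S.B α .south).dom) : IsUnit (lin c d α w) := by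
  refine isUnit_of_body_ne_zero (hM.den_mem α w).1 fun h => body_lin_ne_zero hM.det α w h ?_
  rw [← hM.f_south α w hw, map_mul, h, mul_zero]

theorem isUnit_num {α : Pole} {w : ℂ} (hw : w ∈ (S.B α .north).dom) : IsUnit (lin a b α w) := by
  refine isUnit_of_body_ne_zero (hM.num_mem α w).1 fun h => body_lin_ne_zero hM.det α w ?_ h
  rw [← hM.f_north α w hw, map_mul, h, mul_zero]

theorem mem_dom_south_iff (α : Pole) (w : ℂ) :
    w ∈ (S.B α .south).dom ↔ IsUnit (lin c d α w) := by
  refine ⟨fun hw => hM.isUnit_den hw, fun hu => ?_⟩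
  rcases S.cover α w with hw | hw
  · exact hw
  · refine S.mem_south α w hw (isUnit_of_body_ne_zero ((S.B α .north).f_even w hw) fun h => ?_)
    refine body_ne_zero_of_isUnit hu ?_
    rw [← hM.f_north α w hw, map_mul, h, zero_mul]

theorem eventually_mem_dom (α : Pole) (w : ℂ) : ∀ᶠ v in 𝓝[≠] w, v ∈ (S.B α .south).dom :=
  (eventually_body_lin_ne_zero hM.det α w).mono fun v hv =>
    (hM.mem_dom_south_iff α v).2 (isUnit_of_body_ne_zero (hM.den_mem α v).1 hv)

theorem f_eq {w : ℂ} (hw : w ∈ (S.B .south .south).dom) :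
    (S.B .south .south).f w = lin a b .south w * Ring.inverse (lin c d .south w) := by
  rw [← hM.f_south _ w hw, mul_assoc, Ring.mul_inverse_cancel _ (hM.isUnit_den hw), mul_one]

theorem wderiv_f_mul {w : ℂ} (hw : w ∈ (S.B .south .south).dom) :
    wderiv (S.B .south .south).f w * (lin c d .south w * lin c d .south w) = 1 := by
  rw [← hM.wderiv_f w hw, Ring.mul_inverse_cancel _ (S.isUnit_wderiv_f _ _ hw)]

theorem ipow_f_mul {α : Pole} {w : ℂ} (hw : w ∈ (S.B α .south).dom)
    (hw' : w ∈ (S.B α .north).dom) (k : ℤ) :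
    ipow ((S.B α .north).f w) (-k) * ipow (lin c d α w) k = ipow (lin a b α w) k := by
  have hf := S.isUnit_f α w hw hw'
  rw [← hM.f_north α w hw', ipow_mul ((S.B α .north).f_even w hw') hf (hM.isUnit_num hw'),
    ← mul_assoc, ipow_mul_ipow hf, neg_add_cancel, ipow_zero, one_mul]

/-- A field of weight `k` in the target and `j` in the source is a polynomial of degree `k + j`
divided by `(cz + d)ᵏ`. -/
theorem exists_sum_of_weight {φ : Pole → Pole → ℂ → Gr L} {k j : ℤ} {e : ℂ} (he : e ≠ 0)
    (han : ∀ α β, ∀ w ∈ (S.B α β).dom, SuperAnalyticAt w (φ α β))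
    (hglue : ∀ α, ∀ w ∈ (S.B α .south).dom, w ∈ (S.B α .north).dom →
      φ α .south w = Complex.I • (φ α .north w * ipow ((S.B α .north).f w) (-k)))
    (hinv : ∀ β u, u ≠ 0 → u ∈ (S.B .north β).dom → φ .north β u = (e * u ^ j) • φ .south β u⁻¹)
    (W : Submodule ℂ (Gr L)) (hWmul : ∀ x ∈ W, ∀ y ∈ even L, x * y ∈ W)
    (hW : ∀ β, ∀ w ∈ (S.B .south β).dom, φ .south β w ∈ W) :
    ∃ p : ℕ → Gr L, (∀ i, p i ∈ W ⊓ Subalgebra.toSubmodule (lowAlg L)) ∧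
      (∀ w ∈ (S.B .south .south).dom, φ .south .south w * ipow (lin c d .south w) k
        = ∑ i ∈ Finset.range (k + j + 1).toNat, w ^ i • p i) ∧
      ∀ w ∈ (S.B .south .north).dom, Complex.I • (φ .south .north w * ipow (lin a b .south w) k)
        = ∑ i ∈ Finset.range (k + j + 1).toNat, w ^ i • p i := by
  let A : Pole → Pole → ℂ → Gr L := fun α β => match β with
    | .south => fun w => φ α .south w * ipow (lin c d α w) k
    | .north => fun w => Complex.I • (φ α .north w * ipow (lin a b α w) k)
  suffices ∃ p : ℕ → Gr L, (∀ i, p i ∈ W ⊓ Subalgebra.toSubmodule (lowAlg L)) ∧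
      ∀ β, ∀ w ∈ (S.B .south β).dom, A .south β w
        = ∑ i ∈ Finset.range (k + j + 1).toNat, w ^ i • p i by
    obtain ⟨p, hp, h⟩ := this
    exact ⟨p, hp, h .south, h .north⟩
  refine S.exists_sum_of_section (A := A) (c := e) ?_ ?_ he (k + j) ?_ W ?_
  · rintro α (_ | _) w hw
    · exact (han α _ w hw).mul ((hM.den_an α w).ipow (.of_forall fun v => (hM.den_mem α v).1)
        (hM.isUnit_den hw) k)
    · exact .csmul analyticAt_const ((han α _ w hw).mul ((hM.num_an α w).ipow
        (.of_forall fun v => (hM.num_mem α v).1) (hM.isUnit_num hw) k))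
  · intro α w hw hw'
    simp only [A]
    rw [hglue α w hw hw', smul_mul_assoc, mul_assoc, hM.ipow_f_mul hw hw']
  · rintro (_ | _) u hu hud
    · have h1 := hM.isUnit_den ((S.dom_inv _ u hu).1 hud)
      simp only [A]
      rw [hinv _ u hu hud, lin_inv c d hu, ipow_smul hu h1, smul_mul_smul_comm, zpow_add₀ hu]
      congr 1
      ring
    · have h1 := hM.isUnit_num ((S.dom_inv _ u hu).1 hud)
      simp only [A]
      rw [hinv _ u hu hud, lin_inv a b hu, ipow_smul hu h1, smul_mul_smul_comm, zpow_add₀ hu,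
        smul_smul, smul_smul]
      congr 1
      ring
  · rintro (_ | _) w hw
    · exact hWmul _ (hW _ w hw) _ (ipow_mem_even (hM.den_mem _ w).1 k)
    · exact Submodule.smul_mem _ _ (hWmul _ (hW _ w hw) _ (ipow_mem_even (hM.num_mem _ w).1 k))

end IsMobius

end SphereMap

/-! ### Spheres of index zero -/

theorem eq_of_cubic {R : Type*} [CommRing R] {a b c d k₀ k₁ a₀ a₁ α β γ : R}
    (hdet : a * d - b * c = 1) (hα : α * α = 0) (hβ : β * β = 0) (hαγ : α * γ = 0)
    (hβγ : β * γ = 0) (hγ : γ * γ = -2 * α * β)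
    (e₃ : k₁ * (a * c + α) = a₁ * (c * c))
    (e₂ : k₀ * (a * c + α) + k₁ * (a * d + b * c + γ) = a₀ * (c * c) + a₁ * (2 * c * d))
    (e₁ : k₀ * (a * d + b * c + γ) + k₁ * (b * d + β) = a₀ * (2 * c * d) + a₁ * (d * d))
    (e₀ : k₀ * (b * d + β) = a₀ * (d * d)) :
    ∃ ε, k₁ = ε * (c - d * α) ∧ k₀ = ε * (d + c * β - d * γ - α * β * d) := by
  set q₂ := α * d ^ 2 - γ * d * c + β * c ^ 2 with hq₂
  set q₁ := -2 * α * b * d + γ * (a * d + b * c) - 2 * β * a * c with hq₁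
  set q₀ := α * b ^ 2 - γ * a * b + β * a ^ 2 with hq₀
  set s := d * k₁ - c * k₀ with hs
  set t := a * k₀ - b * k₁ with ht
  have f₁ : s * q₂ = 0 := by
    rw [hs, hq₂]
    linear_combination d ^ 3 * e₃ - d ^ 2 * c * e₂ + d * c ^ 2 * e₁ - c ^ 3 * e₀
  have f₂ : s * (1 + q₁) + t * q₂ = 0 := by
    rw [hs, ht, hq₂, hq₁]
    linear_combination (-3 * d ^ 2 * b) * e₃ + (d ^ 2 * a + 2 * d * b * c) * e₂
      + (-2 * a * c * d - b * c ^ 2) * e₁ + (3 * a * c ^ 2) * e₀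
      - (d * k₁ - c * k₀) * (a * d - b * c + 1) * hdet
  have f₃ : q₁ * q₂ = 0 := by
    rw [hq₁, hq₂]
    linear_combination (-2 * b * d ^ 3) * hα + (2 * b * c * d ^ 2 + (a * d + b * c) * d ^ 2) * hαγ
      - (a * d + b * c) * d * c * hγ + ((a * d + b * c) * c ^ 2 + 2 * a * c ^ 2 * d) * hβγ
      - 2 * a * c ^ 3 * hβ
  have f₄ : q₁ * q₁ = -2 * (q₀ * q₂) := by
    rw [hq₁, hq₂, hq₀]
    linear_combination 6 * b ^ 2 * d ^ 2 * hα - 6 * b * d * (a * d + b * c) * hαγ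
      + ((a * d + b * c) ^ 2 + 2 * a * b * c * d) * hγ - 6 * a * c * (a * d + b * c) * hβγ
      + 6 * a ^ 2 * c ^ 2 * hβ
  have f₅ : s = -(t * q₂) := by
    linear_combination f₂ - q₁ * f₂ + s * f₄ + t * f₃ - 2 * q₀ * f₁
  have g₁ : k₁ = t * (c - a * q₂) := by
    rw [hs, ht] at f₅
    rw [ht]
    linear_combination a * f₅ - k₁ * hdet
  have g₀ : k₀ = t * (d - b * q₂) := by
    rw [hs, ht] at f₅
    rw [ht]
    linear_combination b * f₅ - k₀ * hdet
  refine ⟨t * (1 - α * b * d + γ * a * d - β * a * c - α * β * a * d), ?_, ?_⟩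
  · rw [mul_assoc]
    refine g₁.trans (congrArg _ ?_)
    rw [hq₂]
    linear_combination -(α * d * hdet) - (b * d ^ 2 + β * a * d ^ 2) * hα + a * d ^ 2 * hαγ
  · rw [mul_assoc]
    refine g₀.trans (congrArg _ ?_)
    rw [hq₂]
    linear_combination -(d * γ - c * β + α * β * d) * hdet - b * d ^ 2 * hαγ
      - (β * b * d ^ 2 + β ^ 2 * a * d ^ 2) * hα - 2 * a * c * d * hβγ + a * d ^ 2 * hγ
      + a * c ^ 2 * hβ

theorem mul_eq_of_numerators {R : Type*} [CommRing R] {c d w α β γ : R}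
    (hα : α * α = 0) (hβ : β * β = 0) (hαγ : α * γ = 0)
    (hβγ : β * γ = 0) (hγ : γ * γ = -2 * α * β) :
    (w * c + d + c * β - d * (w * α + γ) - α * β * d)
      * (w * c + d - c * β + d * (w * α + γ) - α * β * d) = (w * c + d) * (w * c + d) := by
  linear_combination (-d ^ 2 * w ^ 2 + β ^ 2 * d ^ 2) * hα - c ^ 2 * hβ - 2 * d ^ 2 * w * hαγ
    + 2 * c * d * hβγ - d ^ 2 * hγ

theorem product_relations {p₁ p₀ q₁ q₀ : Gr L} (hp₁ : p₁ ∈ odd L) (hp₀ : p₀ ∈ odd L)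
    (hq₁ : q₁ ∈ odd L) (hq₀ : q₀ ∈ odd L) :
    p₁ * q₁ * (p₁ * q₁) = 0 ∧ p₀ * q₀ * (p₀ * q₀) = 0 ∧ p₁ * q₁ * (p₁ * q₀ + p₀ * q₁) = 0 ∧
    p₀ * q₀ * (p₁ * q₀ + p₀ * q₁) = 0 ∧
    (p₁ * q₀ + p₀ * q₁) * (p₁ * q₀ + p₀ * q₁) = -(p₁ * q₁ * (p₀ * q₀)) - p₁ * q₁ * (p₀ * q₀) := by
  have h1 : ∀ {x : Gr L}, x ∈ odd L → ∀ y z, x * y * (x * z) = 0 := fun hx y z => by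
    rw [← mul_assoc, odd_mul_mul_self hx, zero_mul]
  have h2 : ∀ {y : Gr L}, y ∈ odd L → ∀ x z, x * y * (z * y) = 0 := fun hy x z => by
    rw [mul_assoc, ← mul_assoc _ z, odd_mul_mul_self hy, mul_zero]
  refine ⟨h1 hp₁ _ _, h1 hp₀ _ _, ?_, ?_, ?_⟩
  · rw [mul_add, h1 hp₁, h2 hq₁, add_zero]
  · rw [mul_add, h1 hp₀, h2 hq₀, add_zero]
  · have e1 : p₁ * q₀ * (p₀ * q₁) = -(p₁ * q₁ * (p₀ * q₀)) := by
      rw [mul_assoc, ← mul_assoc q₀, even_comm (odd_mul_odd_mem hq₀ hp₀), odd_anticomm hq₀ hp₀]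
      noncomm_ring
    have e2 : p₀ * q₁ * (p₁ * q₀) = -(p₁ * q₁ * (p₀ * q₀)) := by
      rw [mul_assoc, ← mul_assoc q₁, ← mul_assoc, ← even_comm (odd_mul_odd_mem hq₁ hp₁),
        odd_anticomm hq₁ hp₁]
      noncomm_ring
    rw [mul_add, add_mul, add_mul, h1 hp₁, h1 hp₀, e1, e2]
    abel

namespace SphereMap

namespace IsMobius

theorem exists_lin_of_zero {S : SphereMap L 0} {a b c d : Gr L} (hM : S.IsMobius a b c d)
    {φ : Pole → Pole → ℂ → Gr L} (han : ∀ α β, ∀ w ∈ (S.B α β).dom, SuperAnalyticAt w (φ α β))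
    (hodd : ∀ α β, ∀ w ∈ (S.B α β).dom, φ α β w ∈ odd L)
    (hglue : ∀ α, ∀ w ∈ (S.B α .south).dom, w ∈ (S.B α .north).dom →
      φ α .south w = Complex.I • (φ α .north w * ipow ((S.B α .north).f w) (-1)))
    (hinv : ∀ β u, u ≠ 0 → u ∈ (S.B .north β).dom → φ .north β u = φ .south β u⁻¹) :
    ∃ p₁ ∈ lowOdd L, ∃ p₀ ∈ lowOdd L,
      (∀ α, ∀ w ∈ (S.B α .south).dom, φ α .south w * lin c d α w = lin p₁ p₀ α w) ∧
      ∀ α, ∀ w ∈ (S.B α .north).dom,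
        Complex.I • (φ α .north w * lin a b α w) = lin p₁ p₀ α w := by
  obtain ⟨p, hp, hS, hN⟩ := hM.exists_sum_of_weight (k := 1) (j := 0) one_ne_zero han hglue
    (fun β u hu hud => by rw [hinv β u hu hud, one_mul, zpow_zero, one_smul]) (odd L)
    (fun x hx y hy => odd_mul_even_mem hx hy) fun β w hw => hodd _ β w hw
  have hs : ∀ w : ℂ, ∑ i ∈ Finset.range ((1 : ℤ) + 0 + 1).toNat, w ^ i • p i
      = lin (p 1) (p 0) .south w := by
    intro w
    rw [show ((1 : ℤ) + 0 + 1).toNat = 2 from rfl]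
    simp [Finset.sum_range_succ, lin, add_comm]
  simp only [hs, ipow_one] at hS hN
  refine ⟨p 1, hp 1, p 0, hp 0, ?_, ?_⟩
  · rintro (_ | _)
    · exact hS
    · refine S.eq_north_of_eq_south (β := .south) (A := fun α w => φ α .south w * lin c d α w)
        (E := lin (p 1) (p 0)) (c := 1) (m := 1) (fun u hu => (han _ _ u hu).mul (hM.den_an _ u))
        (lin_an (hp 1).2 (hp 0).2 _) (fun u hu hud => ?_) (fun u hu => ?_) hS
      · simp only [hinv _ u hu hud, lin_inv c d hu, mul_smul_comm, one_mul, zpow_one]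
      · rw [lin_inv _ _ hu, one_mul, zpow_one]
  · rintro (_ | _)
    · exact hN
    · refine S.eq_north_of_eq_south (β := .north)
        (A := fun α w => Complex.I • (φ α .north w * lin a b α w))
        (E := lin (p 1) (p 0)) (c := 1) (m := 1)
        (fun u hu => .csmul analyticAt_const ((han _ _ u hu).mul (hM.num_an _ u)))
        (lin_an (hp 1).2 (hp 0).2 _) (fun u hu hud => ?_) (fun u hu => ?_) hN
      · simp only [hinv _ u hu hud, lin_inv a b hu, mul_smul_comm, one_mul, zpow_one]
        rw [smul_comm]
      · rw [lin_inv _ _ hu, one_mul, zpow_one]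

theorem glue_relations {R : Type*} [CommRing R] {F e g x s t : R} (hF : F * s = t)
    (he : e * (F * F) = 1) (hx : x * x = 0) :
    g * e * (F + x) * (t * t) = g * (s * t + x * (s * s)) ∧
    g * e * (F + x) * (s * t - x * (s * s)) = g * (s * s) := by
  subst hF
  constructor
  · linear_combination (g * s * s * (F + x)) * he
  · linear_combination (g * s * s) * he - (g * e * s * s) * hx

theorem exists_numerator_of_zero {S : SphereMap L 0} {a b c d : Gr L} (hM : S.IsMobius a b c d)
    {g φ φ' : Pole → Pole → ℂ → Gr L} {p₁ p₀ q₁ q₀ : Gr L}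
    (han : ∀ α β, ∀ w ∈ (S.B α β).dom, SuperAnalyticAt w (g α β))
    (heven : ∀ α β, ∀ w ∈ (S.B α β).dom, g α β w ∈ even L)
    (hglue : ∀ α, ∀ w ∈ (S.B α .south).dom, w ∈ (S.B α .north).dom →
      g α .south w = Complex.I • (g α .north w * ipow ((S.B α .north).f w) (-2)
        * ((S.B α .north).f w + φ α .north w * φ' α .north w)))
    (hinv : ∀ β u, u ≠ 0 → u ∈ (S.B .north β).dom →
      g .north β u = (Complex.I * u ^ (-1 : ℤ)) • g .south β u⁻¹)
    (hp₁ : p₁ ∈ lowOdd L) (hp₀ : p₀ ∈ lowOdd L) (hq₁ : q₁ ∈ lowOdd L) (hq₀ : q₀ ∈ lowOdd L)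
    (hφodd : ∀ α, ∀ w ∈ (S.B α .north).dom, φ α .north w ∈ lowOdd L)
    (hφ'odd : ∀ α, ∀ w ∈ (S.B α .north).dom, φ' α .north w ∈ lowOdd L)
    (hφ : ∀ α, ∀ w ∈ (S.B α .north).dom,
      Complex.I • (φ α .north w * lin a b α w) = lin p₁ p₀ α w)
    (hφ' : ∀ α, ∀ w ∈ (S.B α .north).dom,
      Complex.I • (φ' α .north w * lin a b α w) = lin q₁ q₀ α w) :
    ∃ ε ∈ lowEven L, ∀ w ∈ (S.B .south .south).dom,
      g .south .south w * (lin c d .south w * lin c d .south w)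
        = ε * (lin c d .south w + c * (p₀ * q₀) - d * (w • (p₁ * q₁) + (p₁ * q₀ + p₀ * q₁))
          - p₁ * q₁ * (p₀ * q₀) * d) := by
  let Q : Pole → ℂ → Gr L := fun α w => lin p₁ p₀ α w * lin q₁ q₀ α w
  have hpo : ∀ α w, lin p₁ p₀ α w ∈ lowOdd L := lin_mem hp₁ hp₀
  have hqo : ∀ α w, lin q₁ q₀ α w ∈ lowOdd L := lin_mem hq₁ hq₀
  have hQ : ∀ α w, Q α w ∈ lowEven L := fun α w => lowOdd_mul (hpo α w) (hqo α w)
  have hQan : ∀ α w, SuperAnalyticAt w (Q α) := fun α w =>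
    (lin_an hp₁.2 hp₀.2 α w).mul (lin_an hq₁.2 hq₀.2 α w)
  have hQQ : ∀ α w, Q α w * Q α w = 0 := fun α w => by
    simp only [Q]
    rw [← mul_assoc, odd_mul_mul_self (hpo α w).1, zero_mul]
  have hQN : ∀ α, ∀ w ∈ (S.B α .north).dom, Q α w
      = -(φ α .north w * φ' α .north w * (lin a b α w * lin a b α w)) := by
    intro α w hw
    simp only [Q]
    rw [← hφ α w hw, ← hφ' α w hw, smul_mul_smul_comm, Complex.I_mul_I, neg_one_smul,
      (even_commute (hM.num_mem α w).1 _).mul_mul_mul_comm]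
  have hglow : ∀ α β, ∀ w ∈ (S.B α β).dom, g α β w ∈ lowEven L := fun α β w hw =>
    ⟨heven α β w hw, (han α β w hw).mem_lowAlg⟩
  have hrel : ∀ α, ∀ w ∈ (S.B α .south).dom, w ∈ (S.B α .north).dom →
      g α .south w * (lin c d α w * lin c d α w)
        = Complex.I • (g α .north w * (lin a b α w * lin c d α w - Q α w)) ∧
      g α .south w * (lin a b α w * lin c d α w + Q α w)
        = Complex.I • (g α .north w * (lin a b α w * lin a b α w)) := by
    intro α w hw hw'
    have hfu := S.isUnit_f α w hw hw'
    have hX : φ α .north w * φ' α .north w ∈ lowEven L :=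
      lowOdd_mul (hφodd α w hw') (hφ'odd α w hw')
    have he : ipow ((S.B α .north).f w) (-2) * ((S.B α .north).f w * (S.B α .north).f w) = 1 := by
      have := ipow_mul_ipow hfu (-2) 2
      rwa [show (2 : ℤ) = ((2 : ℕ) : ℤ) from rfl, ipow_natCast, pow_two, neg_add_cancel,
        ipow_zero] at this
    have hxx : φ α .north w * φ' α .north w * (φ α .north w * φ' α .north w) = 0 := by
      rw [← mul_assoc, odd_mul_mul_self (hφodd α w hw').1, zero_mul]
    have := glue_relations (R := lowEvenAlg L) (F := ⟨_, S.f_lowEven α .north hw'⟩)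
      (e := ⟨_, ipow_mem_lowEven (S.f_lowEven α .north hw') (-2)⟩)
      (g := ⟨_, hglow α .north w hw'⟩) (x := ⟨_, hX⟩) (s := ⟨_, hM.num_mem α w⟩)
      (t := ⟨_, hM.den_mem α w⟩) (Subtype.ext (hM.f_north α w hw')) (Subtype.ext he)
      (Subtype.ext hxx)
    have h1 := congrArg Subtype.val this.1
    have h2 := congrArg Subtype.val this.2
    rw [hglue α w hw hw', smul_mul_assoc, smul_mul_assoc, hQN α w hw', sub_neg_eq_add,
      ← sub_eq_add_neg]
    exact ⟨congrArg _ h1, congrArg _ h2⟩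
  let A : Pole → Pole → ℂ → Gr L := fun α β => match β with
    | .south => fun w => g α .south w * (lin c d α w * lin c d α w)
    | .north => fun w => Complex.I • (g α .north w * (lin a b α w * lin c d α w - Q α w))
  let A' : Pole → Pole → ℂ → Gr L := fun α β => match β with
    | .south => fun w => g α .south w * (lin a b α w * lin c d α w + Q α w)
    | .north => fun w => Complex.I • (g α .north w * (lin a b α w * lin a b α w))
  have hQinv : ∀ u ≠ 0, Q .north u = (u * u) • Q .south u⁻¹ := fun u hu => by
    simp only [Q]
    rw [lin_inv _ _ hu, lin_inv _ _ hu, smul_mul_smul_comm]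
  have hsc : ∀ u : ℂ, u ≠ 0 → Complex.I * u ^ (-1 : ℤ) * (u * u) = Complex.I * u ^ (1 : ℤ) := by
    intro u hu
    rw [zpow_neg_one, zpow_one]
    field_simp
  have hA : ∃ p : ℕ → Gr L, (∀ j, p j ∈ even L ⊓ Subalgebra.toSubmodule (lowAlg L)) ∧
      ∀ β, ∀ w ∈ (S.B .south β).dom,
        A .south β w = ∑ j ∈ Finset.range ((1 : ℤ) + 1).toNat, w ^ j • p j := by
    refine S.exists_sum_of_section ?_ (fun α w hw hw' => (hrel α w hw hw').1) Complex.I_ne_zero 1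
      ?_ _ ?_
    · rintro α (_ | _) w hw
      · exact (han α _ w hw).mul ((hM.den_an α w).mul (hM.den_an α w))
      · exact .csmul analyticAt_const ((han α _ w hw).mul
          (((hM.num_an α w).mul (hM.den_an α w)).sub (hQan α w)))
    · rintro (_ | _) u hu hud
      · simp only [A]
        rw [hinv _ u hu hud, lin_inv c d hu, smul_mul_smul_comm, smul_mul_smul_comm, hsc u hu]
      · simp only [A]
        rw [hinv _ u hu hud, lin_inv a b hu, lin_inv c d hu, smul_mul_smul_comm, hQinv u hu,
          ← smul_sub, smul_mul_smul_comm, hsc u hu, smul_comm]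
    · rintro (_ | _) w hw
      · exact even_mul_mem (heven _ _ w hw) (even_mul_mem (hM.den_mem _ w).1 (hM.den_mem _ w).1)
      · exact Submodule.smul_mem _ _ (even_mul_mem (heven _ _ w hw)
          (sub_mem (even_mul_mem (hM.num_mem _ w).1 (hM.den_mem _ w).1) (hQ _ w).1))
  have hA' : ∃ p : ℕ → Gr L, (∀ j, p j ∈ even L ⊓ Subalgebra.toSubmodule (lowAlg L)) ∧
      ∀ β, ∀ w ∈ (S.B .south β).dom,
        A' .south β w = ∑ j ∈ Finset.range ((1 : ℤ) + 1).toNat, w ^ j • p j := by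
    refine S.exists_sum_of_section ?_ (fun α w hw hw' => (hrel α w hw hw').2) Complex.I_ne_zero 1
      ?_ _ ?_
    · rintro α (_ | _) w hw
      · exact (han α _ w hw).mul (.add _ _ ((hM.num_an α w).mul (hM.den_an α w)) (hQan α w))
      · exact .csmul analyticAt_const ((han α _ w hw).mul ((hM.num_an α w).mul (hM.num_an α w)))
    · rintro (_ | _) u hu hud
      · simp only [A']
        rw [hinv _ u hu hud, lin_inv a b hu, lin_inv c d hu, smul_mul_smul_comm, hQinv u hu,
          ← smul_add, smul_mul_smul_comm, hsc u hu]
      · simp only [A']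
        rw [hinv _ u hu hud, lin_inv a b hu, smul_mul_smul_comm, smul_mul_smul_comm, hsc u hu,
          smul_comm]
    · rintro (_ | _) w hw
      · exact even_mul_mem (heven _ _ w hw)
          (add_mem (even_mul_mem (hM.num_mem _ w).1 (hM.den_mem _ w).1) (hQ _ w).1)
      · exact Submodule.smul_mem _ _ (even_mul_mem (heven _ _ w hw)
          (even_mul_mem (hM.num_mem _ w).1 (hM.num_mem _ w).1))
  obtain ⟨k, hk, hK⟩ := hA
  obtain ⟨k', hk', hK'⟩ := hA'
  have hsum : ∀ (q : ℕ → Gr L) (w : ℂ), ∑ j ∈ Finset.range ((1 : ℤ) + 1).toNat, w ^ j • q j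
      = q 0 + w • q 1 := by
    intro q w
    rw [show ((1 : ℤ) + 1).toNat = 2 from rfl]
    simp [Finset.sum_range_succ]
  simp only [hsum] at hK hK'
  have hmain : ∀ w, (k 0 + w • k 1) * (lin a b .south w * lin c d .south w + Q .south w)
      = (k' 0 + w • k' 1) * (lin c d .south w * lin c d .south w) := by
    intro w
    rcases S.cover .south w with hw | hw
    · rw [← hK _ w hw, ← hK' _ w hw]
      simp only [A, A']
      rw [mul_assoc, even_comm (even_mul_mem (hM.den_mem _ w).1 (hM.den_mem _ w).1)
        (lin a b .south w * lin c d .south w + Q .south w), ← mul_assoc]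
    · rw [← hK _ w hw, ← hK' _ w hw]
      simp only [A, A']
      rw [smul_mul_assoc, smul_mul_assoc, mul_assoc, mul_assoc]
      congr 2
      have : ∀ s t q : lowEvenAlg L, q * q = 0 → (s * t - q) * (s * t + q) = s * s * (t * t) := by
        intro s t q h
        linear_combination -h
      exact congrArg Subtype.val (this ⟨_, hM.num_mem .south w⟩ ⟨_, hM.den_mem .south w⟩
        ⟨_, hQ .south w⟩ (Subtype.ext (hQQ .south w)))
  have hcoef := coeff_eq_zero_of_forall_sum_eq_zero (N := 4) (q := fun j => match j with
      | 0 => k 0 * (b * d + p₀ * q₀) - k' 0 * (d * d)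
      | 1 => k 0 * (a * d + b * c + (p₁ * q₀ + p₀ * q₁)) + k 1 * (b * d + p₀ * q₀)
          - (k' 0 * ((2 : ℂ) • (c * d)) + k' 1 * (d * d))
      | 2 => k 0 * (a * c + p₁ * q₁) + k 1 * (a * d + b * c + (p₁ * q₀ + p₀ * q₁))
          - (k' 0 * (c * c) + k' 1 * ((2 : ℂ) • (c * d)))
      | _ => k 1 * (a * c + p₁ * q₁) - k' 1 * (c * c)) (fun w => by
        refine Eq.trans ?_ (sub_eq_zero.2 (hmain w))
        simp only [Finset.sum_range_succ, Finset.sum_range_zero, zero_add, lin, Q, add_mul,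
          mul_add, smul_mul_assoc, mul_smul_comm]
        rw [even_comm hM.hd.1 c]
        module)
  have h₀ := hcoef 0 (by norm_num)
  have h₁ := hcoef 1 (by norm_num)
  have h₂ := hcoef 2 (by norm_num)
  have h₃ := hcoef 3 (by norm_num)
  have hα := lowOdd_mul hp₁ hq₁
  have hβ := lowOdd_mul hp₀ hq₀
  have hγ : p₁ * q₀ + p₀ * q₁ ∈ lowEven L := add_mem (lowOdd_mul hp₁ hq₀) (lowOdd_mul hp₀ hq₁)
  obtain ⟨r₁, r₂, r₃, r₄, r₅⟩ := product_relations hp₁.1 hp₀.1 hq₁.1 hq₀.1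
  have two : ∀ x y : lowEvenAlg L, ((2 * x * y : lowEvenAlg L) : Gr L) = (2 : ℂ) • ((x : Gr L) * y) := by
    intro x y
    rw [mul_assoc, two_mul, two_smul]
    rfl
  let x : lowEvenAlg L := ⟨_, hα⟩
  let y : lowEvenAlg L := ⟨_, hβ⟩
  let z : lowEvenAlg L := ⟨_, hγ⟩
  let C : lowEvenAlg L := ⟨_, hM.hc⟩
  let D : lowEvenAlg L := ⟨_, hM.hd⟩
  have h5 : z * z = -2 * x * y := by
    have : z * z = -(x * y) - x * y := Subtype.ext r₅
    rw [this]
    ring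
  obtain ⟨ε, g₁, g₀⟩ := eq_of_cubic (R := lowEvenAlg L) (a := ⟨a, hM.ha⟩) (b := ⟨b, hM.hb⟩)
    (c := C) (d := D) (k₀ := ⟨k 0, hk 0⟩) (k₁ := ⟨k 1, hk 1⟩) (a₀ := ⟨k' 0, hk' 0⟩)
    (a₁ := ⟨k' 1, hk' 1⟩) (α := x) (β := y) (γ := z) (Subtype.ext hM.det) (Subtype.ext r₁)
    (Subtype.ext r₂) (Subtype.ext r₃) (Subtype.ext r₄) h5 (Subtype.ext (sub_eq_zero.1 h₃))
    (Subtype.ext (by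
      simp only [Subalgebra.coe_add, Subalgebra.coe_mul, two]
      exact sub_eq_zero.1 h₂))
    (Subtype.ext (by
      simp only [Subalgebra.coe_add, Subalgebra.coe_mul, two]
      exact sub_eq_zero.1 h₁)) (Subtype.ext (sub_eq_zero.1 h₀))
  have g₁' : k 1 = ε * (c - d * (p₁ * q₁)) := congrArg Subtype.val g₁
  have g₀' : k 0 = ε * (d + c * (p₀ * q₀) - d * (p₁ * q₀ + p₀ * q₁) - p₁ * q₁ * (p₀ * q₀) * d) :=
    congrArg Subtype.val g₀
  refine ⟨ε, ε.2, fun w hw => ?_⟩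
  refine (hK .south w hw).trans ?_
  rw [g₁', g₀', ← mul_smul_comm, ← mul_add]
  congr 1
  simp only [lin, mul_add, smul_sub, mul_smul_comm]
  abel

end IsMobius

end SphereMap

theorem hasWeakDerivAt_lin (p q : Gr L) (w : ℂ) : HasWeakDerivAt (lin p q .south) p w := by
  have := (HasWeakDerivAt.smul (hasDerivAt_id w) (.const p w)).add (.const q w)
  simpa [lin] using this

theorem SuperAnalyticAt.wderiv_mul_lin_add {φ : ℂ → Gr L} {c d p₁ p₀ : Gr L} {w : ℂ}
    (han : SuperAnalyticAt w φ)
    (h : ∀ᶠ v in 𝓝 w, φ v * lin c d .south v = lin p₁ p₀ .south v) :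
    N2.wderiv φ w * lin c d .south w + φ w * c = p₁ :=
  (han.hasWeakDerivAt_mul han.hasWeakDerivAt (hasWeakDerivAt_lin c d w)).unique
    ((hasWeakDerivAt_lin p₁ p₀ w).congr (h.mono fun _ hv => hv.symm))

/-- The map with the two odd directions exchanged. -/
noncomputable def BodyMap.swap (B : BodyMap L) : BodyMap L where
  dom := B.dom
  f := B.f
  gp := B.gm
  gm := B.gp
  ψp := B.ψm
  ψm := B.ψp
  isOpen := B.isOpen
  f_an := B.f_an
  gp_an := B.gm_an
  gm_an := B.gp_an
  ψp_an := B.ψm_an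
  ψm_an := B.ψp_an
  f_even := B.f_even
  gp_even := B.gm_even
  gm_even := B.gp_even
  ψp_odd := B.ψm_odd
  ψm_odd := B.ψp_odd
  cond w hw := by
    have h1 : wderiv B.ψp w ∈ odd L := (B.ψp_an w hw).wderiv_mem _
      ((B.eventually_mem_dom hw).mono fun v hv => B.ψp_odd v hv)
    have h2 : wderiv B.ψm w ∈ odd L := (B.ψm_an w hw).wderiv_mem _
      ((B.eventually_mem_dom hw).mono fun v hv => B.ψm_odd v hv)
    rw [B.cond w hw, odd_anticomm h1 (B.ψm_odd w hw), odd_anticomm (B.ψp_odd w hw) h2,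
      even_comm (B.gp_even w hw)]
    abel

namespace SphereMap

variable {n : ℤ}

/-- The map with the two odd directions exchanged. -/
noncomputable def swap (S : SphereMap L n) : SphereMap L (-n) where
  B α β := (S.B α β).swap
  cover := S.cover
  isUnit_gp := S.isUnit_gm
  isUnit_gm := S.isUnit_gp
  isUnit_f := S.isUnit_f
  f_rel := S.f_rel
  mem_south := S.mem_south
  mem_north := S.mem_north
  ψp_rel := S.ψm_rel
  ψm_rel := by simp only [neg_neg]; exact S.ψp_rel
  gp_rel := S.gm_rel
  gm_rel := by simp only [neg_neg]; exact S.gp_rel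
  dom_inv := S.dom_inv
  f_inv := S.f_inv
  ψp_inv := S.ψm_inv
  ψm_inv := S.ψp_inv
  gp_inv := S.gm_inv
  gm_inv := by simp only [neg_neg]; exact S.gp_inv

namespace IsMobius

theorem swap {S : SphereMap L n} {a b c d : Gr L} (hM : S.IsMobius a b c d) :
    S.swap.IsMobius a b c d where
  ha := hM.ha
  hb := hM.hb
  hc := hM.hc
  hd := hM.hd
  det := hM.det
  f_south := hM.f_south
  f_north := hM.f_north
  wderiv_f := hM.wderiv_f

/-- The components of an automorphism of the sphere of index zero. -/
theorem exists_components_zero {S : SphereMap L 0} {a b c d : Gr L} (hM : S.IsMobius a b c d) :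
    ∃ p₁ ∈ lowOdd L, ∃ p₀ ∈ lowOdd L, ∃ q₁ ∈ lowOdd L, ∃ q₀ ∈ lowOdd L,
    ∃ εp ∈ lowEven L, ∃ εm ∈ lowEven L, IsUnit εp ∧ IsUnit εm ∧
      εp * εm = 1 - p₁ * q₀ - q₁ * p₀ ∧
      ∀ w ∈ (S.B .south .south).dom,
        (S.B .south .south).ψp w * lin c d .south w = lin p₁ p₀ .south w ∧
        (S.B .south .south).ψm w * lin c d .south w = lin q₁ q₀ .south w ∧
        (S.B .south .south).gp w * (lin c d .south w * lin c d .south w)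
          = εp * (lin c d .south w + c * (p₀ * q₀) - d * (w • (p₁ * q₁) + (p₁ * q₀ + p₀ * q₁))
            - p₁ * q₁ * (p₀ * q₀) * d) ∧
        (S.B .south .south).gm w * (lin c d .south w * lin c d .south w)
          = εm * (lin c d .south w - c * (p₀ * q₀) + d * (w • (p₁ * q₁) + (p₁ * q₀ + p₀ * q₁))
            - p₁ * q₁ * (p₀ * q₀) * d) := by
  obtain ⟨p₁, hp₁, p₀, hp₀, hpS, hpN⟩ := hM.exists_lin_of_zero (φ := fun α β => (S.B α β).ψp)
    (fun α β => (S.B α β).ψp_an) (fun α β => (S.B α β).ψp_odd) S.ψp_rel S.ψp_inv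
  obtain ⟨q₁, hq₁, q₀, hq₀, hqS, hqN⟩ := hM.exists_lin_of_zero (φ := fun α β => (S.B α β).ψm)
    (fun α β => (S.B α β).ψm_an) (fun α β => (S.B α β).ψm_odd) S.ψm_rel S.ψm_inv
  have hplow : ∀ α, ∀ w ∈ (S.B α .north).dom, (S.B α .north).ψp w ∈ lowOdd L := fun α w hw =>
    ⟨(S.B α .north).ψp_odd w hw, ((S.B α .north).ψp_an w hw).mem_lowAlg⟩
  have hmlow : ∀ α, ∀ w ∈ (S.B α .north).dom, (S.B α .north).ψm w ∈ lowOdd L := fun α w hw =>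
    ⟨(S.B α .north).ψm_odd w hw, ((S.B α .north).ψm_an w hw).mem_lowAlg⟩
  obtain ⟨εp, hεp, hgp⟩ := hM.exists_numerator_of_zero (g := fun α β => (S.B α β).gp)
    (φ := fun α β => (S.B α β).ψp) (φ' := fun α β => (S.B α β).ψm)
    (fun α β => (S.B α β).gp_an) (fun α β => (S.B α β).gp_even)
    (fun α w hw hw' => by simpa using S.gp_rel α w hw hw') S.gp_inv hp₁ hp₀ hq₁ hq₀
    hplow hmlow hpN hqN
  obtain ⟨εm, hεm, hgm⟩ := hM.exists_numerator_of_zero (g := fun α β => (S.B α β).gm)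
    (φ := fun α β => (S.B α β).ψm) (φ' := fun α β => (S.B α β).ψp)
    (fun α β => (S.B α β).gm_an) (fun α β => (S.B α β).gm_even)
    (fun α w hw hw' => by simpa using S.gm_rel α w hw hw') S.gm_inv hq₁ hq₀ hp₁ hp₀
    hmlow hplow hqN hpN
  have hgm' : ∀ w ∈ (S.B .south .south).dom,
      (S.B .south .south).gm w * (lin c d .south w * lin c d .south w)
        = εm * (lin c d .south w - c * (p₀ * q₀) + d * (w • (p₁ * q₁) + (p₁ * q₀ + p₀ * q₁))
          - p₁ * q₁ * (p₀ * q₀) * d) := by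
    intro w hw
    rw [hgm w hw, odd_anticomm hq₁.1 hp₁.1, odd_anticomm hq₀.1 hp₀.1, odd_anticomm hq₁.1 hp₀.1,
      odd_anticomm hq₀.1 hp₁.1]
    congr 1
    simp only [smul_neg, mul_neg, neg_mul, neg_neg, mul_add]
    abel
  have hprod : εp * εm = 1 - p₁ * q₀ - q₁ * p₀ := by
    obtain ⟨w, hw⟩ := (hM.eventually_mem_dom .south 0).exists
    have hα := lowOdd_mul hp₁ hq₁
    have hβ := lowOdd_mul hp₀ hq₀
    have hγ : p₁ * q₀ + p₀ * q₁ ∈ lowEven L := add_mem (lowOdd_mul hp₁ hq₀) (lowOdd_mul hp₀ hq₁)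
    obtain ⟨r₁, r₂, r₃, r₄, r₅⟩ := product_relations hp₁.1 hp₀.1 hq₁.1 hq₀.1
    have ht := hM.den_mem .south w
    have htu := hM.isUnit_den hw
    have hpr : (S.B .south .south).gp w * (S.B .south .south).gm w
        * (lin c d .south w * lin c d .south w) = 1 - p₁ * q₀ - q₁ * p₀ := by
      have hP := ((S.B .south .south).ψp_an w hw).wderiv_mul_lin_add
        (((S.B .south .south).eventually_mem_dom hw).mono fun v hv => hpS .south v hv)
      have hQ := ((S.B .south .south).ψm_an w hw).wderiv_mul_lin_add
        (((S.B .south .south).eventually_mem_dom hw).mono fun v hv => hqS .south v hv)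
      have h1 := hM.wderiv_f_mul hw
      rw [(S.B .south .south).cond w hw, add_mul, sub_mul] at h1
      have e1 : wderiv (S.B .south .south).ψp w * (S.B .south .south).ψm w
          * (lin c d .south w * lin c d .south w)
          = (p₁ - (S.B .south .south).ψp w * c) * lin q₁ q₀ .south w := by
        rw [← hP, add_sub_cancel_right, ← hqS .south w hw,
          (even_commute ht.1 _).mul_mul_mul_comm]
      have e2 : (S.B .south .south).ψp w * wderiv (S.B .south .south).ψm w
          * (lin c d .south w * lin c d .south w)
          = lin p₁ p₀ .south w * (q₁ - (S.B .south .south).ψm w * c) := by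
        rw [← hQ, add_sub_cancel_right, ← hpS .south w hw,
          (even_commute ht.1 _).mul_mul_mul_comm]
      have e3 : (S.B .south .south).ψp w * c * lin q₁ q₀ .south w
          = lin p₁ p₀ .south w * ((S.B .south .south).ψm w * c) := by
        rw [← hqS .south w hw, ← hpS .south w hw, (even_commute hM.hc.1 _).mul_mul_mul_comm,
          (even_commute ht.1 _).mul_mul_mul_comm, even_comm hM.hc.1]
      rw [e1, e2, sub_mul, mul_sub, e3] at h1
      have e4 : p₁ * lin q₁ q₀ .south w - lin p₁ p₀ .south w * q₁ = p₁ * q₀ + q₁ * p₀ := by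
        rw [odd_anticomm hq₁.1 hp₀.1]
        simp only [lin, mul_add, add_mul, mul_smul_comm, smul_mul_assoc]
        abel
      rw [sub_sub, ← e4]
      refine eq_sub_of_add_eq' (Eq.trans ?_ h1)
      abel
    have hpr' : (S.B .south .south).gp w * (S.B .south .south).gm w
        * (lin c d .south w * lin c d .south w) = εp * εm := by
      have htt := even_mul_mem ht.1 ht.1
      have hmul := mul_eq_of_numerators (R := lowEvenAlg L) (c := ⟨c, hM.hc⟩) (d := ⟨d, hM.hd⟩)
        (w := algebraMap ℂ _ w) (α := ⟨_, hα⟩) (β := ⟨_, hβ⟩) (γ := ⟨_, hγ⟩) (Subtype.ext r₁)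
        (Subtype.ext r₂) (Subtype.ext r₃) (Subtype.ext r₄) (by
          have : (⟨_, hγ⟩ : lowEvenAlg L) * ⟨_, hγ⟩
            = -(⟨_, hα⟩ * ⟨_, hβ⟩) - ⟨_, hα⟩ * ⟨_, hβ⟩ := Subtype.ext r₅
          rw [this]
          ring)
      simp only [← Algebra.smul_def] at hmul
      have hmul' := congrArg Subtype.val hmul
      change (lin c d .south w + c * (p₀ * q₀) - d * (w • (p₁ * q₁) + (p₁ * q₀ + p₀ * q₁))
          - p₁ * q₁ * (p₀ * q₀) * d) * (lin c d .south w - c * (p₀ * q₀)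
          + d * (w • (p₁ * q₁) + (p₁ * q₀ + p₀ * q₁)) - p₁ * q₁ * (p₀ * q₀) * d)
          = lin c d .south w * lin c d .south w at hmul'
      refine (htu.mul htu).mul_left_injective ?_
      simp only
      rw [mul_assoc, (even_commute ((S.B .south .south).gm_even w hw) _).mul_mul_mul_comm,
        hgp w hw, hgm' w hw, (even_commute hεm.1 _).symm.mul_mul_mul_comm, hmul']
    rw [← hpr', hpr]
  have hu : IsUnit (εp * εm) := by
    rw [hprod]
    refine isUnit_of_body_ne_zero (sub_mem (sub_mem one_mem_even (odd_mul_odd_mem hp₁.1 hq₀.1))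
      (odd_mul_odd_mem hq₁.1 hp₀.1)) ?_
    simp [body_odd hp₁.1, body_odd hq₁.1]
  obtain ⟨hu1, hu2⟩ := (even_commute hεp.1 εm).isUnit_mul_iff.1 hu
  exact ⟨p₁, hp₁, p₀, hp₀, q₁, hq₁, q₀, hq₀, εp, hεp, εm, hεm, hu1, hu2, hprod,
    fun w hw => ⟨hpS .south w hw, hqS .south w hw, hgp w hw, hgm' w hw⟩⟩

end IsMobius

end SphereMap

namespace SphereMap

namespace IsMobius

variable {n : ℤ} {S : SphereMap L n} {a b c d : Gr L} (hM : S.IsMobius a b c d)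
include hM

theorem exists_const_ψp (hn : 1 ≤ n) : ∃ ψ₀ ∈ lowOdd L, (2 ≤ n → ψ₀ = 0) ∧
    ∀ w ∈ (S.B .south .south).dom, (S.B .south .south).ψp w = ψ₀ := by
  obtain ⟨p, hp, h, -⟩ := hM.exists_sum_of_weight (φ := fun α β => (S.B α β).ψp) (k := 1 - n)
    (j := 0) one_ne_zero (fun α β => (S.B α β).ψp_an)
    (by simpa only [neg_sub] using S.ψp_rel)
    (fun β u hu hud => by rw [S.ψp_inv β u hu hud, one_mul, zpow_zero, one_smul]) (odd L)
    (fun x hx y hy => odd_mul_even_mem hx hy) fun β w hw => (S.B .south β).ψp_odd w hw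
  rcases hn.eq_or_lt with rfl | hn
  · refine ⟨p 0, hp 0, fun h => absurd h (by norm_num), fun w hw => ?_⟩
    simpa [ipow_zero] using h w hw
  · refine ⟨0, zero_mem _, fun _ => rfl, fun w hw => ?_⟩
    have h1 := h w hw
    rw [show (1 - n + 0 + 1).toNat = 0 by omega, Finset.range_zero, Finset.sum_empty] at h1
    exact (isUnit_ipow (hM.isUnit_den hw) _).mul_left_eq_zero.1 h1

theorem ψp_mul_ψm_eq_zero (hn : 1 ≤ n) (α : Pole) {w : ℂ} (hS : w ∈ (S.B α .south).dom)
    (hN : w ∈ (S.B α .north).dom) :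
    (n - 1) • ((S.B α .north).ψp w * (S.B α .north).ψm w) = 0 := by
  rcases hn.eq_or_lt with rfl | hn
  · rw [sub_self, zero_smul]
  obtain ⟨ψ₀, -, h0, h⟩ := hM.exists_const_ψp hn.le
  rw [h0 hn] at h
  have hz : ∀ α, ∀ w ∈ (S.B α .south).dom, (S.B α .south).ψp w = 0 := by
    rintro (_ | _)
    · exact h
    · exact S.eq_north_of_eq_south (β := .south) (A := fun α => (S.B α .south).ψp)
        (E := fun _ _ => 0) (c := 1) (m := 0) (S.B .north .south).ψp_an (fun u => .zero u)
        (fun u hu hud => by rw [S.ψp_inv _ u hu hud, one_mul, zpow_zero, one_smul])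
        (fun u _ => (smul_zero _).symm) h
  have h1 := S.ψp_rel α w hS hN
  rw [hz α w hS, eq_comm, smul_eq_zero_iff_right Complex.I_ne_zero] at h1
  rw [(isUnit_ipow (S.isUnit_f α w hS hN) _).mul_left_eq_zero.1 h1, zero_mul, smul_zero]

theorem exists_gp_eq (hn : 1 ≤ n) : ∃ ε ∈ lowEven L, IsUnit ε ∧
    ∀ w ∈ (S.B .south .south).dom,
      (S.B .south .south).gp w = ε * ipow (lin c d .south w) (n - 1) := by
  obtain ⟨p, hp, h, -⟩ := hM.exists_sum_of_weight (φ := fun α β => (S.B α β).gp) (k := 1 - n)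
    (j := n - 1) Complex.I_ne_zero (fun α β => (S.B α β).gp_an)
    (fun α w hS hN => by
      rw [S.gp_rel α w hS hN, hM.ψp_mul_ψm_eq_zero hn α hS hN, sub_zero, neg_sub, mul_assoc]
      congr 2
      have := ipow_mul_ipow (S.isUnit_f α w hS hN) (n - 1 - 1) 1
      rwa [ipow_one, sub_add_cancel] at this)
    S.gp_inv (even L) (fun x hx y hy => even_mul_mem hx hy)
    fun β w hw => (S.B .south β).gp_even w hw
  rw [show (1 - n + (n - 1) + 1).toNat = 1 by omega] at h
  simp only [Finset.range_one, Finset.sum_singleton, pow_zero, one_smul] at h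
  refine ⟨p 0, hp 0, ?_, fun w hw => ?_⟩
  · obtain ⟨w, hw⟩ := (hM.eventually_mem_dom .south 0).exists
    rw [← h w hw]
    exact (S.isUnit_gp _ _ w hw).mul (isUnit_ipow (hM.isUnit_den hw) _)
  · rw [← h w hw, mul_assoc, ipow_mul_ipow (hM.isUnit_den hw), sub_add_sub_cancel', sub_self,
      ipow_zero, mul_one]

theorem exists_ψm_sum (hn : 1 ≤ n) : ∃ p : ℕ → Gr L, (∀ j, p j ∈ lowOdd L) ∧
    ∀ w ∈ (S.B .south .south).dom,
      (S.B .south .south).ψm w * lin c d .south w ^ (n.toNat + 1)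
        = ∑ j ∈ Finset.range (n.toNat + 2), w ^ j • p j := by
  obtain ⟨p, hp, h, -⟩ := hM.exists_sum_of_weight (φ := fun α β => (S.B α β).ψm) (k := n + 1)
    (j := 0) one_ne_zero (fun α β => (S.B α β).ψm_an)
    (by simpa only [neg_add'] using S.ψm_rel)
    (fun β u hu hud => by rw [S.ψm_inv β u hu hud, one_mul, zpow_zero, one_smul]) (odd L)
    (fun x hx y hy => odd_mul_even_mem hx hy) fun β w hw => (S.B .south β).ψm_odd w hw
  refine ⟨p, hp, fun w hw => ?_⟩
  have h1 := h w hw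
  rw [show (n + 1 + 0 + 1).toNat = n.toNat + 2 by omega,
    show n + 1 = ((n.toNat + 1 : ℕ) : ℤ) by omega, ipow_natCast] at h1
  exact h1

theorem gm_eq {ψ₀ ε : Gr L}
    (hψ : ∀ w ∈ (S.B .south .south).dom, (S.B .south .south).ψp w = ψ₀) (hε : IsUnit ε)
    (hg : ∀ w ∈ (S.B .south .south).dom,
      (S.B .south .south).gp w = ε * ipow (lin c d .south w) (n - 1)) {w : ℂ}
    (hw : w ∈ (S.B .south .south).dom) :
    (S.B .south .south).gm w = ipow (lin c d .south w) (1 - n) * (ipow ε (-1) *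
      (ipow (lin c d .south w) (-2) + ψ₀ * wderiv (S.B .south .south).ψm w)) := by
  have htu := hM.isUnit_den hw
  have h1 : wderiv (S.B .south .south).ψp w = 0 := ((HasWeakDerivAt.const ψ₀ w).congr
    (((S.B .south .south).eventually_mem_dom hw).mono fun v hv => (hψ v hv).symm)).wderiv_eq
  have h2 : wderiv (S.B .south .south).f w = ipow (lin c d .south w) (-2) := by
    have e := ipow_mul_ipow htu 2 (-2)
    have e' : ipow (lin c d .south w) 2 = lin c d .south w * lin c d .south w :=
      (ipow_natCast _ 2).trans (pow_two _)
    rw [e', add_neg_cancel, ipow_zero] at e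
    calc _ = wderiv (S.B .south .south).f w * (lin c d .south w * lin c d .south w
          * ipow (lin c d .south w) (-2)) := by rw [e, mul_one]
      _ = _ := by rw [← mul_assoc, hM.wderiv_f_mul hw, one_mul]
  have h3 := (S.B .south .south).cond w hw
  rw [h1, h2, hψ w hw, hg w hw, zero_mul, zero_sub] at h3
  have e1 : ipow ε (-1) * ε = 1 := by
    have := ipow_mul_ipow hε (-1) 1
    rwa [ipow_one, neg_add_cancel, ipow_zero] at this
  have e2 : ipow (lin c d .south w) (1 - n) * ipow (lin c d .south w) (n - 1) = 1 := by
    rw [ipow_mul_ipow htu, sub_add_sub_cancel', sub_self, ipow_zero]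
  have hcomm := even_comm (ipow_mem_even (hM.den_mem .south w).1 (n - 1)) ε
  rw [h3, neg_add_eq_sub, sub_add_cancel, ← hcomm, mul_assoc, ← mul_assoc (ipow ε (-1)),
    ← even_comm (ipow_mem_even (hM.den_mem .south w).1 (n - 1)), mul_assoc, ← mul_assoc, e2,
    one_mul, ← mul_assoc, e1, one_mul]

end IsMobius

theorem wderiv_mul_den_cube {φ : ℂ → Gr L} {c d : Gr L} (hc : c ∈ lowEven L) (hd : d ∈ lowEven L)
    {p : ℕ → Gr L} {w : ℂ} (han : SuperAnalyticAt w φ)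
    (h : ∀ᶠ v in 𝓝 w, φ v * lin c d .south v ^ 2 = ∑ j ∈ Finset.range 3, v ^ j • p j) :
    wderiv φ w * lin c d .south w ^ 3
      = (2 * w) • (p 2 * d) - (w • (p 1 * c) - p 1 * d) - (2 : ℂ) • (p 0 * c) := by
  have ht : lin c d .south w ∈ lowEven L := lin_mem hc hd .south w
  have hlin := hasWeakDerivAt_lin c d w
  have htt := (lin_an hc.2 hd.2 .south w).hasWeakDerivAt_mul hlin hlin
  have h1 := (han.hasWeakDerivAt_mul han.hasWeakDerivAt htt).unique
    ((hasWeakDerivAt_quadratic p w).congr (h.mono fun v hv => by rw [pow_two] at hv; exact hv.symm))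
  rw [← even_comm hc.1 (lin c d .south w), ← two_mul] at h1
  have h2 : wderiv φ w * lin c d .south w ^ 3
      = (p 1 + (2 * w) • p 2) * lin c d .south w
        - (φ w * lin c d .south w ^ 2) * (2 * c) := by
    rw [← h1]
    have hc2 : Commute c (lin c d .south w) := even_comm hc.1 _
    have : φ w * lin c d .south w ^ 2 * (2 * c)
        = φ w * (2 * (c * lin c d .south w)) * lin c d .south w := by
      rw [mul_assoc, mul_assoc, pow_two, hc2.eq]
      congr 1
      simp only [two_mul, mul_add, add_mul, mul_assoc, hc2.eq]
    rw [this, add_mul, add_sub_cancel_right]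
    simp only [pow_succ, pow_zero, one_mul, mul_assoc]
  rw [h2, h.self_of_nhds, two_mul c]
  simp only [Finset.sum_range_succ, Finset.sum_range_zero, zero_add, lin, add_mul, mul_add,
    smul_mul_assoc, mul_smul_comm]
  module

end SphereMap

/-! ### Taylor extension of identities over the body -/

/-- `x` is the value at `z` of the superanalytic extension of `F`. -/
structure HasTaylor (z : Gr L) (F : ℂ → Gr L) (x : Gr L) : Prop where
  even : z ∈ even L
  an : SuperAnalyticAt (body z) F
  eq : taylor F z = x

namespace HasTaylor

variable {z x y : Gr L} {F G : ℂ → Gr L}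

theorem id (hz : z ∈ N2.even L) : HasTaylor z (fun v => algebraMap ℂ (Gr L) v) z :=
  ⟨hz, superAnalyticAt_algebraMap _, taylor_id hz⟩

theorem const (hz : z ∈ N2.even L) {a : Gr L} (ha : a ∈ lowAlg L) :
    HasTaylor z (fun _ => a) a :=
  ⟨hz, .const ha _, taylor_const hz⟩

theorem add (hF : HasTaylor z F x) (hG : HasTaylor z G y) :
    HasTaylor z (fun v => F v + G v) (x + y) :=
  ⟨hF.even, .add _ _ hF.an hG.an, by rw [taylor_add hF.even hF.an hG.an, hF.eq, hG.eq]⟩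

theorem mul (hF : HasTaylor z F x) (hG : HasTaylor z G y) :
    HasTaylor z (fun v => F v * G v) (x * y) :=
  ⟨hF.even, hF.an.mul hG.an, by rw [taylor_mul hF.even hF.an hG.an, hF.eq, hG.eq]⟩

theorem sub (hF : HasTaylor z F x) (hG : HasTaylor z G y) :
    HasTaylor z (fun v => F v - G v) (x - y) := by
  simpa only [neg_one_mul, ← sub_eq_add_neg] using
    hF.add ((const hF.even (neg_mem (one_mem (lowAlg L)))).mul hG)

theorem pow (hF : HasTaylor z F x) (k : ℕ) : HasTaylor z (fun v => F v ^ k) (x ^ k) :=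
  ⟨hF.even, hF.an.pow k, by rw [taylor_pow hF.even hF.an, hF.eq]⟩

theorem sum {ι : Type*} (s : Finset ι) {F : ι → ℂ → Gr L} {x : ι → Gr L} (hz : z ∈ N2.even L)
    (h : ∀ i ∈ s, HasTaylor z (F i) (x i)) :
    HasTaylor z (fun v => ∑ i ∈ s, F i v) (∑ i ∈ s, x i) :=
  ⟨hz, .sum s fun i hi => (h i hi).an, by
    rw [taylor_sum s hz fun i hi => (h i hi).an]
    exact Finset.sum_congr rfl fun i hi => (h i hi).eq⟩

theorem inverse (hF : HasTaylor z F x) (he : ∀ v, F v ∈ N2.even L) (hu : IsUnit (F (body z))) :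
    HasTaylor z (fun v => Ring.inverse (F v)) (Ring.inverse x) := by
  have han := hF.an.inverse (.of_forall he) hu
  refine ⟨hF.even, han, (inverse_eq_of_mul_eq_one ?_ ?_).symm⟩
  · rw [← hF.eq]
    exact taylor_mem _ hF.even (fun _ hx _ hy => even_mul_mem hx hy) hF.an (.of_forall he)
  · rw [← hF.eq, ← taylor_mul hF.even hF.an han, ← taylor_const (a := (1 : Gr L)) hF.even]
    refine taylor_congr ?_
    have hb := hF.an.body.continuousAt.eventually_ne (body_ne_zero_of_isUnit hu)
    filter_upwards [hb] with v hv
    exact Ring.mul_inverse_cancel _ (isUnit_of_body_ne_zero (he v) hv)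

theorem quo (hF : HasTaylor z F x) (hG : HasTaylor z G y) (he : ∀ v, G v ∈ N2.even L)
    (hu : IsUnit (G (body z))) : HasTaylor z (fun v => F v /ₛ G v) (x /ₛ y) :=
  hF.mul (hG.inverse he hu)

theorem ipow (hF : HasTaylor z F x) (he : ∀ v, F v ∈ N2.even L) (hu : IsUnit (F (body z)))
    (k : ℤ) : HasTaylor z (fun v => N2.ipow (F v) k) (N2.ipow x k) :=
  (hF.pow _).mul ((hF.inverse he hu).pow _)

theorem taylor_eq (hG : HasTaylor z G x) {V : Set ℂ} (hV : IsOpen V) (hz : body z ∈ V)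
    (h : ∀ w ∈ V, F w = G w) : taylor F z = x := by
  rw [← hG.eq]
  refine taylor_congr ?_
  filter_upwards [hV.mem_nhds hz] with v hv using h v hv

theorem lin {p q : Gr L} (hz : z ∈ N2.even L) (hp : p ∈ lowAlg L) (hq : q ∈ lowAlg L) :
    HasTaylor z (lin p q .south) (p * z + q) := by
  have h : N2.lin p q .south = fun w => p * algebraMap ℂ (Gr L) w + q := by
    ext w
    rw [← Algebra.commutes, ← Algebra.smul_def]
    rfl
  rw [h]
  exact ((const hz hp).mul (id hz)).add (const hz hq)

end HasTaylor

theorem eq_quo {x y t : Gr L} (hu : IsUnit t) (h : x * t = y) : x = y /ₛ t := by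
  rw [← h, quo, mul_assoc, Ring.mul_inverse_cancel _ hu, mul_one]

theorem eq_quo_add_quo {x e y t : Gr L} (hu : IsUnit t) (h : x * (t * t) = e * t + y) :
    x = e /ₛ t + y /ₛ t ^ 2 := by
  have h2 : e /ₛ t = (e * t) /ₛ t ^ 2 := by
    refine eq_quo (hu.pow 2) ?_
    rw [quo, mul_assoc, pow_two, ← mul_assoc _ t, Ring.inverse_mul_cancel _ hu, one_mul]
  rw [h2, quo, quo, ← add_mul]
  exact eq_quo (hu.pow 2) (by rw [pow_two, h])

theorem inverse_mul_eq {x y : Gr L} (hx : x ∈ even L) : Ring.inverse (x * y)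
    = Ring.inverse x * Ring.inverse y := by
  rw [Ring.mul_inverse_rev' (even_comm hx y), even_comm (inverse_mem_even hx)]

theorem ipow_neg_one (x : Gr L) : ipow x (-1) = Ring.inverse x := by simp [ipow]

theorem inverse_pow_two (x : Gr L) : Ring.inverse (x ^ 2) = ipow x (-2) := by
  have : ipow x (-2) = Ring.inverse x ^ 2 := by simp [ipow]
  rw [this, Ring.inverse_pow]

namespace SphereMap

namespace IsMobius

variable {n : ℤ} {S : SphereMap L n} {a b c d : Gr L} (hM : S.IsMobius a b c d)
include hM

theorem isUnit_den_iff {z : Gr L} (hz : z ∈ even L) :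
    IsUnit (c * z + d) ↔ body z ∈ (S.B .south .south).dom := by
  rw [hM.mem_dom_south_iff, isUnit_iff_body (add_mem (even_mul_mem hM.hc.1 hz) hM.hd.1),
    isUnit_iff_body (hM.den_mem _ _).1]
  simp [lin, mul_comm]

theorem taylor_f {z : Gr L} (hz : z ∈ even L) (hzd : body z ∈ (S.B .south .south).dom) :
    taylor (S.B .south .south).f z = (a * z + b) /ₛ (c * z + d) :=
  ((HasTaylor.lin hz hM.ha.2 hM.hb.2).quo (.lin hz hM.hc.2 hM.hd.2)
    (fun v => (hM.den_mem _ v).1) (hM.isUnit_den hzd)).taylor_eq (S.B .south .south).isOpen hzd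
    fun _ hw => hM.f_eq hw

theorem taylor_sum_quo {φ : ℂ → Gr L} {p : ℕ → Gr L} (hp : ∀ j, p j ∈ lowOdd L) {N k : ℕ}
    (h : ∀ w ∈ (S.B .south .south).dom, φ w * lin c d .south w ^ k
      = ∑ j ∈ Finset.range N, w ^ j • p j)
    {z : Gr L} (hz : z ∈ even L) (hzd : body z ∈ (S.B .south .south).dom) :
    taylor φ z = (∑ j ∈ Finset.range N, p j * z ^ j) /ₛ (c * z + d) ^ k := by
  refine HasTaylor.taylor_eq (G := fun w => (∑ j ∈ Finset.range N, p j * algebraMap ℂ (Gr L) w ^ j)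
    /ₛ lin c d .south w ^ k) ?_ (S.B .south .south).isOpen hzd fun w hw => ?_
  · exact (HasTaylor.sum _ hz fun j _ => (HasTaylor.const hz (hp j).2).mul ((HasTaylor.id hz).pow j)).quo
      ((HasTaylor.lin hz hM.hc.2 hM.hd.2).pow k) (fun v => even_pow_mem (hM.den_mem _ v).1 k)
      ((hM.isUnit_den hzd).pow k)
  · refine eq_quo ((hM.isUnit_den hw).pow k) ((h w hw).trans (Finset.sum_congr rfl fun j _ => ?_))
    rw [← map_pow, ← Algebra.commutes, ← Algebra.smul_def]

theorem taylor_lin_quo {φ : ℂ → Gr L} {p q : Gr L} (hp : p ∈ lowOdd L) (hq : q ∈ lowOdd L)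
    (h : ∀ w ∈ (S.B .south .south).dom, φ w * lin c d .south w = lin p q .south w)
    {z : Gr L} (hz : z ∈ even L) (hzd : body z ∈ (S.B .south .south).dom) :
    taylor φ z = (p * z + q) /ₛ (c * z + d) :=
  ((HasTaylor.lin hz hp.2 hq.2).quo (.lin hz hM.hc.2 hM.hd.2)
    (fun v => (hM.den_mem _ v).1) (hM.isUnit_den hzd)).taylor_eq (S.B .south .south).isOpen hzd
    fun w hw => eq_quo (hM.isUnit_den hw) (h w hw)

theorem taylor_add_quo {φ : ℂ → Gr L} {e p q : Gr L} (he : e ∈ lowEven L) (hp : p ∈ lowEven L)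
    (hq : q ∈ lowEven L) (h : ∀ w ∈ (S.B .south .south).dom,
      φ w * (lin c d .south w * lin c d .south w) = e * lin c d .south w + lin p q .south w)
    {z : Gr L} (hz : z ∈ even L) (hzd : body z ∈ (S.B .south .south).dom) :
    taylor φ z = e /ₛ (c * z + d) + (p * z + q) /ₛ (c * z + d) ^ 2 := by
  have hden := HasTaylor.lin hz hM.hc.2 hM.hd.2
  have hden2 : ∀ v, lin c d .south v ^ 2 ∈ even L := fun v => even_pow_mem (hM.den_mem _ v).1 2
  exact ((((HasTaylor.const hz he.2).quo hden (fun v => (hM.den_mem _ v).1)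
    (hM.isUnit_den hzd)).add ((HasTaylor.lin hz hp.2 hq.2).quo (hden.pow 2) hden2
      ((hM.isUnit_den hzd).pow 2))).taylor_eq (S.B .south .south).isOpen hzd
      fun w hw => eq_quo_add_quo (hM.isUnit_den hw) (h w hw))

/-- The odd components and `g⁺` of an automorphism of the sphere of index `n ≥ 1`, and `g⁻`
over the body. -/
theorem exists_taylor_pos (hn : 1 ≤ n) : ∃ ψ₀ ∈ lowOdd L, (2 ≤ n → ψ₀ = 0) ∧
    ∃ p : ℕ → Gr L, (∀ j, p j ∈ lowOdd L) ∧ ∃ ε ∈ lowEven L, IsUnit ε ∧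
      (∀ w ∈ (S.B .south .south).dom, (S.B .south .south).ψm w * lin c d .south w ^ (n.toNat + 1)
        = ∑ j ∈ Finset.range (n.toNat + 2), w ^ j • p j) ∧
      (∀ w ∈ (S.B .south .south).dom, (S.B .south .south).gm w =
        ipow (lin c d .south w) (1 - n) * (ipow ε (-1) *
          (ipow (lin c d .south w) (-2) + ψ₀ * wderiv (S.B .south .south).ψm w))) ∧
      ∀ z ∈ even L, body z ∈ (S.B .south .south).dom →
        taylor (S.B .south .south).ψp z = ψ₀ ∧
        taylor (S.B .south .south).ψm z
          = (∑ j ∈ Finset.range (n.toNat + 2), p j * z ^ j) /ₛ (c * z + d) ^ (n.toNat + 1) ∧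
        taylor (S.B .south .south).gp z = ε * ipow (c * z + d) (n - 1) := by
  obtain ⟨ψ₀, hψ₀, h2, hψ⟩ := hM.exists_const_ψp hn
  obtain ⟨ε, hε, hεu, hg⟩ := hM.exists_gp_eq hn
  obtain ⟨p, hp, hm⟩ := hM.exists_ψm_sum hn
  refine ⟨ψ₀, hψ₀, h2, p, hp, ε, hε, hεu, hm, fun w hw => hM.gm_eq hψ hεu hg hw,
    fun z hz hzd => ⟨?_, hM.taylor_sum_quo hp hm hz hzd, ?_⟩⟩
  · exact (HasTaylor.const hz hψ₀.2).taylor_eq (S.B .south .south).isOpen hzd hψ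
  · exact ((HasTaylor.const hz hε.2).mul ((HasTaylor.lin hz hM.hc.2 hM.hd.2).ipow
      (fun v => (hM.den_mem _ v).1) (hM.isUnit_den hzd) _)).taylor_eq
      (S.B .south .south).isOpen hzd hg

theorem exists_taylor_of_two_le (hn : 2 ≤ n) :
    ∃ p : ℕ → Gr L, (∀ j, p j ∈ lowOdd L) ∧ ∃ ε ∈ lowEven L, IsUnit ε ∧
      ∀ z ∈ even L, body z ∈ (S.B .south .south).dom →
        taylor (S.B .south .south).ψp z = 0 ∧
        taylor (S.B .south .south).ψm z
          = (∑ j ∈ Finset.range (n.toNat + 2), p j * z ^ j) /ₛ (c * z + d) ^ (n.toNat + 1) ∧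
        taylor (S.B .south .south).gp z = ε * ipow (c * z + d) (n - 1) ∧
        taylor (S.B .south .south).gm z = ipow ε (-1) * ipow (c * z + d) (-n - 1) := by
  obtain ⟨ψ₀, hψ₀, h2, p, hp, ε, hε, hεu, -, hgm, h⟩ := hM.exists_taylor_pos (by omega)
  obtain rfl := h2 hn
  refine ⟨p, hp, ε, hε, hεu, fun z hz hzd => ?_⟩
  obtain ⟨h1, h2, h3⟩ := h z hz hzd
  refine ⟨h1, h2, h3, ?_⟩
  refine ((HasTaylor.const hz (ipow_mem_lowEven hε _).2).mul ((HasTaylor.lin hz hM.hc.2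
    hM.hd.2).ipow (fun v => (hM.den_mem _ v).1) (hM.isUnit_den hzd) _)).taylor_eq
    (S.B .south .south).isOpen hzd fun w hw => ?_
  rw [hgm w hw, zero_mul, add_zero, even_comm (ipow_mem_even (hM.den_mem _ w).1 _), mul_assoc,
    ipow_mul_ipow (hM.isUnit_den hw)]
  congr 2
  omega

theorem exists_taylor_of_eq_one (hn : n = 1) :
    ∃ ψ₀ ∈ lowOdd L, ∃ q₀ ∈ lowOdd L, ∃ q₁ ∈ lowOdd L, ∃ q₂ ∈ lowOdd L,
    ∃ ε ∈ lowEven L, IsUnit ε ∧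
      ∀ z ∈ even L, body z ∈ (S.B .south .south).dom →
        taylor (S.B .south .south).ψp z = ψ₀ ∧
        taylor (S.B .south .south).ψm z = (q₂ * z ^ 2 + q₁ * z + q₀) /ₛ (c * z + d) ^ 2 ∧
        taylor (S.B .south .south).gp z = ε ∧
        taylor (S.B .south .south).gm z = 1 /ₛ (ε * (c * z + d) ^ 2)
          + (ψ₀ * (2 * q₂ * d * z - q₁ * (c * z - d) - 2 * q₀ * c)) /ₛ (ε * (c * z + d) ^ 3) := by
  subst hn
  obtain ⟨ψ₀, hψ₀, -, p, hp, ε, hε, hεu, hm, hgm, h⟩ := hM.exists_taylor_pos le_rfl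
  have e0 : (1 : ℤ).toNat = 1 := rfl
  simp only [e0, Nat.reduceAdd] at hm h
  refine ⟨ψ₀, hψ₀, p 0, hp 0, p 1, hp 1, p 2, hp 2, ε, hε, hεu, fun z hz hzd => ?_⟩
  obtain ⟨h1, h2, h3⟩ := h z hz hzd
  refine ⟨h1, ?_, ?_, ?_⟩
  · rw [h2]
    congr 1
    simp only [Finset.sum_range_succ, Finset.sum_range_zero, pow_zero, mul_one, pow_one]
    abel
  · rw [h3, sub_self, ipow_zero, mul_one]
  have hone : (1 : Gr L) ∈ lowAlg L := one_mem _
  have htwo : (2 : Gr L) ∈ lowAlg L := by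
    rw [← one_add_one_eq_two]
    exact add_mem hone hone
  have hden := HasTaylor.lin hz hM.hc.2 hM.hd.2
  have hde : ∀ k v, ε * lin c d .south v ^ k ∈ even L := fun k v =>
    even_mul_mem hε.1 (even_pow_mem (hM.den_mem _ v).1 k)
  have hdu := hM.isUnit_den hzd
  have key := ((HasTaylor.const hz hone).quo ((HasTaylor.const hz hε.2).mul (hden.pow 2)) (hde 2)
    (hεu.mul (hdu.pow 2))).add (((HasTaylor.const hz hψ₀.2).mul
    (((((HasTaylor.const hz (mul_mem (mul_mem htwo (hp 2).2) hM.hd.2)).mul (.id hz)).sub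
      ((HasTaylor.const hz (hp 1).2).mul (((HasTaylor.const hz hM.hc.2).mul (.id hz)).sub
        (.const hz hM.hd.2))))).sub (HasTaylor.const hz (mul_mem (mul_mem htwo (hp 0).2)
          hM.hc.2)))).quo ((HasTaylor.const hz hε.2).mul (hden.pow 3)) (hde 3)
          (hεu.mul (hdu.pow 3)))
  refine key.taylor_eq (S.B .south .south).isOpen hzd fun w hw => ?_
  have hw' := hM.isUnit_den hw
  have hder := wderiv_mul_den_cube hM.hc hM.hd ((S.B .south .south).ψm_an w hw)
    (((S.B .south .south).eventually_mem_dom hw).mono fun v hv => hm v hv)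
  have hR : 2 * p 2 * d * algebraMap ℂ (Gr L) w - p 1 * (c * algebraMap ℂ (Gr L) w - d)
      - 2 * p 0 * c = wderiv (S.B .south .south).ψm w * lin c d .south w ^ 3 := by
    rw [hder]
    simp only [← Algebra.commutes w, ← Algebra.smul_def, two_mul, add_mul, mul_sub, mul_smul_comm]
    module
  rw [hR, hgm w hw, sub_self, ipow_zero, one_mul, mul_add, quo, quo, inverse_mul_eq hε.1,
    inverse_mul_eq hε.1, one_mul, ipow_neg_one, inverse_pow_two]
  congr 1
  rw [even_comm (inverse_mem_even hε.1), even_comm (inverse_mem_even hε.1) (Ring.inverse _),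
    mul_assoc ψ₀, mul_assoc ψ₀, ← mul_assoc (wderiv _ w * _), mul_assoc (wderiv _ w),
    Ring.mul_inverse_cancel _ (hw'.pow 3), mul_one]

end IsMobius

theorem IsMobius.exists_taylor_zero {S : SphereMap L 0} {a b c d : Gr L}
    (hM : S.IsMobius a b c d) :
    ∃ p₀ ∈ lowOdd L, ∃ p₁ ∈ lowOdd L, ∃ q₀ ∈ lowOdd L, ∃ q₁ ∈ lowOdd L,
    ∃ εp ∈ lowEven L, ∃ εm ∈ lowEven L,
    ∃ fp ∈ lowEven L, ∃ fm ∈ lowEven L, ∃ hp ∈ lowEven L, ∃ hm ∈ lowEven L,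
      IsUnit εp ∧ IsUnit εm ∧
      εp * εm = 1 - p₁ * q₀ - q₁ * p₀ ∧
      fp = -(εp * p₁ * q₁ * d) ∧
      fm = εm * p₁ * q₁ * d ∧
      hp = εp * (p₀ * q₀ * c - (p₁ * q₀ - q₁ * p₀) * d - p₁ * q₁ * p₀ * q₀ * d) ∧
      hm = -(εm * (p₀ * q₀ * c - (p₁ * q₀ - q₁ * p₀) * d + p₁ * q₁ * p₀ * q₀ * d)) ∧
      ∀ z ∈ even L, body z ∈ (S.B .south .south).dom →
        taylor (S.B .south .south).ψp z = (p₁ * z + p₀) /ₛ (c * z + d) ∧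
        taylor (S.B .south .south).ψm z = (q₁ * z + q₀) /ₛ (c * z + d) ∧
        taylor (S.B .south .south).gp z
          = εp /ₛ (c * z + d) + (fp * z + hp) /ₛ (c * z + d) ^ 2 ∧
        taylor (S.B .south .south).gm z
          = εm /ₛ (c * z + d) + (fm * z + hm) /ₛ (c * z + d) ^ 2 := by
  obtain ⟨p₁, hp₁, p₀, hp₀, q₁, hq₁, q₀, hq₀, εp, hεp, εm, hεm, hup, hum, hprod, h⟩ :=
    hM.exists_components_zero
  have hα := lowOdd_mul hp₁ hq₁
  have hβ := lowOdd_mul hp₀ hq₀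
  have hγ : p₁ * q₀ - q₁ * p₀ ∈ lowEven L := sub_mem (lowOdd_mul hp₁ hq₀) (lowOdd_mul hq₁ hp₀)
  have hαβ : p₁ * q₁ * p₀ * q₀ ∈ lowEven L := by
    rw [mul_assoc _ p₀]
    exact lowEven_mul hα hβ
  have hfp : -(εp * p₁ * q₁ * d) ∈ lowEven L := by
    rw [mul_assoc εp]
    exact neg_mem (lowEven_mul (lowEven_mul hεp hα) hM.hd)
  have hfm : εm * p₁ * q₁ * d ∈ lowEven L := by
    rw [mul_assoc εm]
    exact lowEven_mul (lowEven_mul hεm hα) hM.hd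
  have hhp : εp * (p₀ * q₀ * c - (p₁ * q₀ - q₁ * p₀) * d - p₁ * q₁ * p₀ * q₀ * d) ∈ lowEven L :=
    lowEven_mul hεp (sub_mem (sub_mem (lowEven_mul hβ hM.hc) (lowEven_mul hγ hM.hd))
      (lowEven_mul hαβ hM.hd))
  have hhm : -(εm * (p₀ * q₀ * c - (p₁ * q₀ - q₁ * p₀) * d + p₁ * q₁ * p₀ * q₀ * d)) ∈ lowEven L :=
    neg_mem (lowEven_mul hεm (add_mem (sub_mem (lowEven_mul hβ hM.hc) (lowEven_mul hγ hM.hd))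
      (lowEven_mul hαβ hM.hd)))
  refine ⟨p₀, hp₀, p₁, hp₁, q₀, hq₀, q₁, hq₁, εp, hεp, εm, hεm, _, hfp, _, hfm, _, hhp, _, hhm,
    hup, hum, hprod, rfl, rfl, rfl, rfl, fun z hz hzd => ⟨?_, ?_, ?_, ?_⟩⟩
  · exact hM.taylor_lin_quo hp₁ hp₀ (fun w hw => (h w hw).1) hz hzd
  · exact hM.taylor_lin_quo hq₁ hq₀ (fun w hw => (h w hw).2.1) hz hzd
  · refine hM.taylor_add_quo hεp hfp hhp (fun w hw => ?_) hz hzd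
    rw [(h w hw).2.2.1, even_comm hM.hc.1, even_comm hM.hd.1, odd_anticomm hp₀.1 hq₁.1]
    generalize lin c d .south w = t
    simp only [lin, mul_add, mul_sub, add_mul, sub_mul, smul_mul_assoc, mul_smul_comm, mul_neg,
      neg_mul, smul_neg, mul_assoc]
    abel
  · refine hM.taylor_add_quo hεm hfm hhm (fun w hw => ?_) hz hzd
    rw [(h w hw).2.2.2, even_comm hM.hc.1, even_comm hM.hd.1, odd_anticomm hp₀.1 hq₁.1]
    generalize lin c d .south w = t
    simp only [lin, mul_add, mul_sub, add_mul, sub_mul, smul_mul_assoc, mul_smul_comm, mul_neg,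
      neg_mul, mul_assoc]
    abel

end SphereMap

/-! ### Uniqueness -/

namespace IsComponents

variable {H H' : SPoint L →. SPoint L} {f gp gm ψp ψm f' gp' gm' ψp' ψm' : Coeff L}

theorem eq_of_eventuallyEq (hH : IsComponents H f gp gm ψp ψm) (ho : IsOpen H.Dom)
    (hH' : IsComponents H' f' gp' gm' ψp' ψm') (ho' : IsOpen H'.Dom) {x y y' : SPoint L}
    (hy : y ∈ H x) (hy' : y' ∈ H' x)
    (hf : f.onBody =ᶠ[𝓝 x.base] f'.onBody) (hgp : gp.onBody =ᶠ[𝓝 x.base] gp'.onBody)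
    (hgm : gm.onBody =ᶠ[𝓝 x.base] gm'.onBody) (hψp : ψp.onBody =ᶠ[𝓝 x.base] ψp'.onBody)
    (hψm : ψm.onBody =ᶠ[𝓝 x.base] ψm'.onBody) : y = y' := by
  have hV := (image_base_dom ho).1
  have hV' := (image_base_dom ho').1
  have hx : body x.z ∈ SPoint.base '' H.Dom := ⟨x, (PFun.mem_dom _ _).2 ⟨y, hy⟩, rfl⟩
  have hx' : body x.z ∈ SPoint.base '' H'.Dom := ⟨x, (PFun.mem_dom _ _).2 ⟨y', hy'⟩, rfl⟩
  have key : ∀ {F F' : Coeff L}, F.IsAnalytic (SPoint.base '' H.Dom) →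
      F'.IsAnalytic (SPoint.base '' H'.Dom) → F.onBody =ᶠ[𝓝 x.base] F'.onBody →
      F.eval x.z = F'.eval x.z ∧ F.der.eval x.z = F'.der.eval x.z := by
    intro F F' hF hF' h
    rw [hF.eval_eq_taylor hV hx, hF'.eval_eq_taylor hV' hx', hF.eval_der hV hx,
      hF'.eval_der hV' hx']
    exact ⟨taylor_congr h, taylor_congr (wderiv_eventuallyEq h)⟩
  obtain ⟨e1, -⟩ := key hH.f_analytic hH'.f_analytic hf
  obtain ⟨e2, -⟩ := key hH.gp_analytic hH'.gp_analytic hgp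
  obtain ⟨e3, -⟩ := key hH.gm_analytic hH'.gm_analytic hgm
  obtain ⟨e4, e5⟩ := key hH.ψp_analytic hH'.ψp_analytic hψp
  obtain ⟨e6, e7⟩ := key hH.ψm_analytic hH'.ψm_analytic hψm
  ext1
  · rw [hH.z_eq x y hy, hH'.z_eq x y' hy', e1, e2, e3, e4, e5, e6, e7]
  · rw [hH.θp_eq x y hy, hH'.θp_eq x y' hy', e2, e4, e5]
  · rw [hH.θm_eq x y hy, hH'.θm_eq x y' hy', e3, e6, e7]

theorem eq_of_punctured (hL : 1 < L) (hH : IsComponents H f gp gm ψp ψm) (ho : IsOpen H.Dom)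
    (hH' : IsComponents H' f' gp' gm' ψp' ψm') (ho' : IsOpen H'.Dom) {x y y' : SPoint L}
    (hy : y ∈ H x) (hy' : y' ∈ H' x)
    (h : ∀ᶠ v in 𝓝[≠] x.base, ∀ θ θ' : odd L, H (bodyPoint v θ θ') = H' (bodyPoint v θ θ')) :
    y = y' := by
  have hB := hH.represents ho
  have hB' := hH'.represents ho'
  have hx := (hB.mem_dom x).1 ((PFun.mem_dom _ _).2 ⟨y, hy⟩)
  have hx' := (hB'.mem_dom x).1 ((PFun.mem_dom _ _).2 ⟨y', hy'⟩)
  have hev : ∀ᶠ v in 𝓝[≠] x.base, f.onBody v = f'.onBody v ∧ gp.onBody v = gp'.onBody v ∧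
      gm.onBody v = gm'.onBody v ∧ ψp.onBody v = ψp'.onBody v ∧ ψm.onBody v = ψm'.onBody v := by
    filter_upwards [h, ((hH.bodyMap ho).eventually_mem_dom hx).filter_mono nhdsWithin_le_nhds,
      ((hH'.bodyMap ho').eventually_mem_dom hx').filter_mono nhdsWithin_le_nhds] with v h1 h2 h3
    exact hB.components_eq hL hB' h2 h3 h1
  exact hH.eq_of_eventuallyEq ho hH' ho' hy hy'
    (((hH.bodyMap ho).f_an _ hx).eventuallyEq_of_punctured ((hH'.bodyMap ho').f_an _ hx')
      (hev.mono fun _ hv => hv.1))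
    (((hH.bodyMap ho).gp_an _ hx).eventuallyEq_of_punctured ((hH'.bodyMap ho').gp_an _ hx')
      (hev.mono fun _ hv => hv.2.1))
    (((hH.bodyMap ho).gm_an _ hx).eventuallyEq_of_punctured ((hH'.bodyMap ho').gm_an _ hx')
      (hev.mono fun _ hv => hv.2.2.1))
    (((hH.bodyMap ho).ψp_an _ hx).eventuallyEq_of_punctured ((hH'.bodyMap ho').ψp_an _ hx')
      (hev.mono fun _ hv => hv.2.2.2.1))
    (((hH.bodyMap ho).ψm_an _ hx).eventuallyEq_of_punctured ((hH'.bodyMap ho').ψm_an _ hx')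
      (hev.mono fun _ hv => hv.2.2.2.2))

end IsComponents

namespace Sphere

variable {n : ℤ}

/-- The component functions of all expressions of an injective map of the sphere. -/
structure ChartComponents (T : Sphere L n → Sphere L n) where
  f : Pole → Pole → Coeff L
  gp : Pole → Pole → Coeff L
  gm : Pole → Pole → Coeff L
  ψp : Pole → Pole → Coeff L
  ψm : Pole → Pole → Coeff L
  isComponents : ∀ α β, IsComponents (expr T α β) (f α β) (gp α β) (gm α β) (ψp α β) (ψm α β)
  isOpen : ∀ α β, IsOpen (expr T α β).Dom
  injective : Function.Injective T

theorem exists_chartComponents (hL : 1 < L) {T : Sphere L n → Sphere L n} (hT : T ∈ Aut L n) :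
    Nonempty (ChartComponents T) := by
  have h : ∀ α β, IsOpen (expr T α β).Dom ∧
      ∃ f gp gm ψp ψm : Coeff L, IsComponents (expr T α β) f gp gm ψp ψm := by
    intro α β
    by_cases hne : (expr T α β).Dom.Nonempty
    · exact ⟨(hT.2 α β hne).1, (hT.2 α β hne).exists_isComponents hL⟩
    · rw [Set.not_nonempty_iff_eq_empty] at hne
      exact ⟨hne ▸ isOpen_empty, 0, 0, 0, 0, 0, isComponents_of_dom_eq_empty hne⟩
  choose ho f gp gm ψp ψm hc using h
  exact ⟨⟨f, gp, gm, ψp, ψm, hc, ho, hT.1.injective⟩⟩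

namespace ChartComponents

variable {T : Sphere L n → Sphere L n} (C : ChartComponents T)

/-- The restrictions of the component functions to the body. -/
noncomputable def bodyMap (α β : Pole) : BodyMap L := (C.isComponents α β).bodyMap (C.isOpen α β)

theorem represents (α β : Pole) : (C.bodyMap α β).Represents (expr T α β) :=
  (C.isComponents α β).represents (C.isOpen α β)

/-- The associated compatible system of maps over the body. -/
noncomputable def sphereMap (hL : 1 < L) : SphereMap L n :=
  Sphere.sphereMap C.represents hL C.injective

theorem mem_dom (α β : Pole) (x : SPoint L) :
    x ∈ (expr T α β).Dom ↔ body x.z ∈ (C.bodyMap α β).dom := (C.represents α β).mem_dom x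

variable {T' : Sphere L n → Sphere L n} (C' : ChartComponents T')

theorem mem_both_of_punctured (hL : 1 < L) {α : Pole} {w : ℂ}
    (h : ∀ᶠ v in 𝓝[≠] w, ∀ θ θ' : odd L,
      T (point α (bodyPoint v θ θ')) = T' (point α (bodyPoint v θ θ')))
    (hw : w ∈ (C.bodyMap α .south).dom) (hw' : w ∈ (C'.bodyMap α .north).dom) :
    w ∈ (C.bodyMap α .north).dom ∨ w ∈ (C'.bodyMap α .south).dom := by
  by_contra! hcon
  have h1 : ¬ IsUnit ((C.bodyMap α .south).f w) := fun hu =>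
    hcon.1 ((C.sphereMap hL).mem_north α w hw hu)
  have he := (C.bodyMap α .south).f_even w hw
  have h2 : (fun v => (C.bodyMap α .south).f v * (C'.bodyMap α .north).f v) =ᶠ[𝓝 w] fun _ => 1 := by
    refine (((C.bodyMap α .south).f_an w hw).mul
      ((C'.bodyMap α .north).f_an w hw')).eventuallyEq_of_punctured (.const (one_mem _) w) ?_
    filter_upwards [h, ((C.bodyMap α .south).eventually_mem_dom hw).filter_mono nhdsWithin_le_nhds,
      ((C'.bodyMap α .north).eventually_mem_dom hw').filter_mono nhdsWithin_le_nhds] with v h3 h4 h5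
    have h6 : ∀ θ θ' : odd L, expr T α .north (bodyPoint v θ θ')
        = expr T' α .north (bodyPoint v θ θ') := fun θ θ' => by rw [expr, expr, h3]
    have h7 : v ∈ (C.bodyMap α .north).dom := by
      obtain ⟨y, hy⟩ := (C'.represents α .north).exists_mem h5 0 0
      exact (C.represents α .north).mem_dom_of_mem ((h6 0 0).symm ▸ hy)
    rw [← ((C.represents α .north).components_eq hL (C'.represents α .north) h7 h5 h6).1]
    exact (C.sphereMap hL).f_mul_f α h4 h7
  refine h1 (isUnit_of_body_ne_zero he fun h0 => ?_)
  have h3 := congrArg body h2.self_of_nhds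
  rw [map_mul, h0, zero_mul, map_one] at h3
  exact zero_ne_one h3

include C C'

theorem eq_of_punctured (hL : 1 < L) {α : Pole} {x : SPoint L}
    (h : ∀ᶠ v in 𝓝[≠] x.base, ∀ θ θ' : odd L,
      T (point α (bodyPoint v θ θ')) = T' (point α (bodyPoint v θ θ'))) :
    T (point α x) = T' (point α x) := by
  have key : ∀ β, x.base ∈ (C.bodyMap α β).dom → x.base ∈ (C'.bodyMap α β).dom →
      T (point α x) = T' (point α x) := by
    intro β hβ hβ'
    obtain ⟨y, hy⟩ := (PFun.mem_dom _ _).1 ((C.mem_dom α β x).2 hβ)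
    obtain ⟨y', hy'⟩ := (PFun.mem_dom _ _).1 ((C'.mem_dom α β x).2 hβ')
    have : y = y' := (C.isComponents α β).eq_of_punctured hL (C.isOpen α β)
      (C'.isComponents α β) (C'.isOpen α β) hy hy'
      (h.mono fun v hv θ θ' => by rw [expr, expr, hv])
    subst this
    exact eq_of_mem_chart hy hy'
  rcases (C.sphereMap hL).cover α x.base with h1 | h1 <;>
    rcases (C'.sphereMap hL).cover α x.base with h2 | h2
  · exact key _ h1 h2
  · rcases C.mem_both_of_punctured C' hL h h1 h2 with h3 | h3
    · exact key _ h3 h2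
    · exact key _ h1 h3
  · rcases C'.mem_both_of_punctured C hL (h.mono fun v hv θ θ' => (hv θ θ').symm) h2 h1
      with h3 | h3
    · exact key _ h1 h3
    · exact key _ h3 h2
  · exact key _ h1 h2

theorem eq_of_southExpr_eq (hL : 1 < L) (h : southExpr T = southExpr T') : T = T' := by
  obtain ⟨a, b, c, d, hM⟩ := (C.sphereMap hL).exists_isMobius
  have hsouth : ∀ x, T (point .south x) = T' (point .south x) := fun x =>
    C.eq_of_punctured C' hL <| by
      filter_upwards [hM.eventually_mem_dom .south x.base] with v hv θ θ'
      obtain ⟨y, hy⟩ := (C.represents .south .south).exists_mem hv θ θ'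
      exact eq_of_mem_chart hy (show y ∈ southExpr T' _ from h ▸ hy)
  have hunit : ∀ x : SPoint L, IsUnit x.z → T (point .north x) = T' (point .north x) :=
    fun x hx => by rw [point_north_eq hx, hsouth]
  have hnorth : ∀ x, T (point .north x) = T' (point .north x) := fun x =>
    C.eq_of_punctured C' hL <| by
      have h0 : ∀ᶠ v in 𝓝[≠] x.base, v ≠ 0 := by
        by_cases hu0 : x.base = 0
        · rw [hu0]
          exact self_mem_nhdsWithin
        · exact (eventually_ne_nhds hu0).filter_mono nhdsWithin_le_nhds
      filter_upwards [h0] with v hv θ θ'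
      exact hunit _ ((IsUnit.mk0 v hv).map (algebraMap ℂ (Gr L)))
  ext P
  rcases mem_southChart_or P with ⟨y, hy⟩ | ⟨y, hy⟩
  · rw [← point_of_mem_chart _ _ _ hy, hsouth]
  · rw [← point_of_mem_chart _ _ _ hy, hnorth]

end ChartComponents

end Sphere

end N2


theorem theorem4p1 (L : ℕ∞) (hL : 1 < L) (n : ℤ) :
    -- an automorphism is determined by its expression in the southern chart
    Set.InjOn southExpr (Aut L n) ∧
    -- the southern expression has the following component functions
    ∀ T ∈ Aut L n, ∃ f gp gm ψp ψm : Coeff L,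
      IsComponents (southExpr T) f gp gm ψp ψm ∧
      ∃ a ∈ lowEven L, ∃ b ∈ lowEven L, ∃ c ∈ lowEven L, ∃ d ∈ lowEven L,
        a * d - b * c = 1 ∧
        (southExpr T).Dom = {x | IsUnit (c * x.z + d)} ∧
        (∀ z ∈ even L, IsUnit (c * z + d) → f.eval z = (a * z + b) /ₛ (c * z + d)) ∧
        (n = 0 →
          ∃ ψp₀ ∈ lowOdd L, ∃ ψp₁ ∈ lowOdd L, ∃ ψm₀ ∈ lowOdd L, ∃ ψm₁ ∈ lowOdd L,
          ∃ εp ∈ lowEven L, ∃ εm ∈ lowEven L,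
          ∃ fp ∈ lowEven L, ∃ fm ∈ lowEven L, ∃ hp ∈ lowEven L, ∃ hm ∈ lowEven L,
            IsUnit εp ∧ IsUnit εm ∧
            εp * εm = 1 - ψp₁ * ψm₀ - ψm₁ * ψp₀ ∧
            fp = -(εp * ψp₁ * ψm₁ * d) ∧
            fm = εm * ψp₁ * ψm₁ * d ∧
            hp = εp * (ψp₀ * ψm₀ * c - (ψp₁ * ψm₀ - ψm₁ * ψp₀) * d
              - ψp₁ * ψm₁ * ψp₀ * ψm₀ * d) ∧
            hm = -(εm * (ψp₀ * ψm₀ * c - (ψp₁ * ψm₀ - ψm₁ * ψp₀) * d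
              + ψp₁ * ψm₁ * ψp₀ * ψm₀ * d)) ∧
            ∀ z ∈ even L, IsUnit (c * z + d) →
              ψp.eval z = (ψp₁ * z + ψp₀) /ₛ (c * z + d) ∧
              ψm.eval z = (ψm₁ * z + ψm₀) /ₛ (c * z + d) ∧
              gp.eval z = εp /ₛ (c * z + d) + (fp * z + hp) /ₛ (c * z + d) ^ 2 ∧
              gm.eval z = εm /ₛ (c * z + d) + (fm * z + hm) /ₛ (c * z + d) ^ 2) ∧
        (n = 1 →
          ∃ ψp₀ ∈ lowOdd L, ∃ ψm₀ ∈ lowOdd L, ∃ ψm₁ ∈ lowOdd L, ∃ ψm₂ ∈ lowOdd L,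
          ∃ ε ∈ lowEven L, IsUnit ε ∧
            ∀ z ∈ even L, IsUnit (c * z + d) →
              ψp.eval z = ψp₀ ∧
              ψm.eval z = (ψm₂ * z ^ 2 + ψm₁ * z + ψm₀) /ₛ (c * z + d) ^ 2 ∧
              gp.eval z = ε ∧
              gm.eval z = 1 /ₛ (ε * (c * z + d) ^ 2)
                + (ψp₀ * (2 * ψm₂ * d * z - ψm₁ * (c * z - d) - 2 * ψm₀ * c))
                  /ₛ (ε * (c * z + d) ^ 3)) ∧
        (n = -1 →
          ∃ ψm₀ ∈ lowOdd L, ∃ ψp₀ ∈ lowOdd L, ∃ ψp₁ ∈ lowOdd L, ∃ ψp₂ ∈ lowOdd L,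
          ∃ ε ∈ lowEven L, IsUnit ε ∧
            ∀ z ∈ even L, IsUnit (c * z + d) →
              ψp.eval z = (ψp₂ * z ^ 2 + ψp₁ * z + ψp₀) /ₛ (c * z + d) ^ 2 ∧
              ψm.eval z = ψm₀ ∧
              gp.eval z = 1 /ₛ (ε * (c * z + d) ^ 2)
                - ((2 * ψp₂ * d * z - ψp₁ * (c * z - d) - 2 * ψp₀ * c) * ψm₀)
                  /ₛ (ε * (c * z + d) ^ 3) ∧
              gm.eval z = ε) ∧
        (2 ≤ n →
          ∃ ψ : ℕ → Gr L, (∀ j, ψ j ∈ lowOdd L) ∧ ∃ ε ∈ lowEven L, IsUnit ε ∧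
            ∀ z ∈ even L, IsUnit (c * z + d) →
              ψp.eval z = 0 ∧
              ψm.eval z = (∑ j ∈ Finset.range (n.toNat + 2), ψ j * z ^ j)
                /ₛ (c * z + d) ^ (n.toNat + 1) ∧
              gp.eval z = ε * ipow (c * z + d) (n - 1) ∧
              gm.eval z = ipow ε (-1) * ipow (c * z + d) (-n - 1)) ∧
        (n ≤ -2 →
          ∃ ψ : ℕ → Gr L, (∀ j, ψ j ∈ lowOdd L) ∧ ∃ ε ∈ lowEven L, IsUnit ε ∧
            ∀ z ∈ even L, IsUnit (c * z + d) →
              ψp.eval z = (∑ j ∈ Finset.range ((-n).toNat + 2), ψ j * z ^ j)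
                /ₛ (c * z + d) ^ ((-n).toNat + 1) ∧
              ψm.eval z = 0 ∧
              gp.eval z = ipow ε (-1) * ipow (c * z + d) (n - 1) ∧
              gm.eval z = ε * ipow (c * z + d) (-n - 1)) := by
  refine ⟨fun T hT T' hT' h => ?_, fun T hT => ?_⟩
  · obtain ⟨C⟩ := exists_chartComponents hL hT
    obtain ⟨C'⟩ := exists_chartComponents hL hT'
    exact C.eq_of_southExpr_eq C' hL h
  obtain ⟨C⟩ := exists_chartComponents hL hT
  obtain ⟨a, b, c, d, hM⟩ := (C.sphereMap hL).exists_isMobius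
  have hC := C.isComponents .south .south
  have hV := (image_base_dom (C.isOpen .south .south)).1
  have hdom : ∀ z ∈ even L, IsUnit (c * z + d) → body z ∈ (C.bodyMap .south .south).dom :=
    fun z hz hu => (hM.isUnit_den_iff hz).1 hu
  refine ⟨C.f .south .south, C.gp .south .south, C.gm .south .south, C.ψp .south .south,
    C.ψm .south .south, hC, a, hM.ha, b, hM.hb, c, hM.hc, d, hM.hd, hM.det, ?_, ?_, ?_, ?_, ?_,
    ?_, ?_⟩
  · ext x
    exact (C.mem_dom .south .south x).trans (hM.isUnit_den_iff x.z_even).symm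
  · intro z hz hu
    rw [hC.f_analytic.eval_eq_taylor hV (hdom z hz hu)]
    exact hM.taylor_f hz (hdom z hz hu)
  · rintro rfl
    obtain ⟨p₀, hp₀, p₁, hp₁, q₀, hq₀, q₁, hq₁, εp, hεp, εm, hεm, fp, hfp, fm, hfm, hp, hhp, hm,
      hhm, e₁, e₂, e₃, e₄, e₅, e₆, e₇, h⟩ := hM.exists_taylor_zero
    refine ⟨p₀, hp₀, p₁, hp₁, q₀, hq₀, q₁, hq₁, εp, hεp, εm, hεm, fp, hfp, fm, hfm, hp, hhp, hm,
      hhm, e₁, e₂, e₃, e₄, e₅, e₆, e₇, fun z hz hu => ?_⟩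
    have hzd := hdom z hz hu
    rw [hC.ψp_analytic.eval_eq_taylor hV hzd, hC.ψm_analytic.eval_eq_taylor hV hzd,
      hC.gp_analytic.eval_eq_taylor hV hzd, hC.gm_analytic.eval_eq_taylor hV hzd]
    exact h z hz hzd
  · intro hn
    obtain ⟨ψ₀, hψ₀, q₀, hq₀, q₁, hq₁, q₂, hq₂, ε, hε, hεu, h⟩ := hM.exists_taylor_of_eq_one hn
    refine ⟨ψ₀, hψ₀, q₀, hq₀, q₁, hq₁, q₂, hq₂, ε, hε, hεu, fun z hz hu => ?_⟩
    have hzd := hdom z hz hu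
    rw [hC.ψp_analytic.eval_eq_taylor hV hzd, hC.ψm_analytic.eval_eq_taylor hV hzd,
      hC.gp_analytic.eval_eq_taylor hV hzd, hC.gm_analytic.eval_eq_taylor hV hzd]
    exact h z hz hzd
  · intro hn
    obtain ⟨ψ₀, hψ₀, q₀, hq₀, q₁, hq₁, q₂, hq₂, ε, hε, hεu, h⟩ :=
      hM.swap.exists_taylor_of_eq_one (by omega)
    refine ⟨ψ₀, hψ₀, q₀, hq₀, q₁, hq₁, q₂, hq₂, ε, hε, hεu, fun z hz hu => ?_⟩
    have hzd := hdom z hz hu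
    rw [hC.ψp_analytic.eval_eq_taylor hV hzd, hC.ψm_analytic.eval_eq_taylor hV hzd,
      hC.gp_analytic.eval_eq_taylor hV hzd, hC.gm_analytic.eval_eq_taylor hV hzd]
    obtain ⟨h₁, h₂, h₃, h₄⟩ := h z hz hzd
    refine ⟨h₂, h₁, h₄.trans ?_, h₃⟩
    have hodd : 2 * q₂ * d * z - q₁ * (c * z - d) - 2 * q₀ * c ∈ odd L := by
      refine sub_mem (sub_mem (odd_mul_even_mem (odd_mul_even_mem ?_ hM.hd.1) hz)
        (odd_mul_even_mem hq₁.1 (sub_mem (even_mul_mem hM.hc.1 hz) hM.hd.1)))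
        (odd_mul_even_mem ?_ hM.hc.1)
      · rw [two_mul]
        exact add_mem hq₂.1 hq₂.1
      · rw [two_mul]
        exact add_mem hq₀.1 hq₀.1
    rw [odd_anticomm hψ₀.1 hodd, quo, quo, quo, neg_mul, ← sub_eq_add_neg]
  · intro hn
    obtain ⟨p, hp, ε, hε, hεu, h⟩ := hM.exists_taylor_of_two_le hn
    refine ⟨p, hp, ε, hε, hεu, fun z hz hu => ?_⟩
    have hzd := hdom z hz hu
    rw [hC.ψp_analytic.eval_eq_taylor hV hzd, hC.ψm_analytic.eval_eq_taylor hV hzd,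
      hC.gp_analytic.eval_eq_taylor hV hzd, hC.gm_analytic.eval_eq_taylor hV hzd]
    exact h z hz hzd
  · intro hn
    obtain ⟨p, hp, ε, hε, hεu, h⟩ := hM.swap.exists_taylor_of_two_le (by omega)
    refine ⟨p, hp, ε, hε, hεu, fun z hz hu => ?_⟩
    have hzd := hdom z hz hu
    rw [hC.ψp_analytic.eval_eq_taylor hV hzd, hC.ψm_analytic.eval_eq_taylor hV hzd,
      hC.gp_analytic.eval_eq_taylor hV hzd, hC.gm_analytic.eval_eq_taylor hV hzd]
    obtain ⟨h₁, h₂, h₃, h₄⟩ := h z hz hzd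
    rw [neg_neg] at h₄
    exact ⟨h₂, h₁, h₄, h₃⟩
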